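/- Let $m\ge 0$, $N\ge 1$ and $V=(V_{ij}):\mathbb R\to\mathbb C^{2\times2}$ with $V_{11},V_{22}\in W^{N+1,\infty}_{\rm loc}(\mathbb R)$ and $V_{12},V_{21}\in W^{N,\infty}_{\rm loc}(\mathbb R)$ (continuous representatives). Let $H_V$ be the maximal Dirac operator in $L^2(\mathbb R)\oplus L^2(\mathbb R)$, $$H_Vf=\begin{pmatrix}(-i\partial_x+V_{12})f_2+(V_{11}+m)f_1\\(-i\partial_x+V_{21})f_1+(V_{22}-m)f_2\end{pmatrix},\qquad \mathcal D(H_V)=\{f\in L^2\oplus L^2: H_Vf\in L^2\oplus L^2\},$$ the derivatives being distributional. Put $F(x)=\int_0^x(\mathrm{Im}V_{11}+\mathrm{Im}V_{22})\,dt$ and assume: 1. $\limsup_{x\to-\infty}(\mathrm{Im}V_{11}+\mathrm{Im}V_{22})<0<\liminf_{x\to+\infty}(\mathrm{Im}V_{11}+\mathrm{Im}V_{22})$, and there are $\mu_\pm\in(0,1]$ with $|\mathrm{Im}V_{11}+\mathrm{Im}V_{22}|\ge\mu_\pm(|\mathrm{Im}V_{11}|+|\mathrm{Im}V_{22}|)$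 near $\pm\infty$; 2. there are $\varepsilon_\pm\in(0,\mu_\pm/2)$ with $\int_0^x(\mathrm{Im}V_{12}+\mathrm{Im}V_{21})\,dt\le2\varepsilon_\pm F(x)$ near $\pm\infty$; 3. there are a continuous $f:\mathbb R\to\mathbb R$, unbounded at $+\infty$ and at $-\infty$, with $|f(x)|\le C F(x)$ for all large $|x|$, and $\nu_\pm\in\mathbb R$, such that, as $x\to\pm\infty$, $|V_{ii}^{(n)}|=\mathcal O(|f|^{n\nu_\pm}|V_{ii}|)$ for $i=1,2$, $1\le n\le N+1$, and $|(V_{21}-V_{12})^{(n)}|=\mathcal O(|f|^{(n+1)\nu_\pm})$ for $0\le n\le N$ (almost everywhere); if $\nu_\pm<0$, then moreover $|f|$ is bounded below by a positive constant near $\pm\infty$. *Phase.* For real $\lambda\ne0$ let $k_1=e^{-i\int_0^xV_{21}}$, $k_2=e^{-i\int_0^xV_{12}}$, $V_\lambda=(\lambda-m-V_{11})(\lambda+m-V_{22})$, $K_\lambda=\frac{k_1}{k_2}\frac1{\lambda+m-V_{22}}$. Define $\psi_{-1}'=\operatorname{sgn}(\lambda)\, i\lambda^{-1}V_\lambda^{1/2}$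 (principal root), $\psi_{\ell+1}'=\frac1{2\psi_{-1}'}\big(\psi_\ell''+\frac{K_\lambda'}{K_\lambda}\psi_\ell'-\sum_{j=0}^{\ell}\psi_j'\psi_{\ell-j}'\big)$ for $\ell\ge-1$, $\psi_k(0)=0$, and $P_{\lambda,N}=\sum_{k=-1}^{N-1}\lambda^{-k}\psi_k$. *Cut-off.* Fix $\varepsilon_1\in(0,1)$ and let $\eta>0$. Call the end $\pm\infty$ tame if $\mathrm{Re}V_{11},\mathrm{Re}V_{22},\mathrm{Im}V_{11}-\mathrm{Im}V_{22}$ are bounded there. Let $g_\pm$ be the maximum of those of the following terms that apply (and $0$ if none does): $\frac1\eta|\mathrm{Re}V_{11}+m|$, $\frac1\eta|\mathrm{Re}V_{22}-m|$, $\frac1\eta|\mathrm{Im}V_{11}-\mathrm{Im}V_{22}|$ if $\pm\infty$ is not tame; $|f|^{2\nu_\pm/(1-\varepsilon_1)}$ if $\nu_\pm>0$. If $\pm\infty$ is tame and $\nu_\pm\le0$, put $\delta^\pm_\lambda=+\infty$, $\Delta^\pm_\lambda=0$; otherwise $\delta^\pm_\lambda=\inf\{x\ge0:g_\pm(\pm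 x)=|\lambda|\}$, $\Delta^\pm_\lambda=1/\delta^\pm_\lambda$. An admissible family of cut-offs consists of $\xi=\xi_\lambda\in C^\infty(\mathbb R;[0,1])$ ($|\lambda|$ large) with $\xi=1$ on $(-\delta^-_\lambda+\Delta^-_\lambda,\delta^+_\lambda-\Delta^+_\lambda)$, $\xi=0$ outside $(-\delta^-_\lambda,\delta^+_\lambda)$, and $|\xi^{(j)}|\,(\Delta^\pm_\lambda)^{j}\le C_0$ on $\mathbb R_\pm$ for $j=1,2$, with $C_0$ independent of $\lambda$. Put $$\Psi_{\lambda,N}=\begin{pmatrix}k_1u\\k_2v\end{pmatrix},\qquad u=\xi e^{-P_{\lambda,N}},\qquad v=\frac{k_1}{k_2}\,\frac{-i\,\partial_xu}{\lambda+m-V_{22}},$$ $$\kappa(\lambda)=\frac{\Big\|\frac{k_1e^{-P_{\lambda,N}}}{\lambda+m-V_{22}}\xi''\Big\|+\Big\|\frac{k_1e^{-P_{\lambda,N}}}{\lambda+m-V_{22}}\big(2P_{\lambda,N}'-\frac{K_\lambda'}{K_\lambda}\big)\xi'\Big\|}{\sqrt{\|k_1e^{-P_{\lambda,N}}\xi\|^2+\Big\|\frac{k_1(-i\partial_x)(e^{-P_{\lambda,N}}\xi)}{\lambda+m-V_{22}}\Big\|^2}}\qquad(L^2(\mathbb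 R)\text{-norms}).$$ **Claim.** There is $\eta_0\in(0,\min\{\mu_-,\mu_+\}]$ such that for every $\eta\in(0,\eta_0)$ admissible families of cut-offs exist, and for each of them the following holds as $\lambda\to+\infty$ and as $\lambda\to-\infty$: for $|\lambda|$ large, $0\ne\Psi_{\lambda,N}\in\mathcal D(H_V)$; $$\frac{\|(H_V-\lambda)\Psi_{\lambda,N}\|}{\|\Psi_{\lambda,N}\|}=o(1);\qquad \frac{\|(H_V-\lambda)\Psi_{\lambda,N}\|}{\|\Psi_{\lambda,N}\|}\le\kappa(\lambda)+\mathcal O\big(r_-(\lambda)+r_+(\lambda)\big),$$ where $r_\pm(\lambda)=|\lambda|^{-N}$ if $\nu_\pm\le0$ and $r_\pm(\lambda)=|\lambda|^{-\frac{1+\varepsilon_1}2(N+1)+1}$ if $\nu_\pm>0$; and $\kappa(\lambda)=o(1)$. More precisely, there are $d_1,d_2>0$ with $\kappa(\lambda)=\mathcal O(\kappa_-(\lambda)+\kappa_+(\lambda))$, where $\kappa_\pm(\lambda)=0$ if $\pm\infty$ is tame and $\nu_\pm\le0$, and $\kappa_\pm(\lambda)=\exp\big(-d_1F(\pm d_2\delta^\pm_\lambda)\big)$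 otherwise. -/

import Mathlib

open MeasureTheory Filter Topology Complex
open scoped ContDiff ENNReal

noncomputable section

namespace DiracWKB

/-! ### Local Sobolev spaces on the line -/

/-- `u ∈ L^∞_loc(ℝ)`. -/
def MemLinftyLoc (u : ℝ → ℂ) : Prop :=
  ∀ R : ℝ, MemLp u ∞ (volume.restrict (Set.Icc (-R) R))

/-- `w` is the weak (distributional) derivative of `u`. -/
def IsWeakDeriv (u w : ℝ → ℂ) : Prop :=
  ∀ φ : ℝ → ℂ, ContDiff ℝ ∞ φ → HasCompactSupport φ →
    ∫ x, u x * deriv φ x = -∫ x, w x * φ x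

/-- `u ∈ W^{k,∞}_loc(ℝ)`: the weak derivatives of order `0, …, k` exist and are locally
essentially bounded. -/
def MemWLoc (k : ℕ) (u : ℝ → ℂ) : Prop :=
  ∃ w : ℕ → ℝ → ℂ, w 0 = u ∧ (∀ j ≤ k, MemLinftyLoc (w j)) ∧
    ∀ j < k, IsWeakDeriv (w j) (w (j + 1))

/-! ### The Dirac operator -/

/-- The values of spinors, `ℂ²` with its Euclidean norm. -/
abbrev Spinor : Type := EuclideanSpace ℂ (Fin 2)

/-- The Hilbert space `L²(ℝ) ⊕ L²(ℝ) = L²(ℝ; ℂ²)`. -/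
abbrev Hilb : Type := Lp Spinor 2 (volume : Measure ℝ)

/-- `H_V f = g` in the sense of distributions, where
`H_V f = ((-i∂ + V₁₂) f₂ + (V₁₁ + m) f₁, (-i∂ + V₂₁) f₁ + (V₂₂ - m) f₂)`.
The first clause (which is automatic when `V ∈ L²_loc` and `f ∈ L²`) makes `V f` a distribution. -/
def IsDiracImage (m : ℝ) (V : ℝ → Matrix (Fin 2) (Fin 2) ℂ) (f g : ℝ → Spinor) : Prop :=
  (∀ i j, LocallyIntegrable (fun x => V x i j * f x j)) ∧
  ∀ φ : ℝ → ℂ, ContDiff ℝ ∞ φ → HasCompactSupport φ →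
    (∫ x, (I * f x 1 * deriv φ x + (V x 0 1 * f x 1 + (V x 0 0 + m) * f x 0) * φ x)
        = ∫ x, g x 0 * φ x) ∧
    (∫ x, (I * f x 0 * deriv φ x + (V x 1 0 * f x 0 + (V x 1 1 - m) * f x 1) * φ x)
        = ∫ x, g x 1 * φ x)

lemma IsDiracImage.congr {m : ℝ} {V : ℝ → Matrix (Fin 2) (Fin 2) ℂ} {f g f' g' : ℝ → Spinor}
    (h : IsDiracImage m V f g) (hf : f =ᵐ[volume] f') (hg : g =ᵐ[volume] g') :
    IsDiracImage m V f' g' := by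
  refine ⟨fun i j => (h.1 i j).congr ?_, fun φ h1 h2 => ?_⟩
  · filter_upwards [hf] with x hx
    rw [hx]
  · obtain ⟨e1, e2⟩ := h.2 φ h1 h2
    refine ⟨Eq.trans (Eq.trans (integral_congr_ae ?_) e1) (integral_congr_ae ?_),
      Eq.trans (Eq.trans (integral_congr_ae ?_) e2) (integral_congr_ae ?_)⟩ <;>
    · filter_upwards [hf, hg] with x hx hx'
      simp only [hx, hx']

lemma Hilb.locallyIntegrable_apply (f : Hilb) (i : Fin 2) :
    LocallyIntegrable (fun x => f x i) := by
  have h : LocallyIntegrable (fun x => f x) := (Lp.memLp f).locallyIntegrable (by norm_num)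
  intro x
  obtain ⟨s, hs, hs'⟩ := h x
  exact ⟨s, hs, (EuclideanSpace.proj (𝕜 := ℂ) i).integrable_comp hs'⟩

lemma integrable_mul_test {u φ : ℝ → ℂ} (hu : LocallyIntegrable u) (hφ : Continuous φ)
    (hc : HasCompactSupport φ) : Integrable (fun x => u x * φ x) := by
  have := hu.integrable_smul_right_of_hasCompactSupport hφ hc
  simpa [smul_eq_mul] using this

lemma IsDiracImage.integrable {m : ℝ} {V : ℝ → Matrix (Fin 2) (Fin 2) ℂ} {f : Hilb}
    (h : ∀ i j, LocallyIntegrable (fun x => V x i j * f x j)) {φ : ℝ → ℂ}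
    (h1 : ContDiff ℝ ∞ φ) (h2 : HasCompactSupport φ) :
    Integrable (fun x => I * f x 1 * deriv φ x +
      (V x 0 1 * f x 1 + (V x 0 0 + m) * f x 0) * φ x) ∧
    Integrable (fun x => I * f x 0 * deriv φ x +
      (V x 1 0 * f x 0 + (V x 1 1 - m) * f x 1) * φ x) := by
  have hd : Continuous (deriv φ) := h1.continuous_deriv (by simp)
  have hφ := h1.continuous
  have A (i : Fin 2) := (integrable_mul_test (Hilb.locallyIntegrable_apply f i) hd h2.deriv).const_mul I
  have B (i : Fin 2) := (integrable_mul_test (Hilb.locallyIntegrable_apply f i) hφ h2).const_mul (m : ℂ)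
  have C (i j : Fin 2) := integrable_mul_test (h i j) hφ h2
  constructor
  · refine ((A 1).add (((C 0 1).add (C 0 0)).add (B 0))).congr (ae_of_all _ fun x => ?_)
    simp only [Pi.add_apply]; ring
  · refine ((A 0).add (((C 1 0).add (C 1 1)).sub (B 1))).congr (ae_of_all _ fun x => ?_)
    simp only [Pi.add_apply, Pi.sub_apply]; ring

/-- The graph of `H_V` with its maximal domain `{f ∈ ℋ : H_V f ∈ ℋ}`. -/
def diracGraph (m : ℝ) (V : ℝ → Matrix (Fin 2) (Fin 2) ℂ) : Submodule ℂ (Hilb × Hilb) where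
  carrier := {p | IsDiracImage m V p.1 p.2}
  zero_mem' := by
    have h0 : IsDiracImage m V (fun _ => 0) (fun _ => 0) := by
      refine ⟨fun i j => ?_, fun φ _ _ => ?_⟩ <;> simp [locallyIntegrable_zero]
    exact h0.congr (Lp.coeFn_zero _ _ _).symm (Lp.coeFn_zero _ _ _).symm
  add_mem' := by
    rintro ⟨f, g⟩ ⟨f', g'⟩ h h'
    change IsDiracImage m V f g at h
    change IsDiracImage m V f' g' at h'
    have key : IsDiracImage m V (fun x => f x + f' x) (fun x => g x + g' x) := by
      refine ⟨fun i j => ?_, fun φ h1 h2 => ?_⟩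
      · refine ((h.1 i j).add (h'.1 i j)).congr (ae_of_all _ fun x => ?_)
        simp [mul_add]
      · obtain ⟨e1, e2⟩ := h.2 φ h1 h2
        obtain ⟨e1', e2'⟩ := h'.2 φ h1 h2
        obtain ⟨i1, i2⟩ := IsDiracImage.integrable (m := m) h.1 h1 h2
        obtain ⟨i1', i2'⟩ := IsDiracImage.integrable (m := m) h'.1 h1 h2
        have G (u : Hilb) (i : Fin 2) :=
          integrable_mul_test (Hilb.locallyIntegrable_apply u i) h1.continuous h2
        have s1 := integral_add i1 i1'
        have s2 := integral_add i2 i2'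
        have t1 := integral_add (G g 0) (G g' 0)
        have t2 := integral_add (G g 1) (G g' 1)
        rw [e1, e1', ← t1] at s1
        rw [e2, e2', ← t2] at s2
        constructor
        · refine Eq.trans (integral_congr_ae (ae_of_all _ fun x => ?_))
            (s1.trans (integral_congr_ae (ae_of_all _ fun x => ?_)))
          · simp only [PiLp.add_apply]; ring
          · simp only [PiLp.add_apply]; ring
        · refine Eq.trans (integral_congr_ae (ae_of_all _ fun x => ?_))
            (s2.trans (integral_congr_ae (ae_of_all _ fun x => ?_)))
          · simp only [PiLp.add_apply]; ring
          · simp only [PiLp.add_apply]; ring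
    exact key.congr (Lp.coeFn_add f f').symm (Lp.coeFn_add g g').symm
  smul_mem' := by
    rintro c ⟨f, g⟩ h
    change IsDiracImage m V f g at h
    have key : IsDiracImage m V (fun x => c • f x) (fun x => c • g x) := by
      refine ⟨fun i j => ?_, fun φ h1 h2 => ?_⟩
      · refine ((h.1 i j).smul c).congr (ae_of_all _ fun x => ?_)
        simp only [Pi.smul_apply, PiLp.smul_apply, smul_eq_mul]; ring
      · obtain ⟨e1, e2⟩ := h.2 φ h1 h2
        have s1 := congrArg (fun z => c * z) e1
        have s2 := congrArg (fun z => c * z) e2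
        simp only [← integral_const_mul] at s1 s2
        constructor
        · refine Eq.trans (integral_congr_ae (ae_of_all _ fun x => ?_))
            (s1.trans (integral_congr_ae (ae_of_all _ fun x => ?_)))
          · simp only [PiLp.smul_apply, smul_eq_mul]; ring
          · simp only [PiLp.smul_apply, smul_eq_mul]; ring
        · refine Eq.trans (integral_congr_ae (ae_of_all _ fun x => ?_))
            (s2.trans (integral_congr_ae (ae_of_all _ fun x => ?_)))
          · simp only [PiLp.smul_apply, smul_eq_mul]; ring
          · simp only [PiLp.smul_apply, smul_eq_mul]; ring
    exact key.congr (Lp.coeFn_smul c f).symm (Lp.coeFn_smul c g).symm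

/-- The graph is single-valued, so that it is the graph of an operator. -/
lemma diracGraph_single_valued (m : ℝ) (V : ℝ → Matrix (Fin 2) (Fin 2) ℂ) :
    ∀ p ∈ diracGraph m V, p.1 = 0 → p.2 = 0 := by
  rintro ⟨f, g⟩ h hf
  simp only at hf
  subst hf
  have h' : IsDiracImage m V (fun _ => 0) g :=
    IsDiracImage.congr (show IsDiracImage m V (0 : Hilb) g from h) (Lp.coeFn_zero _ _ _)
      (ae_eq_refl _)
  have hz (i : Fin 2) : ∀ᵐ x, g x i = 0 := by
    refine ae_eq_zero_of_integral_contDiff_smul_eq_zero (Hilb.locallyIntegrable_apply g i)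
      fun φ h1 h2 => ?_
    obtain ⟨e1, e2⟩ := h'.2 (fun x => (φ x : ℂ)) (ofRealCLM.contDiff.comp h1)
      (h2.comp_left (g := fun t : ℝ => (t : ℂ)) (by simp))
    fin_cases i
    · simpa [mul_comm] using e1.symm
    · simpa [mul_comm] using e2.symm
  refine Lp.ext ?_
  filter_upwards [hz 0, hz 1, Lp.coeFn_zero Spinor 2 (volume : Measure ℝ)] with x h0 h1 h2
  rw [h2]
  ext i
  fin_cases i
  · simpa using h0
  · simpa using h1

/-- The Dirac operator `H_V`, an unbounded operator in `L²(ℝ; ℂ²)` with maximal domain. -/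
def diracOp (m : ℝ) (V : ℝ → Matrix (Fin 2) (Fin 2) ℂ) : Hilb →ₗ.[ℂ] Hilb :=
  (diracGraph m V).toLinearPMap

/-! ### The two ends of the line and the assumption on the potential -/

/-- The two ends `-∞` and `+∞` of the real line; they index the constants `μ_±`, `ε_±`, `ν_±`. -/
inductive Side
  | minus
  | plus

/-- The sign of an end. The condition `a ≤ s.sgn * x` describes a neighbourhood of the end `s`. -/
def Side.sgn : Side → ℝ
  | .minus => -1
  | .plus => 1

/-- `h` is bounded at the end `s`. -/
def BoundedAt (s : Side) (h : ℝ → ℝ) : Prop :=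
  ∃ C a : ℝ, ∀ x, a ≤ s.sgn * x → |h x| ≤ C

/-- `Im V₁₁ + Im V₂₂`. -/
def imDiag (V : ℝ → Matrix (Fin 2) (Fin 2) ℂ) (x : ℝ) : ℝ := (V x 0 0).im + (V x 1 1).im

/-- `F(x) = ∫₀ˣ (Im V₁₁ + Im V₂₂)`. -/
def bigF (V : ℝ → Matrix (Fin 2) (Fin 2) ℂ) (x : ℝ) : ℝ := ∫ t in (0 : ℝ)..x, imDiag V t

/-- The hypotheses on the potential `V`, the function `f` and the constants `μ_±`, `ε_±`, `ν_±`.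
Functions in `W^{k,∞}_loc(ℝ)` with `k ≥ 1` are identified with their continuous representatives;
their classical derivatives of order `≤ k` then exist almost everywhere and coincide with the
weak ones. -/
structure AssumptionA (V : ℝ → Matrix (Fin 2) (Fin 2) ℂ) (N : ℕ) (f : ℝ → ℝ)
    (μ ε ν : Side → ℝ) : Prop where
  diag_continuous : ∀ i, Continuous fun x => V x i i
  diag_sobolev : ∀ i, MemWLoc (N + 1) fun x => V x i i
  off_continuous : 1 ≤ N → ∀ i j, i ≠ j → Continuous fun x => V x i j
  off_sobolev : ∀ i j, i ≠ j → MemWLoc N fun x => V x i j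
  limsup_neg : limsup (fun x => ((imDiag V x : ℝ) : EReal)) atBot < 0
  liminf_pos : 0 < liminf (fun x => ((imDiag V x : ℝ) : EReal)) atTop
  μ_mem : ∀ s, μ s ∈ Set.Ioc 0 1
  diag_sign : ∀ s, ∃ a > 0, ∀ x, a ≤ s.sgn * x →
    μ s * (|(V x 0 0).im| + |(V x 1 1).im|) ≤ |(V x 0 0).im + (V x 1 1).im|
  ε_mem : ∀ s, ε s ∈ Set.Ioo 0 (μ s / 2)
  off_control : ∀ s, ∃ a > 0, ∀ x, a ≤ s.sgn * x →
    ∫ t in (0 : ℝ)..x, ((V t 0 1).im + (V t 1 0).im) ≤ 2 * ε s * bigF V x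
  f_continuous : Continuous f
  f_unbounded : ∀ s, ¬ BoundedAt s f
  f_le : ∃ C > 0, ∃ a > 0, ∀ x, a ≤ |x| → |f x| ≤ C * bigF V x
  /-- For `ν_± < 0` the weight `|f|^{ν_±}` is bounded near the corresponding end. -/
  f_lower : ∀ s, ν s < 0 → ∃ c > 0, ∃ a > 0, ∀ x, a ≤ s.sgn * x → c ≤ |f x|
  diag_deriv : ∀ s i, ∀ n : ℕ, 1 ≤ n → n ≤ N + 1 → ∃ C a : ℝ, ∀ᵐ x, a ≤ s.sgn * x →
    ‖iteratedDeriv n (fun y => V y i i) x‖ ≤ C * (|f x| ^ (n * ν s) * ‖V x i i‖)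
  off_deriv : ∀ s, ∀ n : ℕ, n ≤ N → ∃ C a : ℝ, ∀ᵐ x, a ≤ s.sgn * x →
    ‖iteratedDeriv n (fun y => V y 1 0 - V y 0 1) x‖ ≤ C * |f x| ^ ((n + 1) * ν s)

/-! ### The WKB phase -/

/-- `k₁(x) = exp(-i ∫₀ˣ V₂₁)`. -/
def k₁ (V : ℝ → Matrix (Fin 2) (Fin 2) ℂ) (x : ℝ) : ℂ := exp (-I * ∫ t in (0 : ℝ)..x, V t 1 0)

/-- `k₂(x) = exp(-i ∫₀ˣ V₁₂)`. -/
def k₂ (V : ℝ → Matrix (Fin 2) (Fin 2) ℂ) (x : ℝ) : ℂ := exp (-I * ∫ t in (0 : ℝ)..x, V t 0 1)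

/-- `V_λ = (λ - m - V₁₁)(λ + m - V₂₂)`. -/
def Vlam (m : ℝ) (V : ℝ → Matrix (Fin 2) (Fin 2) ℂ) (lam x : ℝ) : ℂ :=
  (lam - m - V x 0 0) * (lam + m - V x 1 1)

/-- `K_λ = (k₁ / k₂) / (λ + m - V₂₂)`. -/
def Klam (m : ℝ) (V : ℝ → Matrix (Fin 2) (Fin 2) ℂ) (lam x : ℝ) : ℂ :=
  k₁ V x / k₂ V x * (1 / (lam + m - V x 1 1))

/-- `dpsi m V lam k = ψ'_{k-1}`: the index is shifted by one, and the functions are given by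
`ψ'_{-1} = ± i λ⁻¹ V_λ^{1/2}` (principal square root, with the sign of `λ`) and
`ψ'_{ℓ+1} = (ψ''_ℓ + (K_λ'/K_λ) ψ'_ℓ - ∑_{j=0}^{ℓ} ψ'_j ψ'_{ℓ-j}) / (2 ψ'_{-1})`, `ℓ ≥ -1`. -/
def dpsi (m : ℝ) (V : ℝ → Matrix (Fin 2) (Fin 2) ℂ) (lam : ℝ) : ℕ → ℝ → ℂ
  | 0 => fun x => (Real.sign lam : ℂ) * I * (lam : ℂ)⁻¹ * Vlam m V lam x ^ (1 / 2 : ℂ)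
  | k + 1 => fun x =>
      1 / (2 * dpsi m V lam 0 x) *
        (deriv (dpsi m V lam k) x
          + deriv (Klam m V lam) x / Klam m V lam x * dpsi m V lam k x
          - ∑ j : Fin k, dpsi m V lam (j + 1) x * dpsi m V lam (k - j) x)
termination_by k => k
decreasing_by all_goals omega

/-- `P_{λ,n} = ∑_{k=-1}^{n-1} λ^{-k} ψ_k`, where `ψ_k(x) = ∫₀ˣ ψ'_k`. -/
def phase (m : ℝ) (V : ℝ → Matrix (Fin 2) (Fin 2) ℂ) (n : ℕ) (lam x : ℝ) : ℂ :=
  ∑ k ∈ Finset.range (n + 1), (lam : ℂ) ^ (1 - (k : ℤ)) * ∫ t in (0 : ℝ)..x, dpsi m V lam k t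

/-! ### The cut-off functions -/

/-- `Re V₁₁`, `Re V₂₂` and `Im V₁₁ - Im V₂₂` are bounded at the end `s`. -/
def TameAt (V : ℝ → Matrix (Fin 2) (Fin 2) ℂ) (s : Side) : Prop :=
  BoundedAt s (fun x => (V x 0 0).re) ∧ BoundedAt s (fun x => (V x 1 1).re) ∧
    BoundedAt s (fun x => (V x 0 0).im - (V x 1 1).im)

/-- `max {|Re V₁₁ + m|, |Re V₂₂ - m|, |Im V₁₁ - Im V₂₂|} / η`. -/
def gDiag (m : ℝ) (V : ℝ → Matrix (Fin 2) (Fin 2) ℂ) (η x : ℝ) : ℝ :=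
  max (1 / η * |(V x 0 0).re + m|)
    (max (1 / η * |(V x 1 1).re - m|) (1 / η * |(V x 0 0).im - (V x 1 1).im|))

open Classical in
/-- The functions `g_±`. -/
def gCut (m : ℝ) (V : ℝ → Matrix (Fin 2) (Fin 2) ℂ) (f : ℝ → ℝ) (ν : Side → ℝ) (ε₁ η : ℝ)
    (s : Side) (x : ℝ) : ℝ :=
  if TameAt V s then
    if 0 < ν s then |f x| ^ (2 * ν s / (1 - ε₁)) else 0
  else
    if 0 < ν s then max (gDiag m V η x) (|f x| ^ (2 * ν s / (1 - ε₁))) else gDiag m V η x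

open Classical in
/-- The (possibly infinite) cut-off radius `δ^±_λ`: `inf {x ≥ 0 : g_±(±x) = |λ|}`,
and `+∞` if `g_± = 0`. -/
def delta (m : ℝ) (V : ℝ → Matrix (Fin 2) (Fin 2) ℂ) (f : ℝ → ℝ) (ν : Side → ℝ) (ε₁ η : ℝ)
    (s : Side) (lam : ℝ) : EReal :=
  if TameAt V s ∧ ν s ≤ 0 then ⊤
  else sInf {y : EReal | ∃ x : ℝ, 0 ≤ x ∧ gCut m V f ν ε₁ η s (s.sgn * x) = |lam| ∧ y = x}

open Classical in
/-- The transition width `Δ^±_λ`. -/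
def Delta (m : ℝ) (V : ℝ → Matrix (Fin 2) (Fin 2) ℂ) (f : ℝ → ℝ) (ν : Side → ℝ) (ε₁ η : ℝ)
    (s : Side) (lam : ℝ) : ℝ :=
  if TameAt V s ∧ ν s ≤ 0 then 0 else (delta m V f ν ε₁ η s lam).toReal⁻¹

/-- `χ` is an admissible cut-off for the parameter `λ`, its first two derivatives being
controlled with the constant `C`. (If `δ^±_λ = +∞`, there is no cut-off at that end.) -/
structure IsCutoff (m : ℝ) (V : ℝ → Matrix (Fin 2) (Fin 2) ℂ) (f : ℝ → ℝ) (ν : Side → ℝ)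
    (ε₁ η C lam : ℝ) (χ : ℝ → ℝ) : Prop where
  smooth : ContDiff ℝ ∞ χ
  mem_Icc : ∀ x, χ x ∈ Set.Icc 0 1
  eq_one : ∀ x : ℝ,
    -delta m V f ν ε₁ η .minus lam + (Delta m V f ν ε₁ η .minus lam : EReal) < x →
    x < delta m V f ν ε₁ η .plus lam - (Delta m V f ν ε₁ η .plus lam : EReal) → χ x = 1
  eq_zero : ∀ x : ℝ,
    ¬ (-delta m V f ν ε₁ η .minus lam < x ∧ x < delta m V f ν ε₁ η .plus lam) → χ x = 0
  deriv_le : ∀ s : Side, ∀ j : ℕ, (j = 1 ∨ j = 2) → ∀ x, 0 ≤ s.sgn * x →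
    |iteratedDeriv j χ x| * Delta m V f ν ε₁ η s lam ^ j ≤ C

/-! ### The pseudomode -/

/-- `u_{λ,n} = ξ exp(-P_{λ,n})`. -/
def uFun (m : ℝ) (V : ℝ → Matrix (Fin 2) (Fin 2) ℂ) (n : ℕ) (lam : ℝ) (χ : ℝ → ℝ) (x : ℝ) : ℂ :=
  χ x * exp (-phase m V n lam x)

/-- `v_{λ,n} = (k₁ / k₂) (-i ∂ₓ u_{λ,n}) / (λ + m - V₂₂)`. -/
def vFun (m : ℝ) (V : ℝ → Matrix (Fin 2) (Fin 2) ℂ) (n : ℕ) (lam : ℝ) (χ : ℝ → ℝ) (x : ℝ) : ℂ :=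
  k₁ V x / k₂ V x * (-I * deriv (uFun m V n lam χ) x / (lam + m - V x 1 1))

/-- The WKB pseudomode `Ψ_{λ,n} = (k₁ u_{λ,n}, k₂ v_{λ,n})`. -/
def pseudomode (m : ℝ) (V : ℝ → Matrix (Fin 2) (Fin 2) ℂ) (n : ℕ) (lam : ℝ) (χ : ℝ → ℝ)
    (x : ℝ) : Spinor :=
  !₂[k₁ V x * uFun m V n lam χ x, k₂ V x * vFun m V n lam χ x]

/-- The `L²(ℝ)`-norm of a scalar function. -/
def normL2 (h : ℝ → ℂ) : ℝ := (eLpNorm h 2 volume).toReal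

/-- The contribution `κ(λ)` of the derivatives of the cut-off. -/
def kappa (m : ℝ) (V : ℝ → Matrix (Fin 2) (Fin 2) ℂ) (n : ℕ) (lam : ℝ) (χ : ℝ → ℝ) : ℝ :=
  (normL2 (fun x => k₁ V x * exp (-phase m V n lam x) / (lam + m - V x 1 1)
      * ((iteratedDeriv 2 χ x : ℝ) : ℂ))
    + normL2 (fun x => k₁ V x * exp (-phase m V n lam x) / (lam + m - V x 1 1)
      * (2 * deriv (phase m V n lam) x - deriv (Klam m V lam) x / Klam m V lam x)
      * ((deriv χ x : ℝ) : ℂ)))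
  / √(normL2 (fun x => k₁ V x * exp (-phase m V n lam x) * (χ x : ℂ)) ^ 2
    + normL2 (fun x => k₁ V x * (-I * deriv (fun y => exp (-phase m V n lam y) * (χ y : ℂ)) x)
      / (lam + m - V x 1 1)) ^ 2)

open Classical in
/-- The bound for the part of `κ(λ)` that comes from the end `s`: it vanishes if there is no
cut-off at `s`, and is `exp(-d₁ F(± d₂ δ^±_λ))` otherwise. -/
def kappaBound (m : ℝ) (V : ℝ → Matrix (Fin 2) (Fin 2) ℂ) (f : ℝ → ℝ) (ν : Side → ℝ)
    (ε₁ η d₁ d₂ : ℝ) (s : Side) (lam : ℝ) : ℝ :=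
  if TameAt V s ∧ ν s ≤ 0 then 0
  else Real.exp (-d₁ * bigF V (s.sgn * (d₂ * (delta m V f ν ε₁ η s lam).toReal)))

/-- The rate of the WKB remainder at the end `s`: `|λ|^{-n}` if `ν_± ≤ 0`, and
`|λ|^{-(1+ε₁)(n+1)/2+1}` if `ν_± > 0`. -/
def rate (ν : Side → ℝ) (ε₁ : ℝ) (n : ℕ) (s : Side) (lam : ℝ) : ℝ :=
  if ν s ≤ 0 then |lam| ^ (-(n : ℝ)) else |lam| ^ (-((1 + ε₁) / 2 * (n + 1)) + 1)

end DiracWKB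

end

open DiracWKB

noncomputable section

namespace DiracWKB

/-! ### Square roots of products in a sector -/

/-! The choice of v makes the second row of (H_V - λ)Ψ vanish, and the first row becomes a
second-order equation for u. With u = ξ e^{-P} its residual is -k₁ e^{-P} / (λ + m - V₂₂) times ξ''
- (2P' - K'/K) ξ' + R ξ, where R = P'² - P'' - (K'/K) P' + V_λ (`Regime.deriv_compOne`,
`Regime.deriv_compTwo`). The norms of the two terms with derivatives of ξ, divided by ‖Ψ‖, add up to
κ(λ). What remains is to bound R and to show that k₁ e^{-P} decays.

Size of R. Put Φ_k = λ^{1-k} ψ'_{k-1}. The equation for Φ₀ is Φ₀² = -V_λ, and the recursion cancels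
in R every order up to the last, so that only -2Φ₀Φ_{N+1} and the products Φ_iΦ_j with i, j ≤ N and
i + j ≥ N + 2 survive. Let ρ = |λ + m - V₂₂|, and let w be the maximum of 1 and |f|^{ν_±} if ν_± >
0, and 1 otherwise. A calculus of symbols in which each derivative costs a factor w gives |Φ_k| ≤ C
w^k ρ^{1-k} (`AssumptionA.sym_Phi`). The cut-off is chosen so that w² ≤ |λ|^{1-ε₁} on [-δ^-, δ^+],
hence R is of the order of the rates times ρ (`AssumptionA.remainder_bound`). The factor ρ cancels
the denominator λ + m - V₂₂, and ξ R contributes at most the rates times ‖Ψ‖.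

Decay. Up to bounded terms, log |k₁ e^{-P}| is ½ ∫ (Im V₁₂ + Im V₂₁) - ∫ Re Φ₀ - ∫ Re Σ_{k≥2} Φ_k
(`AssumptionA.eventually_log_norm`): Φ₁ is explicit and symmetrises the off-diagonal part. The
square root satisfies an exact identity (`NearReal.sign_re`), by which ± Re Φ₀ is at least a
constant times ± (Im V₁₁ + Im V₂₂), and this constant tends to 1/2 as η → 0. The off-diagonal
integral costs at most ε_± F, and ε_± < μ_±/2 ≤ 1/2, so a multiple of F is left for small η. The sum
over k ≥ 2 is O(|λ|^{-ε₁}), and its integral is absorbed because F grows at least linearly. Thus |k₁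
e^{-P}| ≤ C e^{-dF} (`AssumptionA.exists_exp_upper`), while it stays away from 0 on [0, 1], so that
‖Ψ‖ is bounded below. The derivatives of ξ live at distance comparable to δ^± and are at most of
order (δ^±)², which the exponential absorbs; this bounds κ.

Two technical points shape the argument. The estimates hold on an open interval `dom` around 0 on
which V_λ avoids the cut of the square root although Im V₁₁ and Im V₂₂ may be much larger than λ;
only their difference is small. The entries of V have their highest derivatives only almost
everywhere, so the symbol classes require local Lipschitz bounds below the top order and almost
everywhere bounds at it; weak and classical derivatives are identified at the start. -/

lemma sq_cpow_half (z : ℂ) : (z ^ (1 / 2 : ℂ)) ^ 2 = z := by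
  simp

lemma cpow_half_re_pos {z : ℂ} (hz : z ∈ slitPlane) : 0 < (z ^ (1 / 2 : ℂ)).re := by
  have h0 := slitPlane_ne_zero hz
  rw [Complex.cpow_def_of_ne_zero h0, Complex.exp_re]
  refine mul_pos (Real.exp_pos _) (Real.cos_pos_of_mem_Ioo ?_)
  have h1 := Complex.neg_pi_lt_arg z
  have h2 := (Complex.arg_le_pi z).lt_of_ne (mem_slitPlane_iff_arg.1 hz).1
  have : (Complex.log z * (1 / 2 : ℂ)).im = arg z / 2 := by
    rw [show (1 / 2 : ℂ) = ((1 / 2 : ℝ) : ℂ) by norm_num, Complex.im_mul_ofReal, Complex.log_im]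
    ring
  rw [this]
  constructor <;> linarith

lemma norm_cpow_half_sq (z : ℂ) : ‖z ^ (1 / 2 : ℂ)‖ ^ 2 = ‖z‖ := by
  rw [← norm_pow, sq_cpow_half]

/-- Both factors of `V_λ` are close to `λ` in real part, and their imaginary parts are close to
each other, on the scale `e |λ|`. -/
structure NearReal (e l : ℝ) (z w : ℂ) : Prop where
  ne : l ≠ 0
  pos : 0 < e
  le : e ≤ 1 / 10
  left : |z.re - l| ≤ e * |l|
  right : |w.re - l| ≤ e * |l|
  im : |z.im - w.im| ≤ e * |l|

namespace NearReal

variable {e l : ℝ} {z w : ℂ}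

lemma neg (h : NearReal e l z w) : NearReal e (-l) (-z) (-w) := by
  have key (a b : ℝ) : |-a - -b| = |a - b| := by rw [← abs_neg]; congr 1; ring
  refine ⟨neg_ne_zero.2 h.ne, h.pos, h.le, ?_, ?_, ?_⟩
  · rw [abs_neg, neg_re, key]; exact h.left
  · rw [abs_neg, neg_re, key]; exact h.right
  · rw [abs_neg, neg_im, neg_im, key]; exact h.im

lemma swap (h : NearReal e l z w) : NearReal e l w z :=
  ⟨h.ne, h.pos, h.le, h.right, h.left, by rw [abs_sub_comm]; exact h.im⟩

/-- Reduction to positive `λ`. -/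
lemma exists_pos (h : NearReal e l z w) :
    ∃ z' w', NearReal e |l| z' w' ∧ z' * w' = z * w ∧ ‖z'‖ = ‖z‖ ∧ ‖w'‖ = ‖w‖ := by
  rcases le_total 0 l with hl | hl
  · exact ⟨z, w, by rwa [abs_of_nonneg hl], rfl, rfl, rfl⟩
  · exact ⟨-z, -w, by rw [abs_of_nonpos hl]; exact h.neg, by ring, norm_neg _, norm_neg _⟩

lemma re_bounds (h : NearReal e l z w) (hl : 0 < l) :
    (1 - e) * l ≤ z.re ∧ z.re ≤ (1 + e) * l ∧ (1 - e) * l ≤ w.re ∧ w.re ≤ (1 + e) * l ∧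
      -(e * l) ≤ z.im - w.im ∧ z.im - w.im ≤ e * l := by
  have h1 := abs_le.1 h.left
  have h2 := abs_le.1 h.right
  have h3 := abs_le.1 h.im
  rw [abs_of_pos hl] at h1 h2 h3
  refine ⟨?_, ?_, ?_, ?_, ?_, ?_⟩ <;> nlinarith

lemma norm_left (h : NearReal e l z w) : (1 - e) * |l| ≤ ‖z‖ := by
  obtain ⟨z', w', h', -, hz, -⟩ := h.exists_pos
  rw [← hz]
  exact ((h'.re_bounds (abs_pos.2 h.ne)).1).trans (Complex.re_le_norm _)

lemma norm_left' (h : NearReal e l z w) : |l| / 2 ≤ ‖z‖ := by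
  have := h.norm_left
  have := h.le
  nlinarith [abs_pos.2 h.ne]

lemma norm_right' (h : NearReal e l z w) : |l| / 2 ≤ ‖w‖ := h.swap.norm_left'

lemma left_ne (h : NearReal e l z w) : z ≠ 0 :=
  norm_pos_iff.1 (lt_of_lt_of_le (by have := abs_pos.2 h.ne; positivity) h.norm_left')

lemma right_ne (h : NearReal e l z w) : w ≠ 0 := h.swap.left_ne

lemma norm_le (h : NearReal e l z w) : ‖z‖ ≤ 2 * ‖w‖ := by
  have h1 : ‖z - w‖ ≤ |(z - w).re| + |(z - w).im| := Complex.norm_le_abs_re_add_abs_im _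
  have h2 : |(z - w).re| ≤ 2 * (e * |l|) := by
    have := abs_sub (z.re - l) (w.re - l)
    rw [show z.re - l - (w.re - l) = (z - w).re by simp] at this
    linarith [h.left, h.right]
  have h3 : |(z - w).im| ≤ e * |l| := by simpa using h.im
  have h4 := h.swap.norm_left
  have h5 : ‖z‖ ≤ ‖z - w‖ + ‖w‖ := by simpa using norm_add_le (z - w) w
  have := h.le
  nlinarith [abs_pos.2 h.ne]

lemma norm_ge (h : NearReal e l z w) : ‖w‖ ≤ 2 * ‖z‖ := h.swap.norm_le

/-- After the reduction both factors have positive real part. If their product is real, the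
imaginary parts have opposite signs, so the real part of the product is positive. No bound on the
imaginary parts is needed. -/
lemma mul_mem_slitPlane (h : NearReal e l z w) : z * w ∈ slitPlane := by
  obtain ⟨z', w', h', hm, -, -⟩ := h.exists_pos
  rw [← hm]
  have hl := abs_pos.2 h.ne
  obtain ⟨h1, -, h3, -, -, -⟩ := h'.re_bounds hl
  have h4 : 0 < z'.re := lt_of_lt_of_le (by have := h.le; nlinarith) h1
  have h5 : 0 < w'.re := lt_of_lt_of_le (by have := h.le; nlinarith) h3
  rw [mem_slitPlane_iff]
  by_cases hi : (z' * w').im = 0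
  · left
    rw [mul_im] at hi
    rw [mul_re]
    have : z'.im * w'.im * (z'.re * w'.re) = -(z'.re * w'.im) ^ 2 := by
      linear_combination (z'.re * w'.im) * hi
    have hp := mul_pos h4 h5
    have : z'.im * w'.im ≤ 0 := by
      by_contra hc
      push Not at hc
      have := mul_pos hc hp
      nlinarith [sq_nonneg (z'.re * w'.im)]
    linarith
  · exact Or.inr hi

/-- For z = a + ib and w = c + id, the quantity ac + bd is Re(z w̄). Since b - d is small against l,
bd equals b² up to e l |b|, which l² + b² absorbs for e ≤ 1/10. -/
lemma inner_lower {e l a b c d : ℝ} (he : e ≤ 1 / 10) (hl : 0 < l)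
    (h5 : -(e * l) ≤ b - d) (h6 : b - d ≤ e * l) (hac : (1 - e) ^ 2 * l ^ 2 ≤ a * c) :
    (l ^ 2 + b ^ 2) / 2 ≤ a * c + b * d := by
  have hbd : b ^ 2 - e * l * |b| ≤ b * d := by
    have h7 : |b * (b - d)| ≤ |b| * (e * l) := by
      rw [abs_mul]
      exact mul_le_mul_of_nonneg_left (abs_le.2 ⟨h5, h6⟩) (abs_nonneg _)
    nlinarith only [le_abs_self (b * (b - d)), h7]
  have h8 : e * l * |b| ≤ (l ^ 2 + b ^ 2) / 20 := by
    have h81 : l * |b| ≤ (l ^ 2 + b ^ 2) / 2 := by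
      nlinarith only [sq_nonneg (l - |b|), sq_abs b]
    have h82 : 0 ≤ l * |b| := by positivity
    nlinarith only [mul_le_mul_of_nonneg_right he h82, h81]
  have h9 : (81 / 100 : ℝ) * l ^ 2 ≤ (1 - e) ^ 2 * l ^ 2 :=
    mul_le_mul_of_nonneg_right (by nlinarith only [he]) (sq_nonneg _)
  nlinarith only [sq_nonneg b, sq_nonneg l, h9, h8, hbd, hac]

/-- Up to sign ad - bc is Im(z w̄). Written as a(d - b) + b(a - c), it contains only the small
differences, so it gains a factor e even if b is large. -/
lemma cross_sq_le {e l a b c d : ℝ} (he0 : 0 < e) (he : e ≤ 1 / 10) (hl : 0 < l)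
    (ha : |a| ≤ (1 + e) * l) (hac : |a - c| ≤ 2 * (e * l)) (hbd : |b - d| ≤ e * l) :
    (a * d - b * c) ^ 2 ≤ 8 * e ^ 2 * l ^ 2 * (l ^ 2 + b ^ 2) := by
  have h7 : |a * d - b * c| ≤ e * l * (2 * l + 2 * |b|) := by
    have h71 : |a * (d - b)| ≤ (1 + e) * l * (e * l) := by
      rw [abs_mul, abs_sub_comm d b]
      exact mul_le_mul ha hbd (abs_nonneg _) (by positivity)
    have h72 : |b * (a - c)| ≤ |b| * (2 * (e * l)) := by
      rw [abs_mul]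
      exact mul_le_mul_of_nonneg_left hac (abs_nonneg _)
    have h73 := abs_add_le (a * (d - b)) (b * (a - c))
    rw [show a * (d - b) + b * (a - c) = a * d - b * c by ring] at h73
    have : (1 + e) * l * (e * l) ≤ 2 * l * (e * l) :=
      mul_le_mul_of_nonneg_right (by nlinarith only [he, hl]) (by positivity)
    linarith only [h73, h71, h72, this]
  rw [← sq_abs]
  calc |a * d - b * c| ^ 2 ≤ (e * l * (2 * l + 2 * |b|)) ^ 2 :=
        pow_le_pow_left₀ (abs_nonneg _) h7 2
    _ = e ^ 2 * l ^ 2 * (2 * l + 2 * |b|) ^ 2 := by ring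
    _ ≤ e ^ 2 * l ^ 2 * (8 * (l ^ 2 + b ^ 2)) := by
        refine mul_le_mul_of_nonneg_left ?_ (by positivity)
        nlinarith only [sq_nonneg (l - |b|), sq_abs b]
    _ = _ := by ring

/-- For q² = zw one has 2 (Re q)² = |zw| + Re(zw). Moreover |zw|² = (ac + bd)² + (ad - bc)², so |zw|
lies between ac + bd and ac + bd + 2e l². Adding Re(zw) = ac - bd cancels bd, the product of the
possibly large imaginary parts, and leaves 2ac, which is close to 2l². -/
lemma cpow_re_bounds (h : NearReal e l z w) :
    (1 - e) * |l| ≤ ((z * w) ^ (1 / 2 : ℂ)).re ∧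
      ((z * w) ^ (1 / 2 : ℂ)).re ≤ (1 + 2 * e) * |l| := by
  have hp := cpow_half_re_pos h.mul_mem_slitPlane
  have hsq := sq_cpow_half (z * w)
  have hn := norm_cpow_half_sq (z * w)
  obtain ⟨z', w', h', hm, -, -⟩ := h.exists_pos
  rw [← hm] at hp hsq hn ⊢
  set q := (z' * w') ^ (1 / 2 : ℂ)
  have hl := abs_pos.2 h.ne
  set l := |l|
  obtain ⟨h1, h2, h3, h4, h5, h6⟩ := h'.re_bounds hl
  have he := h.le
  have he0 := h.pos
  rw [norm_mul] at hn
  have e1 : q.re ^ 2 - q.im ^ 2 = z'.re * w'.re - z'.im * w'.im := by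
    have := congrArg Complex.re hsq
    rw [sq, mul_re, mul_re] at this
    linarith
  have e2 : q.re ^ 2 + q.im ^ 2 = ‖z'‖ * ‖w'‖ := by
    rw [← hn, Complex.sq_norm, Complex.normSq_apply]; ring
  have e3 : (‖z'‖ * ‖w'‖) ^ 2 = (z'.re * w'.re + z'.im * w'.im) ^ 2
      + (z'.re * w'.im - z'.im * w'.re) ^ 2 := by
    rw [mul_pow, Complex.sq_norm, Complex.sq_norm, Complex.normSq_apply, Complex.normSq_apply]
    ring
  have hN : 0 ≤ ‖z'‖ * ‖w'‖ := by positivity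
  set A := ‖z'‖ * ‖w'‖
  set a := z'.re
  set b := z'.im
  set c := w'.re
  set d := w'.im
  have hac1 : (1 - e) ^ 2 * l ^ 2 ≤ a * c := by
    calc (1 - e) ^ 2 * l ^ 2 = ((1 - e) * l) * ((1 - e) * l) := by ring
      _ ≤ a * c := mul_le_mul h1 h3 (by nlinarith) (by nlinarith)
  have hac2 : a * c ≤ (1 + e) ^ 2 * l ^ 2 := by
    calc a * c ≤ ((1 + e) * l) * ((1 + e) * l) := mul_le_mul h2 h4 (by nlinarith) (by nlinarith)
      _ = _ := by ring
  constructor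
  · have : a * c + b * d ≤ A := abs_le_of_sq_le_sq' (by nlinarith [sq_nonneg (a * d - b * c)]) hN |>.2
    have : ((1 - e) * l) ^ 2 ≤ q.re ^ 2 := by nlinarith
    exact (abs_le_of_sq_le_sq' this hp.le).2
  · have hX := inner_lower he hl h5 h6 hac1
    have hY := cross_sq_le (c := c) (d := d) he0 he hl (abs_le.2 ⟨by nlinarith only [h1, he0, he, hl], h2⟩) (abs_le.2 ⟨by linarith, by linarith⟩)
      (abs_le.2 ⟨h5, h6⟩)
    have hA : A ≤ a * c + b * d + 2 * (e * l ^ 2) := by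
      refine (abs_le_of_sq_le_sq' ?_ (by nlinarith only [hX, sq_nonneg b, sq_nonneg l, mul_pos he0 (pow_pos hl 2)])).2
      rw [e3]
      have h10 : 8 * e ^ 2 * l ^ 2 * (l ^ 2 + b ^ 2) ≤ 2 * e * l ^ 2 * (l ^ 2 + b ^ 2) := by
        refine mul_le_mul_of_nonneg_right (mul_le_mul_of_nonneg_right ?_ (sq_nonneg _))
          (by positivity)
        nlinarith
      have h11 : (l ^ 2 + b ^ 2) / 2 * (4 * (e * l ^ 2)) ≤ (a * c + b * d) * (4 * (e * l ^ 2)) :=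
        mul_le_mul_of_nonneg_right hX (by positivity)
      nlinarith only [sq_nonneg (e * l ^ 2), h10, h11, hY]
    have : q.re ^ 2 ≤ ((1 + 2 * e) * l) ^ 2 := by
      nlinarith only [mul_nonneg (sq_nonneg e) (sq_nonneg l), mul_pos he0 (pow_pos hl 2), hA, e1, e2,
        hac2]
    exact (abs_le_of_sq_le_sq' this (by positivity)).2

/-- The imaginary part of q² = zw reads 2 Re q Im q = Re z Im w + Im z Re w, and the sign of l turns
both real parts into absolute values. The identity is exact, so the sign of the leading phase can be
read off from Im z and Im w. -/
lemma sign_re (h : NearReal e l z w) :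
    ((Real.sign l : ℂ) * I * (z * w) ^ (1 / 2 : ℂ)).re =
      -(|z.re| * w.im + |w.re| * z.im) / (2 * ((z * w) ^ (1 / 2 : ℂ)).re) := by
  have hp := cpow_half_re_pos h.mul_mem_slitPlane
  have hsq := sq_cpow_half (z * w)
  set q := (z * w) ^ (1 / 2 : ℂ)
  have e1 : 2 * q.re * q.im = z.re * w.im + z.im * w.re := by
    have := congrArg Complex.im hsq
    rw [sq, mul_im, mul_im] at this
    linarith
  rw [eq_div_iff (by positivity)]
  have hsr : ((Real.sign l : ℂ) * I * q).re = -(Real.sign l * q.im) := by simp [mul_re]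
  rw [hsr]
  have hs : Real.sign l * z.re = |z.re| ∧ Real.sign l * w.re = |w.re| := by
    have h1 := abs_le.1 h.left
    have h2 := abs_le.1 h.right
    have he := h.le
    have he0 := h.pos
    rcases lt_or_gt_of_ne h.ne with hl | hl
    · rw [abs_of_neg hl] at h1 h2
      rw [Real.sign_of_neg hl, abs_of_neg (by nlinarith), abs_of_neg (by nlinarith)]
      constructor <;> ring
    · rw [abs_of_pos hl] at h1 h2
      rw [Real.sign_of_pos hl, abs_of_pos (by nlinarith), abs_of_pos (by nlinarith)]
      constructor <;> ring
  rw [← hs.1, ← hs.2]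
  linear_combination (-Real.sign l) * e1

lemma abs_re_bounds (h : NearReal e l z w) :
    (1 - e) * |l| ≤ |z.re| ∧ |z.re| ≤ (1 + e) * |l| := by
  have h1 := h.left
  have h2 := abs_sub_abs_le_abs_sub z.re l
  have h3 := abs_sub_abs_le_abs_sub l z.re
  rw [abs_sub_comm] at h3
  constructor <;> nlinarith

lemma abs_sign_re_le (h : NearReal e l z w) :
    |((Real.sign l : ℂ) * I * (z * w) ^ (1 / 2 : ℂ)).re| ≤ |z.im| + |w.im| := by
  rw [h.sign_re, abs_div]
  have hS := h.cpow_re_bounds.1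
  have hl := abs_pos.2 h.ne
  have he := h.le
  have hpos := cpow_half_re_pos h.mul_mem_slitPlane
  set S := ((z * w) ^ (1 / 2 : ℂ)).re
  rw [abs_of_pos (by positivity : 0 < 2 * S), div_le_iff₀ (by positivity), abs_neg]
  have h1 := h.abs_re_bounds.2
  have h2 := h.swap.abs_re_bounds.2
  have h3 : |(|z.re| * w.im + |w.re| * z.im)| ≤ |z.re| * |w.im| + |w.re| * |z.im| := by
    refine (abs_add_le _ _).trans ?_
    simp [abs_mul]
  have h4 : (1 + e) * |l| ≤ 2 * S := by nlinarith
  nlinarith [mul_le_mul_of_nonneg_right (h1.trans h4) (abs_nonneg w.im),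
    mul_le_mul_of_nonneg_right (h2.trans h4) (abs_nonneg z.im)]

/-- Lower bound for the real part of the leading term of the phase. -/
lemma le_sign_re (h : NearReal e l z w) {σ μ : ℝ} (hσ : |σ| = 1) (hμ : 0 < μ) (he : e ≤ μ)
    (hb : μ * (|z.im| + |w.im|) ≤ -σ * (z.im + w.im)) :
    (1 - e / μ) / (2 * (1 + 2 * e)) * (-σ * (z.im + w.im)) ≤
      σ * ((Real.sign l : ℂ) * I * (z * w) ^ (1 / 2 : ℂ)).re := by
  rw [h.sign_re]
  have hS := h.cpow_re_bounds.2
  have hl := abs_pos.2 h.ne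
  have he0 := h.pos
  have hpos := cpow_half_re_pos h.mul_mem_slitPlane
  set S := ((z * w) ^ (1 / 2 : ℂ)).re
  set X := -σ * (z.im + w.im)
  have hX : 0 ≤ X := le_trans (by positivity) hb
  have h1 := h.left
  have h2 := h.right
  have hz := h.abs_re_bounds
  have hw := h.swap.abs_re_bounds
  -- Replacing |Re z| and |Re w| by |l| costs at most e |l| (|Im z| + |Im w|), which `hb` turns into
  -- the fraction e/μ of the main term |l| X.
  have key : (1 - e / μ) * |l| * X ≤ -σ * (|z.re| * w.im + |w.re| * z.im) := by
    have e1 : -σ * (|z.re| * w.im + |w.re| * z.im) =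
        |l| * X + (-σ * w.im * (|z.re| - |l|) + -σ * z.im * (|w.re| - |l|)) := by
      simp only [X]; ring
    have e2 : |(-σ * w.im * (|z.re| - |l|))| ≤ |w.im| * (e * |l|) := by
      rw [abs_mul, abs_mul, abs_neg, hσ, one_mul]
      exact mul_le_mul_of_nonneg_left (abs_le.2 ⟨by linarith, by linarith⟩) (abs_nonneg _)
    have e3 : |(-σ * z.im * (|w.re| - |l|))| ≤ |z.im| * (e * |l|) := by
      rw [abs_mul, abs_mul, abs_neg, hσ, one_mul]
      exact mul_le_mul_of_nonneg_left (abs_le.2 ⟨by linarith, by linarith⟩) (abs_nonneg _)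
    have e4 : (|z.im| + |w.im|) * (e * |l|) ≤ e / μ * |l| * X := by
      have : |z.im| + |w.im| ≤ X / μ := by rw [le_div_iff₀ hμ]; linarith
      calc (|z.im| + |w.im|) * (e * |l|) ≤ X / μ * (e * |l|) :=
            mul_le_mul_of_nonneg_right this (by positivity)
        _ = _ := by ring
    rw [e1]
    have := neg_abs_le (-σ * w.im * (|z.re| - |l|))
    have := neg_abs_le (-σ * z.im * (|w.re| - |l|))
    nlinarith
  have hk : 0 ≤ 1 - e / μ := by rw [sub_nonneg, div_le_one hμ]; exact he
  rw [show σ * (-(|z.re| * w.im + |w.re| * z.im) / (2 * S)) =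
    (-σ * (|z.re| * w.im + |w.re| * z.im)) / (2 * S) by ring, le_div_iff₀ (by positivity)]
  refine le_trans ?_ key
  have : (1 - e / μ) / (2 * (1 + 2 * e)) * X * (2 * S) = (1 - e / μ) * X * (S / (1 + 2 * e)) := by
    field_simp
  rw [this]
  have h5 : S / (1 + 2 * e) ≤ |l| := by rw [div_le_iff₀ (by positivity)]; linarith
  calc (1 - e / μ) * X * (S / (1 + 2 * e)) ≤ (1 - e / μ) * X * |l| :=
        mul_le_mul_of_nonneg_left h5 (by positivity)
    _ = _ := by ring

end NearReal

end DiracWKB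

end

noncomputable section

namespace DiracWKB

/-! ### Functions that are Lipschitz near a point -/

/-- `u` is Lipschitz in a neighbourhood of `x`. -/
def LipAt (u : ℝ → ℂ) (x : ℝ) : Prop :=
  ∃ K : NNReal, ∃ U ∈ 𝓝 x, LipschitzOnWith K u U

lemma LipAt.congr {u v : ℝ → ℂ} {x : ℝ} (h : LipAt u x) (huv : u =ᶠ[𝓝 x] v) : LipAt v x := by
  obtain ⟨K, U, hU, hK⟩ := h
  refine ⟨K, U ∩ {y | u y = v y}, inter_mem hU huv, ?_⟩
  intro y hy z hz
  rw [← hy.2, ← hz.2]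
  exact hK hy.1 hz.1

lemma LipAt.continuousAt {u : ℝ → ℂ} {x : ℝ} (h : LipAt u x) : ContinuousAt u x := by
  obtain ⟨K, U, hU, hK⟩ := h
  exact hK.continuousOn.continuousAt hU

lemma lipAt_of_contDiffAt {u : ℝ → ℂ} {x : ℝ} (h : ContDiffAt ℝ 1 u x) : LipAt u x :=
  h.exists_lipschitzOnWith

lemma lipAt_const (c : ℂ) (x : ℝ) : LipAt (fun _ => c) x := lipAt_of_contDiffAt contDiffAt_const

lemma LipAt.comp {u : ℝ → ℂ} {g : ℂ → ℂ} {x : ℝ} (hu : LipAt u x)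
    (hg : ContDiffAt ℝ 1 g (u x)) : LipAt (fun y => g (u y)) x := by
  have hc := hu.continuousAt
  obtain ⟨K, U, hU, hK⟩ := hu
  obtain ⟨K', T, hT, hK'⟩ := hg.exists_lipschitzOnWith
  exact ⟨K' * K, U ∩ u ⁻¹' T, inter_mem hU (hc hT),
    hK'.comp (hK.mono Set.inter_subset_left) fun y hy => hy.2⟩

lemma LipAt.comp₂ {u v : ℝ → ℂ} {g : ℂ × ℂ → ℂ} {x : ℝ} (hu : LipAt u x) (hv : LipAt v x)
    (hg : ContDiffAt ℝ 1 g (u x, v x)) : LipAt (fun y => g (u y, v y)) x := by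
  have hc : ContinuousAt (fun y => (u y, v y)) x := hu.continuousAt.prodMk hv.continuousAt
  obtain ⟨K, U, hU, hK⟩ := hu
  obtain ⟨L, S, hS, hL⟩ := hv
  obtain ⟨K', T, hT, hK'⟩ := hg.exists_lipschitzOnWith
  refine ⟨K' * max K L, (U ∩ S) ∩ (fun y => (u y, v y)) ⁻¹' T,
    inter_mem (inter_mem hU hS) (hc hT), ?_⟩
  exact hK'.comp (((hK.mono Set.inter_subset_left).prodMk (hL.mono Set.inter_subset_right)).mono
    Set.inter_subset_left) fun y hy => hy.2

lemma LipAt.add {u v : ℝ → ℂ} {x : ℝ} (hu : LipAt u x) (hv : LipAt v x) :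
    LipAt (fun y => u y + v y) x :=
  hu.comp₂ (g := fun p => p.1 + p.2) hv (contDiffAt_fst.add contDiffAt_snd)

lemma LipAt.mul {u v : ℝ → ℂ} {x : ℝ} (hu : LipAt u x) (hv : LipAt v x) :
    LipAt (fun y => u y * v y) x :=
  hu.comp₂ (g := fun p => p.1 * p.2) hv (contDiffAt_fst.mul contDiffAt_snd)

lemma LipAt.inv {u : ℝ → ℂ} {x : ℝ} (hu : LipAt u x) (h0 : u x ≠ 0) :
    LipAt (fun y => (u y)⁻¹) x :=
  hu.comp (contDiffAt_inv ℝ h0)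

/-- Rademacher's theorem applies on a neighbourhood of each point, and being a null set is a local
property. -/
lemma ae_differentiableAt_of_lipAt {J : Set ℝ} {u : ℝ → ℂ} (h : ∀ x ∈ J, LipAt u x) :
    ∀ᵐ x, x ∈ J → DifferentiableAt ℝ u x := by
  rw [ae_iff]
  refine measure_null_of_locally_null _ fun x hx => ?_
  simp only [Classical.not_imp, Set.mem_ofPred_eq] at hx
  obtain ⟨K, U, hU, hK⟩ := h x hx.1
  refine ⟨_, inter_mem_nhdsWithin _ (interior_mem_nhds.2 hU), ?_⟩
  have h1 := (hK.mono interior_subset).ae_differentiableWithinAt_of_mem_real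
  refine measure_mono_null (fun y hy => ?_) (ae_iff.1 h1)
  simp only [Classical.not_imp, Set.mem_inter_iff, Set.mem_ofPred_eq] at hy ⊢
  exact ⟨hy.2, fun hd => hy.1.2 (hd.differentiableAt (isOpen_interior.mem_nhds hy.2))⟩

lemma exists_lipschitzOnWith_Icc {u : ℝ → ℂ} (h : ∀ x, LipAt u x) (a b : ℝ) :
    ∃ K, LipschitzOnWith K u (Set.Icc a b) := by
  have : LocallyLipschitzOn (Set.Icc a b) u := fun x _ => by
    obtain ⟨K, U, hU, hK⟩ := h x
    exact ⟨K, U, mem_nhdsWithin_of_mem_nhds hU, hK⟩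
  exact this.exists_lipschitzOnWith_of_compact isCompact_Icc

lemma norm_deriv_bounded {u : ℝ → ℂ} (h : ∀ x, LipAt u x) (R : ℝ) :
    ∃ C : ℝ, ∀ x, |x| ≤ R → ‖deriv u x‖ ≤ C := by
  obtain ⟨K, hK⟩ := exists_lipschitzOnWith_Icc h (-R - 1) (R + 1)
  refine ⟨K, fun x hx => norm_deriv_le_of_lipschitzOn (Icc_mem_nhds ?_ ?_) hK⟩ <;>
  · have := abs_le.1 hx
    linarith

lemma continuous_of_lipAt {u : ℝ → ℂ} (h : ∀ x, LipAt u x) : Continuous u :=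
  continuous_iff_continuousAt.2 fun x => (h x).continuousAt

/-- The fundamental theorem of calculus for locally Lipschitz functions. -/
lemma integral_deriv_of_lipAt {u : ℝ → ℂ} (h : ∀ x, LipAt u x) (a b : ℝ) :
    ∫ x in a..b, deriv u x = u b - u a := by
  obtain ⟨K, hK⟩ := exists_lipschitzOnWith_Icc h (min a b) (max a b)
  have hd : ∀ᵐ x, DifferentiableAt ℝ u x := by
    simpa using ae_differentiableAt_of_lipAt (J := Set.univ) fun x _ => h x
  have hre : AbsolutelyContinuousOnInterval (fun x => (u x).re) a b := by
    refine LipschitzOnWith.absolutelyContinuousOnInterval (K := K) ?_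
    have := (reCLM.lipschitz.lipschitzOnWith (s := Set.univ)).comp hK (Set.mapsTo_univ _ _)
    simpa [Function.comp_def, Set.uIcc] using this
  have him : AbsolutelyContinuousOnInterval (fun x => (u x).im) a b := by
    refine LipschitzOnWith.absolutelyContinuousOnInterval (K := K) ?_
    have := (imCLM.lipschitz.lipschitzOnWith (s := Set.univ)).comp hK (Set.mapsTo_univ _ _)
    simpa [Function.comp_def, Set.uIcc] using this
  have e1 : (fun x => deriv (fun x => (u x).re) x) =ᵐ[volume] fun x => (deriv u x).re := by
    filter_upwards [hd] with x hx
    exact (reCLM.hasFDerivAt.comp_hasDerivAt x hx.hasDerivAt).deriv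
  have e2 : (fun x => deriv (fun x => (u x).im) x) =ᵐ[volume] fun x => (deriv u x).im := by
    filter_upwards [hd] with x hx
    exact (imCLM.hasFDerivAt.comp_hasDerivAt x hx.hasDerivAt).deriv
  have i1 : IntervalIntegrable (fun x => (deriv u x).re) volume a b :=
    hre.intervalIntegrable_deriv.congr_ae (ae_restrict_of_ae e1)
  have i2 : IntervalIntegrable (fun x => (deriv u x).im) volume a b :=
    him.intervalIntegrable_deriv.congr_ae (ae_restrict_of_ae e2)
  have s1 : ∫ x in a..b, (deriv u x).re = (u b).re - (u a).re := by
    rw [← hre.integral_deriv_eq_sub]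
    exact intervalIntegral.integral_congr_ae (e1.mono fun x hx _ => hx.symm)
  have s2 : ∫ x in a..b, (deriv u x).im = (u b).im - (u a).im := by
    rw [← him.integral_deriv_eq_sub]
    exact intervalIntegral.integral_congr_ae (e2.mono fun x hx _ => hx.symm)
  calc ∫ x in a..b, deriv u x
      = ∫ x in a..b, ((((deriv u x).re : ℝ) : ℂ) + (((deriv u x).im : ℝ) : ℂ) * I) := by
        simp only [Complex.re_add_im]
    _ = (∫ x in a..b, (((deriv u x).re : ℝ) : ℂ)) + ∫ x in a..b, (((deriv u x).im : ℝ) : ℂ) * I :=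
        intervalIntegral.integral_add ⟨i1.1.ofReal, i1.2.ofReal⟩
          (IntervalIntegrable.mul_const ⟨i2.1.ofReal, i2.2.ofReal⟩ I)
    _ = u b - u a := by
        rw [intervalIntegral.integral_mul_const, intervalIntegral.integral_ofReal,
          intervalIntegral.integral_ofReal, s1, s2]
        apply Complex.ext <;> simp

lemma integrable_deriv_mul_test {u φ : ℝ → ℂ} (h : ∀ x, LipAt u x) (hφ : Continuous φ)
    (hc : HasCompactSupport φ) : Integrable (fun x => deriv u x * φ x) := by
  refine integrable_mul_test ?_ hφ hc
  rw [MeasureTheory.locallyIntegrable_iff]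
  intro k hk
  obtain ⟨R, hR⟩ := hk.isBounded.subset_closedBall 0
  obtain ⟨C, hC⟩ := norm_deriv_bounded h R
  refine Measure.integrableOn_of_bounded (M := C) hk.measure_lt_top.ne
    (measurable_deriv u).aestronglyMeasurable ?_
  refine (ae_restrict_iff' hk.measurableSet).2 (ae_of_all _ fun x hx => hC x ?_)
  simpa using hR hx

lemma exists_Ioc_of_hasCompactSupport {φ : ℝ → ℂ} (hc : HasCompactSupport φ) :
    ∃ R : ℝ, ∀ x, R ≤ |x| → φ x = 0 := by
  obtain ⟨R, hR⟩ := hc.isCompact.isBounded.subset_closedBall 0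
  refine ⟨R + 1, fun x hx => image_eq_zero_of_notMem_tsupport fun hx' => ?_⟩
  have := hR hx'
  rw [Metric.mem_closedBall, dist_zero_right, Real.norm_eq_abs] at this
  linarith

/-- Integration by parts: the classical derivative of a locally Lipschitz function is its
weak derivative. -/
lemma isWeakDeriv_of_lipAt {u : ℝ → ℂ} (h : ∀ x, LipAt u x) : IsWeakDeriv u (deriv u) := by
  intro φ hφ hc
  have hφ1 : ContDiff ℝ 1 φ := hφ.of_le (by exact_mod_cast le_top)
  have hd : Continuous (deriv φ) := hφ.continuous_deriv (by simp)
  obtain ⟨R, hR⟩ := exists_Ioc_of_hasCompactSupport hc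
  have hl : ∀ x, LipAt (fun y => u y * φ y) x := fun x =>
    (h x).mul (lipAt_of_contDiffAt hφ1.contDiffAt)
  have hdu : ∀ᵐ x, DifferentiableAt ℝ u x := by
    simpa using ae_differentiableAt_of_lipAt (J := Set.univ) fun x _ => h x
  have i1 : Integrable (fun x => u x * deriv φ x) :=
    integrable_mul_test (continuous_of_lipAt h).locallyIntegrable hd hc.deriv
  have i2 := integrable_deriv_mul_test h hφ.continuous hc
  have key : ∫ x, deriv (fun y => u y * φ y) x = 0 := by
    have hs : Function.support (deriv fun y => u y * φ y) ⊆ Set.Ioc (-(|R| + 1)) (|R| + 1) := by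
      intro x hx
      by_contra hx'
      apply hx
      have : (fun y => u y * φ y) =ᶠ[𝓝 x] fun _ => 0 := by
        have : ∀ᶠ y in 𝓝 x, R < |y| := by
          refine continuous_abs.continuousAt.eventually_const_lt ?_
          refine lt_of_lt_of_le (b := |R| + 1) ?_ ?_
          · linarith [le_abs_self R]
          · rw [Set.mem_Ioc, not_and_or, not_lt, not_le] at hx'
            rcases hx' with hx' | hx'
            · linarith [neg_abs_le x]
            · linarith [le_abs_self x]
        filter_upwards [this] with y hy
        rw [hR y hy.le, mul_zero]
      rw [this.deriv_eq]
      simp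
    rw [← intervalIntegral.integral_eq_integral_of_support_subset hs, integral_deriv_of_lipAt hl,
      hR (|R| + 1), hR (-(|R| + 1))]
    · simp
    · rw [abs_neg, abs_of_nonneg (by positivity)]; linarith [le_abs_self R]
    · rw [abs_of_nonneg (by positivity)]; linarith [le_abs_self R]
  have e : ∫ x, deriv (fun y => u y * φ y) x = ∫ x, (deriv u x * φ x + u x * deriv φ x) := by
    refine integral_congr_ae ?_
    filter_upwards [hdu] with x hx
    exact deriv_fun_mul hx (hφ1.differentiable (by simp)).differentiableAt
  rw [e, integral_add i2 i1] at key
  linear_combination key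

/-! ### The lemma of du Bois-Reymond -/

/-- A test function φ minus its integral times the normalised bump χ has integral zero, hence equals
Θ' for a test function Θ. Testing with Θ shows that h minus the constant ∫ χ h annihilates φ. -/
lemma ae_eq_const_of_weakDeriv_zero {h : ℝ → ℂ} (hl : LocallyIntegrable h)
    (h0 : IsWeakDeriv h fun _ => 0) : ∃ c : ℂ, ∀ᵐ x, h x = c := by
  let b : ContDiffBump (0 : ℝ) := ⟨1, 2, one_pos, one_lt_two⟩
  let χ : ℝ → ℝ := b.normed volume
  have hχ : ContDiff ℝ ∞ χ := b.contDiff_normed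
  have hχc : HasCompactSupport χ := b.hasCompactSupport_normed
  have hχi : ∫ x, χ x = 1 := b.integral_normed
  refine ⟨∫ x, χ x • h x, ?_⟩
  set c := ∫ x, χ x • h x with hcdef
  have hlc : LocallyIntegrable fun x => h x - c := hl.sub (locallyIntegrable_const c)
  have key := ae_eq_zero_of_integral_contDiff_smul_eq_zero hlc fun φ hφ hφc => ?_
  · filter_upwards [key] with x hx
    exact sub_eq_zero.1 hx
  set I0 := ∫ x, φ x
  let θ : ℝ → ℝ := fun x => φ x - I0 * χ x
  have hθ : ContDiff ℝ ∞ θ := hφ.sub (contDiff_const.mul hχ)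
  have hθc : HasCompactSupport θ := hφc.sub hχc.mul_left
  have hφi : Integrable φ := hφ.continuous.integrable_of_hasCompactSupport hφc
  have hχi' : Integrable χ := hχ.continuous.integrable_of_hasCompactSupport hχc
  have hθi : ∫ x, θ x = 0 := by
    rw [integral_sub hφi (hχi'.const_mul _), integral_const_mul, hχi]; simp [I0]
  obtain ⟨R, hR⟩ := hθc.isCompact.isBounded.subset_closedBall 0
  have hR' : ∀ x, |R| < |x| → θ x = 0 := fun x hx => by
    refine image_eq_zero_of_notMem_tsupport fun hx' => ?_
    have := hR hx'
    rw [Metric.mem_closedBall, dist_zero_right, Real.norm_eq_abs] at this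
    linarith [le_abs_self R]
  let Θ : ℝ → ℝ := fun x => ∫ t in (-(|R| + 1))..x, θ t
  have hΘd : ∀ x, HasDerivAt Θ (θ x) x := fun x =>
    intervalIntegral.integral_hasDerivAt_right (hθ.continuous.intervalIntegrable _ _)
      hθ.continuous.stronglyMeasurable.stronglyMeasurableAtFilter hθ.continuous.continuousAt
  have hΘ' : deriv Θ = θ := funext fun x => (hΘd x).deriv
  have hΘ : ContDiff ℝ ∞ Θ := by
    rw [contDiff_infty_iff_deriv]
    exact ⟨fun x => (hΘd x).differentiableAt, by rw [hΘ']; exact hθ⟩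
  have hΘc : HasCompactSupport Θ := by
    refine HasCompactSupport.intro (isCompact_Icc (a := -(|R| + 1)) (b := |R| + 1)) fun x hx => ?_
    rw [Set.mem_Icc, not_and_or, not_le, not_le] at hx
    rcases hx with hx | hx
    · refine (intervalIntegral.integral_congr (g := fun _ => 0) fun t ht => ?_).trans (by simp)
      rw [Set.uIcc_of_ge hx.le] at ht
      refine hR' t ?_
      linarith [neg_abs_le t, ht.2]
    · rw [← hθi]
      refine intervalIntegral.integral_eq_integral_of_support_subset fun t ht => ?_
      have h1 : |t| ≤ |R| := by
        by_contra hc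
        exact ht (hR' t (not_le.1 hc))
      have := abs_le.1 h1
      exact ⟨by linarith, by linarith⟩
  have h1 := h0 (fun x => (Θ x : ℂ)) (ofRealCLM.contDiff.comp hΘ)
    (hΘc.comp_left (g := fun t : ℝ => (t : ℂ)) (by simp))
  have h2 : deriv (fun x => (Θ x : ℂ)) = fun x => (θ x : ℂ) :=
    funext fun x => (hΘd x).ofReal_comp.deriv
  rw [h2] at h1
  simp only [zero_mul, integral_zero, neg_zero] at h1
  have j1 : Integrable fun x => φ x • h x :=
    hl.integrable_smul_left_of_hasCompactSupport hφ.continuous hφc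
  have j2 : Integrable fun x => χ x • h x :=
    hl.integrable_smul_left_of_hasCompactSupport hχ.continuous hχc
  have h3 : (∫ x, φ x • h x) - I0 • c = 0 := by
    have j4 : Integrable fun x => I0 • χ x • h x := j2.smul I0
    rw [hcdef, ← integral_smul, ← integral_sub j1 j4, ← h1]
    refine integral_congr_ae (ae_of_all _ fun x => ?_)
    simp only [θ, real_smul]
    push_cast
    ring
  have j3 : Integrable fun x => φ x • c := hφi.smul_const c
  simp only [smul_sub]
  rw [integral_sub j1 j3, integral_smul_const]
  exact h3

/-! ### Regularity of functions in local Sobolev spaces -/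

/-- The classical derivatives of order `< k` exist and are locally Lipschitz. -/
def RegW : ℕ → (ℝ → ℂ) → Prop
  | 0, _ => True
  | k + 1, u => (∀ x, LipAt u x) ∧ (1 ≤ k → Differentiable ℝ u) ∧ RegW k (deriv u)

lemma MemLinftyLoc.exists_bound {w : ℝ → ℂ} (h : MemLinftyLoc w) (R : ℝ) :
    ∃ C : NNReal, ∀ᵐ x, x ∈ Set.Icc (-R) R → ‖w x‖ ≤ C := by
  have := (h R).2
  refine ⟨(eLpNorm w ∞ (volume.restrict (Set.Icc (-R) R))).toNNReal, ?_⟩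
  rw [← ae_restrict_iff' measurableSet_Icc]
  have h1 : ∀ᵐ x ∂(volume.restrict (Set.Icc (-R) R)),
      ‖w x‖ₑ ≤ eLpNorm w ∞ (volume.restrict (Set.Icc (-R) R)) := by
    rw [eLpNorm_exponent_top]
    exact ae_le_eLpNormEssSup
  filter_upwards [h1] with x hx
  rw [← ENNReal.coe_toNNReal this.ne, enorm_le_coe] at hx
  exact hx

lemma MemLinftyLoc.locallyIntegrable {w : ℝ → ℂ} (h : MemLinftyLoc w) : LocallyIntegrable w := by
  rw [MeasureTheory.locallyIntegrable_iff]
  intro k hk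
  obtain ⟨R, hR⟩ := hk.isBounded.subset_closedBall 0
  rw [Real.closedBall_eq_Icc, zero_sub, zero_add] at hR
  refine IntegrableOn.mono_set ?_ hR
  exact (h R).integrable le_top

/-- Primitives of locally bounded functions are locally Lipschitz. -/
lemma lipAt_primitive {w : ℝ → ℂ} (h : MemLinftyLoc w) (c : ℂ) (x : ℝ) :
    LipAt (fun y => c + ∫ t in (0 : ℝ)..y, w t) x := by
  obtain ⟨C, hC⟩ := h.exists_bound (|x| + 1)
  refine ⟨C, Set.Icc (x - 1) (x + 1), Icc_mem_nhds (by linarith) (by linarith), ?_⟩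
  refine LipschitzOnWith.of_dist_le_mul fun y hy z hz => ?_
  have hi (a b : ℝ) : IntervalIntegrable w volume a b := intervalIntegrable_iff.2 <|
    (h.locallyIntegrable.integrableOn_isCompact isCompact_uIcc).mono_set Set.uIoc_subset_uIcc
  rw [dist_eq_norm, add_sub_add_left_eq_sub,
    intervalIntegral.integral_interval_sub_left (hi _ _) (hi _ _), dist_comm, dist_comm, dist_eq_norm]
  refine intervalIntegral.norm_integral_le_of_norm_le_const_ae ?_
  filter_upwards [hC] with t ht ht'
  apply ht
  have h1 := Set.uIoc_subset_uIcc ht'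
  have h2 : t ∈ Set.Icc (x - 1) (x + 1) := Set.uIcc_subset_Icc hz hy h1
  have := neg_abs_le x
  have := le_abs_self x
  exact ⟨by linarith [h2.1], by linarith [h2.2]⟩

/-- The primitive of w is locally Lipschitz, so it has weak derivative w as well; the difference to
u has weak derivative zero and is constant by du Bois-Reymond. -/
lemma IsWeakDeriv.ae_eq_primitive {u w : ℝ → ℂ} (hu : MemLinftyLoc u) (hw : MemLinftyLoc w)
    (h : IsWeakDeriv u w) : ∃ c : ℂ, ∀ᵐ x, u x = c + ∫ t in (0 : ℝ)..x, w t := by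
  have hp : ∀ x, LipAt (fun y => ∫ t in (0 : ℝ)..y, w t) x := fun x => by
    simpa using lipAt_primitive hw 0 x
  have hae : deriv (fun y => ∫ t in (0 : ℝ)..y, w t) =ᵐ[volume] w := by
    filter_upwards [_root_.LocallyIntegrable.ae_hasDerivAt_integral hw.locallyIntegrable] with x hx
    exact (hx 0).deriv
  have hpl : LocallyIntegrable fun y => ∫ t in (0 : ℝ)..y, w t :=
    (continuous_of_lipAt hp).locallyIntegrable
  have hz : IsWeakDeriv (fun x => u x - ∫ t in (0 : ℝ)..x, w t) fun _ => 0 := by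
    intro φ hφ hφc
    have hd : Continuous (deriv φ) := hφ.continuous_deriv (by simp)
    have e1 := h φ hφ hφc
    have e2 := isWeakDeriv_of_lipAt hp φ hφ hφc
    have e3 : ∫ x, deriv (fun y => ∫ t in (0 : ℝ)..y, w t) x * φ x = ∫ x, w x * φ x := by
      refine integral_congr_ae ?_
      filter_upwards [hae] with x hx
      rw [hx]
    have e4 := integral_sub (integrable_mul_test hu.locallyIntegrable hd hφc.deriv)
      (integrable_mul_test hpl hd hφc.deriv)
    simp only [sub_mul, zero_mul, integral_zero, neg_zero]
    rw [e4, e1, e2, e3]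
    ring
  obtain ⟨c, hc⟩ := ae_eq_const_of_weakDeriv_zero (hu.locallyIntegrable.sub hpl) hz
  refine ⟨c, ?_⟩
  filter_upwards [hc] with x hx
  rw [← hx, Pi.sub_apply]; ring

lemma MemLinftyLoc.congr {u v : ℝ → ℂ} (h : MemLinftyLoc u) (huv : u =ᵐ[volume] v) :
    MemLinftyLoc v := fun R => (memLp_congr_ae (ae_restrict_of_ae huv)).1 (h R)

/-- The representative is built from the top derivative downwards: once the weak derivative has a
regular representative v, a constant plus the primitive of v represents u and has classical
derivative v. -/
lemma MemWLoc.exists_regW {k : ℕ} {u : ℝ → ℂ} (h : MemWLoc (k + 1) u) :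
    ∃ v, u =ᵐ[volume] v ∧ RegW (k + 1) v := by
  induction k generalizing u with
  | zero =>
    obtain ⟨w, rfl, hb, hw⟩ := h
    obtain ⟨c, hc⟩ := (hw 0 (by simp)).ae_eq_primitive (hb 0 (by simp)) (hb 1 le_rfl)
    exact ⟨_, hc, lipAt_primitive (hb 1 le_rfl) c, by simp, trivial⟩
  | succ k ih =>
    obtain ⟨w, rfl, hb, hw⟩ := h
    obtain ⟨v, hv, hreg⟩ := ih (u := w 1) ⟨fun j => w (j + 1), rfl, fun j hj => hb _ (by omega),
      fun j hj => hw _ (by omega)⟩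
    obtain ⟨c, hc⟩ := (hw 0 (by simp)).ae_eq_primitive (hb 0 (by simp)) (hb 1 (by omega))
    have hvc : Continuous v := continuous_of_lipAt hreg.1
    have hvb : MemLinftyLoc v := (hb 1 (by omega)).congr hv
    have hd : ∀ x, HasDerivAt (fun y => c + ∫ t in (0 : ℝ)..y, v t) (v x) x := fun x =>
      (intervalIntegral.integral_hasDerivAt_right (hvc.intervalIntegrable _ _)
        hvc.stronglyMeasurable.stronglyMeasurableAtFilter hvc.continuousAt).const_add c
    refine ⟨fun x => c + ∫ t in (0 : ℝ)..x, v t, ?_, lipAt_primitive hvb c,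
      fun _ x => (hd x).differentiableAt, ?_⟩
    · filter_upwards [hc] with x hx
      rw [hx]
      congr 1
      exact intervalIntegral.integral_congr_ae (hv.mono fun t ht _ => ht)
    · have : deriv (fun y => c + ∫ t in (0 : ℝ)..y, v t) = v := funext fun x => (hd x).deriv
      rw [this]
      exact hreg

/-- A continuous function in `W^{k,∞}_loc` has locally Lipschitz derivatives of order `< k`. -/
lemma MemWLoc.regW {k : ℕ} {u : ℝ → ℂ} (h : MemWLoc k u) (hu : Continuous u) : RegW k u := by
  cases k with
  | zero => trivial
  | succ k =>
    obtain ⟨v, hv, hreg⟩ := h.exists_regW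
    have : u = v := (continuous_of_lipAt hreg.1).ae_eq_iff_eq volume hu |>.1 hv.symm |>.symm
    rw [this]
    exact hreg

end DiracWKB

end

noncomputable section

namespace DiracWKB

/-! ### Symbol classes -/

/-- Uniform almost everywhere bounds `|u_λ| ≤ C w_λ` on `J_λ`. -/
def AEBound (l : Filter ℝ) (J : ℝ → Set ℝ) (w : ℝ → ℝ → ℝ) (u : ℝ → ℝ → ℂ) : Prop :=
  ∃ C : ℝ, 0 ≤ C ∧ ∀ᶠ lam in l, ∀ᵐ x, x ∈ J lam → ‖u lam x‖ ≤ C * w lam x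

/-- `u_λ ∈ W^{k,∞}_loc(J_λ)` with `|u_λ^{(j)}| ≤ C W^j w_λ` for `j ≤ k`, uniformly in `λ`. -/
def Sym (l : Filter ℝ) (J : ℝ → Set ℝ) (W : ℝ → ℝ) :
    ℕ → (ℝ → ℝ → ℝ) → (ℝ → ℝ → ℂ) → Prop
  | 0, w, u => AEBound l J w u
  | k + 1, w, u => AEBound l J w u ∧
      (∀ᶠ lam in l, ∀ x ∈ J lam, LipAt (u lam) x ∧ (1 ≤ k → DifferentiableAt ℝ (u lam) x)) ∧
      Sym l J W k (fun lam x => W x * w lam x) (fun lam => deriv (u lam))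

section

variable {l : Filter ℝ} {J : ℝ → Set ℝ} {W : ℝ → ℝ} {w w' : ℝ → ℝ → ℝ} {u v : ℝ → ℝ → ℂ} {k : ℕ}

lemma AEBound.mono (h : AEBound l J w u) {C : ℝ} (hC : 0 ≤ C)
    (hw : ∀ᶠ lam in l, ∀ x ∈ J lam, w lam x ≤ C * w' lam x) : AEBound l J w' u := by
  obtain ⟨D, hD, h⟩ := h
  refine ⟨D * C, by positivity, ?_⟩
  filter_upwards [h, hw] with lam h1 h2
  filter_upwards [h1] with x hx hJ
  refine (hx hJ).trans ?_
  rw [mul_assoc]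
  exact mul_le_mul_of_nonneg_left (h2 x hJ) hD

lemma AEBound.add (hu : AEBound l J w u) (hv : AEBound l J w v) :
    AEBound l J w (fun lam x => u lam x + v lam x) := by
  obtain ⟨C, hC, h⟩ := hu
  obtain ⟨D, hD, h'⟩ := hv
  refine ⟨C + D, by positivity, ?_⟩
  filter_upwards [h, h'] with lam h1 h2
  filter_upwards [h1, h2] with x hx hx' hJ
  rw [add_mul]
  exact (norm_add_le _ _).trans (add_le_add (hx hJ) (hx' hJ))

lemma AEBound.mul (hu : AEBound l J w u) (hv : AEBound l J w' v) :
    AEBound l J (fun lam x => w lam x * w' lam x) (fun lam x => u lam x * v lam x) := by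
  obtain ⟨C, hC, h⟩ := hu
  obtain ⟨D, hD, h'⟩ := hv
  refine ⟨C * D, by positivity, ?_⟩
  filter_upwards [h, h'] with lam h1 h2
  filter_upwards [h1, h2] with x hx hx' hJ
  rw [norm_mul, mul_mul_mul_comm]
  exact mul_le_mul (hx hJ) (hx' hJ) (norm_nonneg _) ((norm_nonneg _).trans (hx hJ))

lemma Sym.aeBound (h : Sym l J W k w u) : AEBound l J w u := by
  cases k with
  | zero => exact h
  | succ k => exact h.1

lemma Sym.pred (h : Sym l J W (k + 1) w u) : Sym l J W k w u := by
  induction k generalizing w u with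
  | zero => exact h.1
  | succ k ih =>
    exact ⟨h.1, h.2.1.mono fun lam hl x hx => ⟨(hl x hx).1, fun _ => (hl x hx).2 (by omega)⟩,
      ih h.2.2⟩

lemma Sym.of_le {j : ℕ} (h : Sym l J W k w u) (hj : j ≤ k) : Sym l J W j w u := by
  induction hj with
  | refl => exact h
  | step _ ih => exact ih h.pred

lemma Sym.lipAt (h : Sym l J W k w u) (hk : 1 ≤ k) :
    ∀ᶠ lam in l, ∀ x ∈ J lam, LipAt (u lam) x := by
  obtain ⟨k, rfl⟩ := Nat.exists_eq_add_of_le' hk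
  exact h.2.1.mono fun lam hl x hx => (hl x hx).1

lemma Sym.mono (h : Sym l J W k w u) (hW : ∀ x, 0 ≤ W x) {C : ℝ} (hC : 0 ≤ C)
    (hw : ∀ᶠ lam in l, ∀ x ∈ J lam, w lam x ≤ C * w' lam x) : Sym l J W k w' u := by
  induction k generalizing w w' u with
  | zero => exact AEBound.mono h hC hw
  | succ k ih =>
    refine ⟨h.1.mono hC hw, h.2.1, ih h.2.2 ?_⟩
    filter_upwards [hw] with lam h1 x hx
    rw [mul_left_comm]
    exact mul_le_mul_of_nonneg_left (h1 x hx) (hW x)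

/-- At order 0 only the almost everywhere class matters. At positive order equality is required on
all of J, which is open, so that the two functions agree near each point and share their
derivatives. -/
lemma Sym.congr (h : Sym l J W k w u) (hJ : ∀ᶠ lam in l, IsOpen (J lam))
    (huv : ∀ᶠ lam in l, (∀ᵐ x, x ∈ J lam → u lam x = v lam x) ∧
      (1 ≤ k → ∀ x ∈ J lam, u lam x = v lam x)) : Sym l J W k w v := by
  have hb (h : AEBound l J w u) : AEBound l J w v := by
    obtain ⟨C, hC, h⟩ := h
    refine ⟨C, hC, ?_⟩
    filter_upwards [h, huv] with lam h1 h2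
    filter_upwards [h1, h2.1] with x hx hx' hJ
    rw [← hx' hJ]
    exact hx hJ
  induction k generalizing w u v with
  | zero => exact hb h
  | succ k ih =>
    refine ⟨hb h.1, ?_, ?_⟩
    · filter_upwards [h.2.1, huv, hJ] with lam h1 h2 h3 x hx
      have he : u lam =ᶠ[𝓝 x] v lam :=
        eventually_of_mem (h3.mem_nhds hx) fun y hy => h2.2 (by omega) y hy
      exact ⟨(h1 x hx).1.congr he, fun hk => ((h1 x hx).2 hk).congr_of_eventuallyEq he.symm⟩
    · have hd : ∀ᶠ lam in l, ∀ x ∈ J lam, deriv (u lam) x = deriv (v lam) x := by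
        filter_upwards [huv, hJ] with lam h2 h3 x hx
        have he : u lam =ᶠ[𝓝 x] v lam :=
          eventually_of_mem (h3.mem_nhds hx) fun y hy => h2.2 (by omega) y hy
        exact he.deriv_eq
      have hd' := hd.mono fun lam h => And.intro (ae_of_all volume h) fun (_ : 1 ≤ k) => h
      refine ih h.2.2 hd' fun hb' => ?_
      obtain ⟨C, hC, hb'⟩ := hb'
      refine ⟨C, hC, ?_⟩
      filter_upwards [hb', hd] with lam h1 h2
      filter_upwards [h1] with x hx hJ
      rw [← h2 x hJ]
      exact hx hJ

/-- The derivatives of two elements of `Sym (k + 1)` exist almost everywhere, and everywhere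
if `1 ≤ k`. -/
lemma Sym.ae_differentiable (h : Sym l J W (k + 1) w u) :
    ∀ᶠ lam in l, (∀ᵐ x, x ∈ J lam → DifferentiableAt ℝ (u lam) x) ∧
      (1 ≤ k → ∀ x ∈ J lam, DifferentiableAt ℝ (u lam) x) :=
  h.2.1.mono fun _ hl => ⟨ae_differentiableAt_of_lipAt fun x hx => (hl x hx).1,
    fun hk x hx => (hl x hx).2 hk⟩

lemma Sym.zero : Sym l J W k w (fun _ _ => 0) := by
  induction k generalizing w with
  | zero => exact ⟨0, le_rfl, by simp⟩
  | succ k ih =>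
    refine ⟨⟨0, le_rfl, by simp⟩, ?_, ?_⟩
    · exact Eventually.of_forall fun lam x _ => ⟨lipAt_const 0 x, fun _ => differentiableAt_const 0⟩
    · simpa using ih

lemma Sym.const {c : ℝ → ℂ} {C : ℝ} (hC : 0 ≤ C)
    (h : ∀ᶠ lam in l, ∀ x ∈ J lam, ‖c lam‖ ≤ C * w lam x) :
    Sym l J W k w (fun lam _ => c lam) := by
  have hb : AEBound l J w (fun lam _ => c lam) := ⟨C, hC, h.mono fun lam h => ae_of_all _ h⟩
  cases k with
  | zero => exact hb
  | succ k =>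
    refine ⟨hb, ?_, ?_⟩
    · exact Eventually.of_forall fun lam x _ => ⟨lipAt_const _ x, fun _ => differentiableAt_const _⟩
    · simpa using Sym.zero

lemma Sym.add (hJ : ∀ᶠ lam in l, IsOpen (J lam)) (hu : Sym l J W k w u) (hv : Sym l J W k w v) :
    Sym l J W k w (fun lam x => u lam x + v lam x) := by
  induction k generalizing w u v with
  | zero => exact AEBound.add hu hv
  | succ k ih =>
    refine ⟨hu.1.add hv.1, ?_, ?_⟩
    · filter_upwards [hu.2.1, hv.2.1] with lam h1 h2 x hx
      exact ⟨(h1 x hx).1.add (h2 x hx).1, fun hk => ((h1 x hx).2 hk).add ((h2 x hx).2 hk)⟩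
    · refine (ih hu.2.2 hv.2.2).congr hJ ?_
      filter_upwards [hu.ae_differentiable, hv.ae_differentiable] with lam h1 h2
      refine ⟨?_, fun hk x hx => (deriv_fun_add (h1.2 hk x hx) (h2.2 hk x hx)).symm⟩
      filter_upwards [h1.1, h2.1] with x hx hx' hJ
      exact (deriv_fun_add (hx hJ) (hx' hJ)).symm

lemma Sym.mul (hJ : ∀ᶠ lam in l, IsOpen (J lam)) (hu : Sym l J W k w u) (hv : Sym l J W k w' v) :
    Sym l J W k (fun lam x => w lam x * w' lam x) (fun lam x => u lam x * v lam x) := by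
  induction k generalizing w w' u v with
  | zero => exact AEBound.mul hu hv
  | succ k ih =>
    refine ⟨hu.1.mul hv.1, ?_, ?_⟩
    · filter_upwards [hu.2.1, hv.2.1] with lam h1 h2 x hx
      exact ⟨(h1 x hx).1.mul (h2 x hx).1, fun hk => ((h1 x hx).2 hk).mul ((h2 x hx).2 hk)⟩
    · have h1 := ih hu.2.2 hv.pred
      have h2 := ih hu.pred hv.2.2
      have e1 : (fun lam x => W x * w lam x * w' lam x) =
          fun lam x => W x * (w lam x * w' lam x) := by ext; ring
      have e2 : (fun lam x => w lam x * (W x * w' lam x)) =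
          fun lam x => W x * (w lam x * w' lam x) := by ext; ring
      rw [e1] at h1
      rw [e2] at h2
      refine (h1.add hJ h2).congr hJ ?_
      filter_upwards [hu.ae_differentiable, hv.ae_differentiable] with lam h1 h2
      refine ⟨?_, fun hk x hx => (deriv_fun_mul (h1.2 hk x hx) (h2.2 hk x hx)).symm⟩
      filter_upwards [h1.1, h2.1] with x hx hx' hJ
      exact (deriv_fun_mul (hx hJ) (hx' hJ)).symm

lemma Sym.const_mul (hJ : ∀ᶠ lam in l, IsOpen (J lam)) (c : ℂ) (hu : Sym l J W k w u) :
    Sym l J W k w (fun lam x => c * u lam x) := by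
  have h := Sym.mul hJ (Sym.const (c := fun _ => c) (w := fun _ _ => 1) (norm_nonneg c)
    (Eventually.of_forall fun lam x _ => by simp)) hu
  simpa using h

lemma Sym.sub (hJ : ∀ᶠ lam in l, IsOpen (J lam)) (hu : Sym l J W k w u) (hv : Sym l J W k w v) :
    Sym l J W k w (fun lam x => u lam x - v lam x) := by
  simpa [sub_eq_add_neg] using hu.add hJ (hv.const_mul hJ (-1))

lemma Sym.sum {ι : Type*} (hJ : ∀ᶠ lam in l, IsOpen (J lam)) (s : Finset ι) {U : ι → ℝ → ℝ → ℂ}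
    (h : ∀ i ∈ s, Sym l J W k w (U i)) : Sym l J W k w (fun lam x => ∑ i ∈ s, U i lam x) := by
  classical
  induction s using Finset.induction_on with
  | empty => simpa using Sym.zero
  | insert i s hi ih =>
    simp only [Finset.sum_insert hi]
    exact (h i (by simp)).add hJ (ih fun j hj => h j (by simp [hj]))

/-- Induction through (1/u)' = -u' · (1/u)²: the weights W w · w⁻¹ · w⁻¹ of the right-hand side
multiply to W w⁻¹. -/
lemma Sym.inv (hJ : ∀ᶠ lam in l, IsOpen (J lam)) (hW : ∀ x, 0 ≤ W x) (hu : Sym l J W k w u)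
    {c : ℝ} (hc : 0 < c) (hw : ∀ᶠ lam in l, ∀ x ∈ J lam, 0 < w lam x ∧ c * w lam x ≤ ‖u lam x‖) :
    Sym l J W k (fun lam x => (w lam x)⁻¹) (fun lam x => (u lam x)⁻¹) := by
  have hb : AEBound l J (fun lam x => (w lam x)⁻¹) (fun lam x => (u lam x)⁻¹) := by
    refine ⟨c⁻¹, by positivity, ?_⟩
    filter_upwards [hw] with lam h
    refine ae_of_all _ fun x hx => ?_
    obtain ⟨h1, h2⟩ := h x hx
    rw [norm_inv, ← mul_inv]
    exact inv_anti₀ (by positivity) h2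
  have h0 : ∀ᶠ lam in l, ∀ x ∈ J lam, u lam x ≠ 0 := by
    filter_upwards [hw] with lam h x hx
    obtain ⟨h1, h2⟩ := h x hx
    exact norm_pos_iff.1 (lt_of_lt_of_le (by positivity) h2)
  induction k with
  | zero => exact hb
  | succ k ih =>
    refine ⟨hb, ?_, ?_⟩
    · filter_upwards [hu.2.1, h0] with lam h1 h2 x hx
      exact ⟨(h1 x hx).1.inv (h2 x hx), fun hk => ((h1 x hx).2 hk).inv (h2 x hx)⟩
    · have hi := ih hu.pred
      have h1 := ((hu.2.2.mul hJ (hi.mul hJ hi)).const_mul hJ (-1)).mono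
        (w' := fun lam x => W x * (w lam x)⁻¹) hW zero_le_one (by
          filter_upwards [hw] with lam h x hx
          obtain ⟨h1, h2⟩ := h x hx
          refine le_of_eq ?_
          field_simp)
      refine h1.congr hJ ?_
      have hd {lam x : ℝ} (h : DifferentiableAt ℝ (u lam) x) (h0 : u lam x ≠ 0) :
          -1 * (deriv (u lam) x * ((u lam x)⁻¹ * (u lam x)⁻¹)) =
            deriv (fun x => (u lam x)⁻¹) x := by
        rw [deriv_fun_inv'' h h0]
        field_simp
      filter_upwards [hu.ae_differentiable, h0] with lam h1 h2
      refine ⟨?_, fun hk x hx => hd (h1.2 hk x hx) (h2 x hx)⟩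
      filter_upwards [h1.1] with x hx hJ
      exact hd (hx hJ) (h2 x hJ)

/-- A function is in the symbol class if its logarithmic derivative is. -/
lemma Sym.of_logDeriv {h : ℝ → ℝ → ℂ} (hJ : ∀ᶠ lam in l, IsOpen (J lam))
    (hh : Sym l J W k (fun _ x => W x) h) (hb : AEBound l J w u)
    (hd : ∀ᶠ lam in l, ∀ x ∈ J lam, LipAt (u lam) x ∧
      HasDerivAt (u lam) (h lam x * u lam x) x) : Sym l J W (k + 1) w u := by
  have hc : ∀ᶠ lam in l, ∀ x ∈ J lam, LipAt (u lam) x ∧ (1 ≤ k → DifferentiableAt ℝ (u lam) x) :=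
    hd.mono fun lam h1 x hx => ⟨(h1 x hx).1, fun _ => (h1 x hx).2.differentiableAt⟩
  have hdd : ∀ᶠ lam in l, ∀ x ∈ J lam, h lam x * u lam x = deriv (u lam) x :=
    hd.mono fun lam h1 x hx => (h1 x hx).2.deriv.symm
  have hdd' := hdd.mono fun lam h => And.intro (ae_of_all volume h) fun (_ : 1 ≤ k) => h
  induction k with
  | zero => exact ⟨hb, hc, (hh.mul hJ hb : Sym l J W 0 _ _).congr hJ hdd'⟩
  | succ k ih =>
    refine ⟨hb, hc, (hh.mul hJ (ih hh.pred ?_ ?_)).congr hJ hdd'⟩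
    · exact hc.mono fun lam h1 x hx => ⟨(h1 x hx).1, fun _ => (h1 x hx).2 (by omega)⟩
    · exact hdd.mono fun lam h => And.intro (ae_of_all volume h) fun (_ : 1 ≤ k) => h

lemma Sym.of_regW (hr : ∀ lam, RegW k (u lam))
    (hb : ∀ j ≤ k, AEBound l J (fun lam x => W x ^ j * w lam x) fun lam => iteratedDeriv j (u lam)) :
    Sym l J W k w u := by
  induction k generalizing w u with
  | zero => simpa [Sym] using hb 0 le_rfl
  | succ k ih =>
    refine ⟨by simpa using hb 0 (by omega), ?_, ih (fun lam => (hr lam).2.2) fun j hj => ?_⟩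
    · exact Eventually.of_forall fun lam x _ => ⟨(hr lam).1 x, fun hk => (hr lam).2.1 hk x⟩
    · have := hb (j + 1) (by omega)
      simp only [iteratedDeriv_succ', pow_succ, mul_assoc] at this
      exact this

end

end DiracWKB

end

noncomputable section

namespace DiracWKB

/-! ### The weight and the derivatives of the potential -/

lemma Side.sgn_mul_self (s : Side) : s.sgn * s.sgn = 1 := by cases s <;> simp [Side.sgn]

lemma Side.sgn_mul_sgn_mul (s : Side) (x : ℝ) : s.sgn * (s.sgn * x) = x := by
  rw [← mul_assoc, s.sgn_mul_self, one_mul]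

lemma Side.abs_sgn (s : Side) : |s.sgn| = 1 := by cases s <;> simp [Side.sgn]

lemma Side.abs_eq {s : Side} {x : ℝ} (h : 0 ≤ s.sgn * x) : |x| = s.sgn * x := by
  rw [← abs_of_nonneg h, abs_mul, s.abs_sgn, one_mul]

lemma exists_side (x : ℝ) : ∃ s : Side, 0 ≤ s.sgn * x := by
  rcases le_total 0 x with h | h
  · exact ⟨.plus, by simpa [Side.sgn]⟩
  · exact ⟨.minus, by simpa [Side.sgn]⟩

/-- The end to which a point belongs. -/
def sideOf (x : ℝ) : Side := if 0 ≤ x then .plus else .minus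

lemma sideOf_eq {s : Side} {x : ℝ} (h : 0 < s.sgn * x) : sideOf x = s := by
  cases s
  · simp only [Side.sgn, neg_mul, one_mul, Left.neg_pos_iff] at h
    simp [sideOf, h]
  · simp only [Side.sgn, one_mul] at h
    simp [sideOf, h.le]

lemma sideOf_nonneg (x : ℝ) : 0 ≤ (sideOf x).sgn * x := by
  rcases le_or_gt 0 x with h | h
  · simp [sideOf, h, Side.sgn]
  · simpa [sideOf, not_le.2 h, Side.sgn] using h.le

/-- The weight `max 1 |f|^ν_±` if `ν_± > 0`, and `1` otherwise. -/
def wt (f : ℝ → ℝ) (ν : Side → ℝ) (x : ℝ) : ℝ :=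
  if 0 < ν (sideOf x) then max 1 (|f x| ^ ν (sideOf x)) else 1

lemma one_le_wt (f : ℝ → ℝ) (ν : Side → ℝ) (x : ℝ) : 1 ≤ wt f ν x := by
  unfold wt
  split_ifs
  · exact le_max_left _ _
  · exact le_rfl

lemma wt_nonneg (f : ℝ → ℝ) (ν : Side → ℝ) (x : ℝ) : 0 ≤ wt f ν x :=
  zero_le_one.trans (one_le_wt f ν x)

section

variable {V : ℝ → Matrix (Fin 2) (Fin 2) ℂ} {N : ℕ} {f : ℝ → ℝ} {μ ε ν : Side → ℝ}

/-- For a negative exponent the power of |f| is bounded because `f_lower` keeps |f| away from 0, and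
the trivial weight 1 suffices. For a nonnegative exponent the threshold 1 serves only to exclude x =
0, so that x belongs to the end s. -/
lemma AssumptionA.rpow_le_wt (hA : AssumptionA V N f μ ε ν) (s : Side) (n : ℕ) :
    ∃ C a : ℝ, 0 ≤ C ∧ ∀ x, a ≤ s.sgn * x → |f x| ^ (n * ν s) ≤ C * wt f ν x ^ n := by
  rcases lt_or_ge (ν s) 0 with h | h
  · obtain ⟨c, hc, a, -, ha⟩ := hA.f_lower s h
    refine ⟨c ^ (n * ν s), a, by positivity, fun x hx => ?_⟩
    have h1 : |f x| ^ (n * ν s) ≤ c ^ (n * ν s) :=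
      Real.rpow_le_rpow_of_nonpos hc (ha x hx) (mul_nonpos_of_nonneg_of_nonpos (by positivity) h.le)
    exact h1.trans (le_mul_of_one_le_right (by positivity) (one_le_pow₀ (one_le_wt f ν x)))
  · refine ⟨1, 1, zero_le_one, fun x hx => ?_⟩
    have hs : sideOf x = s := sideOf_eq (by linarith)
    rw [one_mul, mul_comm, Real.rpow_mul (abs_nonneg _), Real.rpow_natCast]
    refine pow_le_pow_left₀ (by positivity) ?_ n
    rw [wt, hs]
    split_ifs with h0
    · exact le_max_right _ _
    · have : ν s = 0 := le_antisymm (not_lt.1 h0) h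
      simp [this]

lemma RegW.iteratedDeriv_bounded {k : ℕ} {u : ℝ → ℂ} (h : RegW (k + 1) u) {n : ℕ}
    (hn : n ≤ k + 1) (R : ℝ) : ∃ C : ℝ, ∀ x, |x| ≤ R → ‖iteratedDeriv n u x‖ ≤ C := by
  induction k generalizing n u with
  | zero =>
    rcases Nat.le_one_iff_eq_zero_or_eq_one.1 hn with rfl | rfl
    · obtain ⟨C, hC⟩ := (isCompact_Icc (a := -R) (b := R)).exists_bound_of_continuousOn
        (continuous_of_lipAt h.1).continuousOn
      exact ⟨C, fun x hx => by simpa using hC x (abs_le.1 hx)⟩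
    · simpa [iteratedDeriv_one] using norm_deriv_bounded h.1 R
  | succ k ih =>
    cases n with
    | zero =>
      obtain ⟨C, hC⟩ := (isCompact_Icc (a := -R) (b := R)).exists_bound_of_continuousOn
        (continuous_of_lipAt h.1).continuousOn
      exact ⟨C, fun x hx => by simpa using hC x (abs_le.1 hx)⟩
    | succ n =>
      simp only [iteratedDeriv_succ']
      exact ih h.2.2 (by omega)

/-- Bounds at both ends and on compact sets give global bounds. -/
lemma ae_bound_of_sides {u : ℝ → ℂ} {w : ℝ → ℝ} (hw : ∀ x, 1 ≤ w x)
    (hc : ∀ R : ℝ, ∃ C : ℝ, ∀ x, |x| ≤ R → ‖u x‖ ≤ C)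
    (hs : ∀ s : Side, ∃ C a : ℝ, ∀ᵐ x, a ≤ s.sgn * x → ‖u x‖ ≤ C * w x) :
    ∃ C : ℝ, 0 ≤ C ∧ ∀ᵐ x, ‖u x‖ ≤ C * w x := by
  obtain ⟨C1, a1, h1⟩ := hs .minus
  obtain ⟨C2, a2, h2⟩ := hs .plus
  obtain ⟨C3, h3⟩ := hc (max a1 a2)
  refine ⟨max 0 (max C1 (max C2 C3)), le_max_left _ _, ?_⟩
  filter_upwards [h1, h2] with x hx1 hx2
  have hw0 : 0 ≤ w x := zero_le_one.trans (hw x)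
  by_cases hx : |x| ≤ max a1 a2
  · refine (h3 x hx).trans ((?_ : C3 ≤ max 0 (max C1 (max C2 C3))).trans
      (le_mul_of_one_le_right (le_max_left _ _) (hw x)))
    simp
  · rw [not_le, max_lt_iff] at hx
    obtain ⟨s, hs⟩ := exists_side x
    rw [Side.abs_eq hs] at hx
    cases s
    · exact (hx1 hx.1.le).trans (mul_le_mul_of_nonneg_right (by simp) hw0)
    · exact (hx2 hx.2.le).trans (mul_le_mul_of_nonneg_right (by simp) hw0)

lemma AssumptionA.diag_regW (hA : AssumptionA V N f μ ε ν) (i : Fin 2) :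
    RegW (N + 1) fun x => V x i i :=
  (hA.diag_sobolev i).regW (hA.diag_continuous i)

lemma RegW.add {k : ℕ} {u v : ℝ → ℂ} (hu : RegW k u) (hv : RegW k v) :
    RegW k fun x => u x + v x := by
  induction k generalizing u v with
  | zero => trivial
  | succ k ih =>
    refine ⟨fun x => (hu.1 x).add (hv.1 x), fun hk => (hu.2.1 hk).add (hv.2.1 hk), ?_⟩
    cases k with
    | zero => trivial
    | succ k =>
      have : deriv (fun x => u x + v x) = fun x => deriv u x + deriv v x :=
        funext fun x => deriv_fun_add (hu.2.1 (by omega) x) (hv.2.1 (by omega) x)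
      rw [this]
      exact ih hu.2.2 hv.2.2

lemma RegW.const_mul {k : ℕ} {u : ℝ → ℂ} (c : ℂ) (hu : RegW k u) : RegW k fun x => c * u x := by
  induction k generalizing u with
  | zero => trivial
  | succ k ih =>
    refine ⟨fun x => (lipAt_const c x).mul (hu.1 x), fun hk => (hu.2.1 hk).const_mul c, ?_⟩
    have : deriv (fun x => c * u x) = fun x => c * deriv u x :=
      funext fun x => deriv_const_mul_field _
    rw [this]
    exact ih hu.2.2

lemma AssumptionA.off_regW (hA : AssumptionA V N f μ ε ν) (hN : 1 ≤ N) {i j : Fin 2}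
    (hij : i ≠ j) : RegW N fun x => V x i j :=
  (hA.off_sobolev i j hij).regW (hA.off_continuous hN i j hij)

lemma AssumptionA.sub_regW (hA : AssumptionA V N f μ ε ν) (hN : 1 ≤ N) :
    RegW N fun x => V x 1 0 - V x 0 1 := by
  have := (hA.off_regW hN (i := 1) (j := 0) (by simp)).add
    ((hA.off_regW hN (i := 0) (j := 1) (by simp)).const_mul (-1))
  simpa [sub_eq_add_neg] using this

/-- Near the ends this is the hypothesis on the derivatives. On a compact set V_ii may vanish where
its derivatives do not; the summand 1 takes care of that. -/
lemma AssumptionA.diag_bound (hA : AssumptionA V N f μ ε ν) (i : Fin 2) {n : ℕ}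
    (hn : n ≤ N + 1) : ∃ C : ℝ, 0 ≤ C ∧
      ∀ᵐ x, ‖iteratedDeriv n (fun y => V y i i) x‖ ≤ C * (wt f ν x ^ n * (1 + ‖V x i i‖)) := by
  rcases Nat.eq_zero_or_pos n with rfl | hn0
  · exact ⟨1, zero_le_one, ae_of_all _ fun x => by simp⟩
  refine ae_bound_of_sides (fun x => ?_) (fun R => (hA.diag_regW i).iteratedDeriv_bounded hn R)
    fun s => ?_
  · exact one_le_mul_of_one_le_of_one_le (one_le_pow₀ (one_le_wt f ν x)) (by simp)
  · obtain ⟨C, a, h⟩ := hA.diag_deriv s i n hn0 hn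
    obtain ⟨C', a', hC', h'⟩ := hA.rpow_le_wt s n
    refine ⟨|C| * C', max a a', ?_⟩
    filter_upwards [h] with x hx hxa
    have h1 := hx ((le_max_left _ _).trans hxa)
    have h2 := h' x ((le_max_right _ _).trans hxa)
    have hw : 0 ≤ wt f ν x ^ n := pow_nonneg (wt_nonneg f ν x) n
    calc _ ≤ C * (|f x| ^ (n * ν s) * ‖V x i i‖) := h1
      _ ≤ |C| * (|f x| ^ (n * ν s) * ‖V x i i‖) :=
        mul_le_mul_of_nonneg_right (le_abs_self C) (by positivity)
      _ ≤ |C| * ((C' * wt f ν x ^ n) * (1 + ‖V x i i‖)) := by gcongr; simp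
      _ = _ := by ring

lemma AssumptionA.sub_bound (hA : AssumptionA V N f μ ε ν) (hN : 1 ≤ N) {n : ℕ} (hn : n ≤ N) :
    ∃ C : ℝ, 0 ≤ C ∧ ∀ᵐ x, ‖iteratedDeriv n (fun y => V y 1 0 - V y 0 1) x‖ ≤
      C * wt f ν x ^ (n + 1) := by
  obtain ⟨k, rfl⟩ := Nat.exists_eq_add_of_le' hN
  refine ae_bound_of_sides (fun x => one_le_pow₀ (one_le_wt f ν x))
    (fun R => (hA.sub_regW hN).iteratedDeriv_bounded hn R) fun s => ?_
  obtain ⟨C, a, h⟩ := hA.off_deriv s n hn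
  obtain ⟨C', a', hC', h'⟩ := hA.rpow_le_wt s (n + 1)
  refine ⟨|C| * C', max a a', ?_⟩
  filter_upwards [h] with x hx hxa
  have h1 := hx ((le_max_left _ _).trans hxa)
  have h2 := h' x ((le_max_right _ _).trans hxa)
  push_cast at h2
  calc _ ≤ C * |f x| ^ ((n + 1) * ν s) := h1
    _ ≤ |C| * |f x| ^ ((n + 1) * ν s) :=
      mul_le_mul_of_nonneg_right (le_abs_self C) (by positivity)
    _ ≤ |C| * (C' * wt f ν x ^ (n + 1)) := by gcongr
    _ = _ := by ring

end

/-! ### The region of the cut-off -/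

lemma eventually_le_abs (R : ℝ) : ∀ᶠ lam : ℝ in atBot ⊔ atTop, R ≤ |lam| := by
  rw [eventually_sup]
  exact ⟨tendsto_abs_atBot_atTop.eventually_ge_atTop R,
    tendsto_abs_atTop_atTop.eventually_ge_atTop R⟩

lemma tendsto_abs_atTop' : Tendsto (fun lam : ℝ => |lam|) (atBot ⊔ atTop) atTop :=
  tendsto_atTop.2 eventually_le_abs

/-- `λ - m - V₁₁`. -/
def zOne (m : ℝ) (V : ℝ → Matrix (Fin 2) (Fin 2) ℂ) (lam x : ℝ) : ℂ := lam - m - V x 0 0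

/-- `λ + m - V₂₂`. -/
def zTwo (m : ℝ) (V : ℝ → Matrix (Fin 2) (Fin 2) ℂ) (lam x : ℝ) : ℂ := lam + m - V x 1 1

/-- The points where `V_λ` is well approximated by `λ²` up to the imaginary parts. -/
def nearSet (m : ℝ) (V : ℝ → Matrix (Fin 2) (Fin 2) ℂ) (e lam : ℝ) : Set ℝ :=
  {x | |(V x 0 0).re + m| < e * |lam| ∧ |(V x 1 1).re - m| < e * |lam| ∧
    |(V x 0 0).im - (V x 1 1).im| < e * |lam|}

/-- An open interval around `0` that contains the support of the cut-off. -/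
def dom (m : ℝ) (V : ℝ → Matrix (Fin 2) (Fin 2) ℂ) (e lam : ℝ) : Set ℝ :=
  connectedComponentIn (nearSet m V e lam) 0

/-- The interval `[-δ^-_λ, δ^+_λ]`. -/
def core (m : ℝ) (V : ℝ → Matrix (Fin 2) (Fin 2) ℂ) (f : ℝ → ℝ) (ν : Side → ℝ) (ε₁ η lam : ℝ) :
    Set ℝ :=
  {x | -delta m V f ν ε₁ η .minus lam ≤ x ∧ (x : EReal) ≤ delta m V f ν ε₁ η .plus lam}

section

variable {m : ℝ} {V : ℝ → Matrix (Fin 2) (Fin 2) ℂ} {N : ℕ} {f : ℝ → ℝ} {μ ε ν : Side → ℝ}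
  {ε₁ η e lam : ℝ}

lemma AssumptionA.isOpen_nearSet (hA : AssumptionA V N f μ ε ν) : IsOpen (nearSet m V e lam) := by
  have h0 := hA.diag_continuous 0
  have h1 := hA.diag_continuous 1
  have r0 := continuous_re.comp h0
  have r1 := continuous_re.comp h1
  have i0 := continuous_im.comp h0
  have i1 := continuous_im.comp h1
  exact (isOpen_lt (r0.add continuous_const).abs continuous_const).inter
    ((isOpen_lt (r1.sub continuous_const).abs continuous_const).inter
      (isOpen_lt (i0.sub i1).abs continuous_const))

lemma AssumptionA.isOpen_dom (hA : AssumptionA V N f μ ε ν) : IsOpen (dom m V e lam) :=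
  hA.isOpen_nearSet.connectedComponentIn

lemma dom_subset : dom m V e lam ⊆ nearSet m V e lam := connectedComponentIn_subset _ _

lemma ordConnected_dom : (dom m V e lam).OrdConnected :=
  isPreconnected_connectedComponentIn.ordConnected

lemma nearReal_of_mem_dom {x : ℝ} (he : 0 < e) (he' : e ≤ 1 / 10) (hlam : lam ≠ 0)
    (hx : x ∈ dom m V e lam) : NearReal e lam (zOne m V lam x) (zTwo m V lam x) := by
  obtain ⟨h1, h2, h3⟩ := dom_subset hx
  refine ⟨hlam, he, he', ?_, ?_, ?_⟩
  · rw [← abs_neg]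
    refine le_trans (le_of_eq ?_) h1.le
    congr 1
    simp [zOne]
    ring
  · rw [← abs_neg]
    refine le_trans (le_of_eq ?_) h2.le
    congr 1
    simp [zTwo]
    ring
  · rw [← abs_neg]
    refine le_trans (le_of_eq ?_) h3.le
    congr 1
    simp [zOne, zTwo]
    ring

/-- There is no cut-off at the end `s`. -/
def NoCut (V : ℝ → Matrix (Fin 2) (Fin 2) ℂ) (ν : Side → ℝ) (s : Side) : Prop :=
  TameAt V s ∧ ν s ≤ 0

lemma BoundedAt.exists_bound {s : Side} {h : ℝ → ℝ} (hb : BoundedAt s h) (hc : Continuous h) :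
    ∃ C : ℝ, ∀ x, 0 ≤ s.sgn * x → |h x| ≤ C := by
  obtain ⟨C, a, ha⟩ := hb
  obtain ⟨D, hD⟩ := (isCompact_Icc (a := -a) (b := a)).exists_bound_of_continuousOn
    hc.continuousOn
  refine ⟨max C D, fun x hx => ?_⟩
  rcases le_total a (s.sgn * x) with h | h
  · exact (ha x h).trans (le_max_left _ _)
  · rw [← Side.abs_eq hx] at h
    exact (hD x (abs_le.1 h)).trans (le_max_right _ _)

lemma AssumptionA.continuous_gDiag (hA : AssumptionA V N f μ ε ν) : Continuous (gDiag m V η) := by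
  have h0 := hA.diag_continuous 0
  have h1 := hA.diag_continuous 1
  have r0 := continuous_re.comp h0
  have r1 := continuous_re.comp h1
  have i0 := continuous_im.comp h0
  have i1 := continuous_im.comp h1
  exact (continuous_const.mul (r0.add continuous_const).abs).max
    ((continuous_const.mul (r1.sub continuous_const).abs).max
      (continuous_const.mul (i0.sub i1).abs))

lemma AssumptionA.continuous_gCut (hA : AssumptionA V N f μ ε ν) (hε₁ : ε₁ ∈ Set.Ioo (0 : ℝ) 1)
    (s : Side) : Continuous (gCut m V f ν ε₁ η s) := by
  have hp : 0 < ν s → Continuous fun x => |f x| ^ (2 * ν s / (1 - ε₁)) := fun h =>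
    hA.f_continuous.abs.rpow_const fun x => Or.inr (by have := hε₁.2; positivity [sub_pos.2 hε₁.2])
  unfold gCut
  by_cases ht : TameAt V s <;> by_cases hν : 0 < ν s <;> simp only [ht, hν, if_true, if_false]
  · exact hp hν
  · exact continuous_const
  · exact hA.continuous_gDiag.max (hp hν)
  · exact hA.continuous_gDiag

lemma rpow_le_gCut {s : Side} (hν : 0 < ν s) (x : ℝ) :
    |f x| ^ (2 * ν s / (1 - ε₁)) ≤ gCut m V f ν ε₁ η s x := by
  unfold gCut
  by_cases ht : TameAt V s <;> simp [ht, hν]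

lemma gDiag_le_gCut {s : Side} (ht : ¬ TameAt V s) (x : ℝ) :
    gDiag m V η x ≤ gCut m V f ν ε₁ η s x := by
  unfold gCut
  by_cases hν : 0 < ν s <;> simp [ht, hν]

/-- A bounded g_± would bound f if ν_± > 0, and would make the end tame otherwise. -/
lemma AssumptionA.gCut_unbounded (hA : AssumptionA V N f μ ε ν) (hε₁ : ε₁ ∈ Set.Ioo (0 : ℝ) 1)
    (hη : 0 < η) {s : Side} (hs : ¬ NoCut V ν s) (B : ℝ) :
    ∃ x, 0 ≤ s.sgn * x ∧ B < gCut m V f ν ε₁ η s x := by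
  by_contra hcon
  push Not at hcon
  have hexp : 0 < 1 - ε₁ := sub_pos.2 hε₁.2
  by_cases hν : 0 < ν s
  -- The bound for |f| comes from inverting the power in g_±; the maximum with 1 keeps the base
  -- positive.
  · refine hA.f_unbounded s ⟨(max B 1) ^ ((2 * ν s / (1 - ε₁))⁻¹), 0, fun x hx => ?_⟩
    have h1 := ((rpow_le_gCut hν x).trans (hcon x hx)).trans (le_max_left B 1)
    rw [← Real.rpow_le_rpow_iff (abs_nonneg _) (by positivity)
      (by positivity : 0 < 2 * ν s / (1 - ε₁)), ← Real.rpow_mul (by positivity),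
      inv_mul_cancel₀ (by positivity), Real.rpow_one]
    exact h1
  · have ht : ¬ TameAt V s := fun ht => hs ⟨ht, not_lt.1 hν⟩
    have h1 (x : ℝ) (hx : 0 ≤ s.sgn * x) : gDiag m V η x ≤ B :=
      (gDiag_le_gCut ht x).trans (hcon x hx)
    have h2 {c d : ℝ} (h : 1 / η * |c| ≤ d) : |c| ≤ η * d := by
      rw [one_div, inv_mul_le_iff₀ hη] at h
      exact h
    refine ht ⟨⟨η * B + |m|, 0, fun x hx => ?_⟩, ⟨η * B + |m|, 0, fun x hx => ?_⟩,
      ⟨η * B, 0, fun x hx => ?_⟩⟩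
    · have := h2 ((le_max_left _ _).trans (h1 x hx))
      have h3 := abs_sub ((V x 0 0).re + m) m
      rw [add_sub_cancel_right] at h3
      linarith
    · have := h2 ((le_max_left _ _).trans ((le_max_right _ _).trans (h1 x hx)))
      have h3 := abs_add_le ((V x 1 1).re - m) m
      rw [sub_add_cancel] at h3
      linarith
    · exact h2 ((le_max_right _ _).trans ((le_max_right _ _).trans (h1 x hx)))

lemma delta_eq_top {s : Side} (hs : NoCut V ν s) : delta m V f ν ε₁ η s lam = ⊤ := if_pos hs

lemma delta_eq_sInf {s : Side} (hs : ¬ NoCut V ν s) : delta m V f ν ε₁ η s lam =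
    sInf {y : EReal | ∃ x : ℝ, 0 ≤ x ∧ gCut m V f ν ε₁ η s (s.sgn * x) = |lam| ∧ y = x} :=
  if_neg hs

lemma Delta_eq_zero {s : Side} (hs : NoCut V ν s) : Delta m V f ν ε₁ η s lam = 0 := if_pos hs

lemma Delta_eq_inv {s : Side} (hs : ¬ NoCut V ν s) :
    Delta m V f ν ε₁ η s lam = (delta m V f ν ε₁ η s lam).toReal⁻¹ := if_neg hs

lemma delta_nonneg (s : Side) : 0 ≤ delta m V f ν ε₁ η s lam := by
  by_cases hs : NoCut V ν s
  · rw [delta_eq_top hs]; exact le_top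
  · rw [delta_eq_sInf hs]
    refine le_sInf ?_
    rintro y ⟨x, hx, -, rfl⟩
    exact_mod_cast hx

/-- Up to the cut-off radius, `g_±` does not exceed `|λ|`. -/
lemma AssumptionA.gCut_le (hA : AssumptionA V N f μ ε ν) (hε₁ : ε₁ ∈ Set.Ioo (0 : ℝ) 1)
    {s : Side} (hs : ¬ NoCut V ν s) (h0 : gCut m V f ν ε₁ η s 0 ≤ |lam|) {x : ℝ}
    (hx : 0 ≤ s.sgn * x) (hxd : ((s.sgn * x : ℝ) : EReal) ≤ delta m V f ν ε₁ η s lam) :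
    gCut m V f ν ε₁ η s x ≤ |lam| := by
  by_contra hcon
  rw [not_le] at hcon
  have hc : ContinuousOn (fun y => gCut m V f ν ε₁ η s (s.sgn * y)) (Set.Icc 0 (s.sgn * x)) :=
    ((hA.continuous_gCut hε₁ s).comp (continuous_const.mul continuous_id)).continuousOn
  have hmem : |lam| ∈ Set.Ico (gCut m V f ν ε₁ η s (s.sgn * 0))
      (gCut m V f ν ε₁ η s (s.sgn * (s.sgn * x))) := by
    rw [mul_zero, s.sgn_mul_sgn_mul]
    exact ⟨h0, hcon⟩
  obtain ⟨y, hy, hyl⟩ := intermediate_value_Ico hx hc hmem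
  have hle : delta m V f ν ε₁ η s lam ≤ ((y : ℝ) : EReal) := by
    rw [delta_eq_sInf hs]
    exact sInf_le ⟨y, hy.1, hyl, rfl⟩
  have := hxd.trans hle
  rw [EReal.coe_le_coe_iff] at this
  exact absurd hy.2 (not_lt.2 this)

/-- At an end with a cut-off, the radius is finite for large `|λ|` and tends to infinity. -/
lemma AssumptionA.delta_large (hA : AssumptionA V N f μ ε ν) (hε₁ : ε₁ ∈ Set.Ioo (0 : ℝ) 1)
    (hη : 0 < η) {s : Side} (hs : ¬ NoCut V ν s) (R : ℝ) :
    ∀ᶠ lam in atBot ⊔ atTop, ∃ d : ℝ, R ≤ d ∧ delta m V f ν ε₁ η s lam = d := by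
  have hc : Continuous fun y => gCut m V f ν ε₁ η s (s.sgn * y) :=
    (hA.continuous_gCut hε₁ s).comp (continuous_const.mul continuous_id)
  -- Once |λ| exceeds the bound B of g_± on [0, |R|], the level |λ| cannot be attained there, so the
  -- radius is at least |R|. It is attained somewhere by unboundedness and the intermediate value
  -- theorem, so the radius is finite.
  obtain ⟨B, hB⟩ := (isCompact_Icc (a := 0) (b := |R|)).exists_bound_of_continuousOn
    hc.continuousOn
  filter_upwards [eventually_le_abs (B + 1)] with lam hlam
  obtain ⟨x, hx, hxl⟩ := hA.gCut_unbounded (m := m) hε₁ hη hs |lam|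
  have h0 : gCut m V f ν ε₁ η s (s.sgn * 0) ≤ |lam| := by
    have := hB 0 ⟨le_rfl, abs_nonneg _⟩
    linarith [le_abs_self (gCut m V f ν ε₁ η s (s.sgn * 0)),
      Real.norm_eq_abs (gCut m V f ν ε₁ η s (s.sgn * 0))]
  obtain ⟨y, hy, hyl⟩ := intermediate_value_Icc hx hc.continuousOn
    ⟨h0, by rw [s.sgn_mul_sgn_mul]; exact hxl.le⟩
  have hle : delta m V f ν ε₁ η s lam ≤ ((y : ℝ) : EReal) := by
    rw [delta_eq_sInf hs]
    exact sInf_le ⟨y, hy.1, hyl, rfl⟩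
  have hge : ((|R| : ℝ) : EReal) ≤ delta m V f ν ε₁ η s lam := by
    rw [delta_eq_sInf hs]
    refine le_sInf ?_
    rintro z ⟨x, hx, hxl, rfl⟩
    rw [EReal.coe_le_coe_iff]
    by_contra hcon
    have := hB x ⟨hx, (not_le.1 hcon).le⟩
    rw [hxl, Real.norm_eq_abs, abs_abs] at this
    linarith
  have hfin : ((delta m V f ν ε₁ η s lam).toReal : EReal) = delta m V f ν ε₁ η s lam :=
    EReal.coe_toReal (fun h => by rw [h] at hle; exact absurd hle (by simp))
      (fun h => by rw [h] at hge; exact absurd hge (by simp))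
  refine ⟨_, ?_, hfin.symm⟩
  rw [← hfin, EReal.coe_le_coe_iff] at hge
  exact (le_abs_self R).trans hge

lemma mem_core_iff {x : ℝ} : x ∈ core m V f ν ε₁ η lam ↔
    ((-x : ℝ) : EReal) ≤ delta m V f ν ε₁ η .minus lam ∧
      (x : EReal) ≤ delta m V f ν ε₁ η .plus lam := by
  rw [core, Set.mem_ofPred_eq, EReal.coe_neg, EReal.neg_le]

lemma side_le_delta {x : ℝ} (hx : x ∈ core m V f ν ε₁ η lam) (s : Side) :
    ((s.sgn * x : ℝ) : EReal) ≤ delta m V f ν ε₁ η s lam := by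
  rw [mem_core_iff] at hx
  cases s
  · simpa [Side.sgn] using hx.1
  · simpa [Side.sgn] using hx.2

lemma ordConnected_core : (core m V f ν ε₁ η lam).OrdConnected := by
  refine ⟨fun x hx y hy z hz => ?_⟩
  rw [mem_core_iff] at hx hy ⊢
  refine ⟨le_trans ?_ hx.1, le_trans ?_ hy.2⟩
  · exact EReal.coe_le_coe_iff.2 (neg_le_neg hz.1)
  · exact EReal.coe_le_coe_iff.2 hz.2

lemma zero_mem_core : (0 : ℝ) ∈ core m V f ν ε₁ η lam := by
  rw [mem_core_iff]
  simp [delta_nonneg]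

lemma eventually_gCut_zero_le (m : ℝ) (V : ℝ → Matrix (Fin 2) (Fin 2) ℂ) (f : ℝ → ℝ)
    (ν : Side → ℝ) (ε₁ η : ℝ) :
    ∀ᶠ lam in atBot ⊔ atTop, ∀ s : Side, gCut m V f ν ε₁ η s 0 ≤ |lam| := by
  filter_upwards [eventually_le_abs (gCut m V f ν ε₁ η .minus 0),
    eventually_le_abs (gCut m V f ν ε₁ η .plus 0)] with lam h1 h2 s
  cases s
  · exact h1
  · exact h2

/-- At a tame end the three quantities are bounded and any large |λ| will do. Otherwise g_± ≤ |λ|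
bounds them by η|λ|. The parameter 2η leaves room for the strict inequalities that make the set
open. -/
lemma AssumptionA.core_subset_nearSet (hA : AssumptionA V N f μ ε ν)
    (hε₁ : ε₁ ∈ Set.Ioo (0 : ℝ) 1) (hη : 0 < η) :
    ∀ᶠ lam in atBot ⊔ atTop, core m V f ν ε₁ η lam ⊆ nearSet m V (2 * η) lam := by
  have hside (s : Side) : ∀ᶠ lam : ℝ in atBot ⊔ atTop, ∀ x ∈ core m V f ν ε₁ η lam,
      0 ≤ s.sgn * x → x ∈ nearSet m V (2 * η) lam := by
    by_cases ht : TameAt V s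
    · have h0 := hA.diag_continuous 0
      have h1 := hA.diag_continuous 1
      have r0 := continuous_re.comp h0
      have r1 := continuous_re.comp h1
      have i0 := continuous_im.comp h0
      have i1 := continuous_im.comp h1
      obtain ⟨C0, hC0⟩ := ht.1.exists_bound r0
      obtain ⟨C1, hC1⟩ := ht.2.1.exists_bound r1
      obtain ⟨C2, hC2⟩ := ht.2.2.exists_bound (i0.sub i1)
      filter_upwards [eventually_le_abs ((C0 + |m| + 1) / (2 * η)),
        eventually_le_abs ((C1 + |m| + 1) / (2 * η)), eventually_le_abs ((C2 + 1) / (2 * η))]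
        with lam l0 l1 l2 x _ hxs
      rw [div_le_iff₀' (by positivity)] at l0 l1 l2
      refine ⟨?_, ?_, ?_⟩
      · have := abs_add_le (V x 0 0).re m
        linarith [hC0 x hxs]
      · have := abs_sub (V x 1 1).re m
        linarith [hC1 x hxs]
      · linarith [hC2 x hxs]
    · filter_upwards [eventually_gCut_zero_le m V f ν ε₁ η, eventually_le_abs 1]
        with lam h0 hl x hx hxs
      have h1 := (gDiag_le_gCut ht x).trans (hA.gCut_le hε₁ (fun h => ht h.1) (h0 s) hxs
        (side_le_delta hx s))
      have h2 {c : ℝ} (h : 1 / η * |c| ≤ |lam|) : |c| < 2 * η * |lam| := by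
        rw [one_div, inv_mul_le_iff₀ hη] at h
        nlinarith [mul_pos hη (zero_lt_one.trans_le hl)]
      exact ⟨h2 ((le_max_left _ _).trans h1),
        h2 ((le_max_left _ _).trans ((le_max_right _ _).trans h1)),
        h2 ((le_max_right _ _).trans ((le_max_right _ _).trans h1))⟩
  filter_upwards [hside .minus, hside .plus] with lam h1 h2 x hx
  obtain ⟨s, hs⟩ := exists_side x
  cases s
  · exact h1 x hx hs
  · exact h2 x hx hs

lemma AssumptionA.core_subset_dom (hA : AssumptionA V N f μ ε ν)
    (hε₁ : ε₁ ∈ Set.Ioo (0 : ℝ) 1) (hη : 0 < η) :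
    ∀ᶠ lam in atBot ⊔ atTop, core m V f ν ε₁ η lam ⊆ dom m V (2 * η) lam := by
  filter_upwards [hA.core_subset_nearSet (m := m) hε₁ hη] with lam h
  exact ordConnected_core.isPreconnected.subset_connectedComponentIn zero_mem_core h

/-- The exponent 2ν_±/(1 - ε₁) in g_± is made for this: g_± ≤ |λ| says |f|^{2ν_±} ≤ |λ|^{1-ε₁}. -/
lemma AssumptionA.wt_sq_le (hA : AssumptionA V N f μ ε ν) (hε₁ : ε₁ ∈ Set.Ioo (0 : ℝ) 1) :
    ∀ᶠ lam in atBot ⊔ atTop, ∀ x ∈ core m V f ν ε₁ η lam, wt f ν x ^ 2 ≤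
      if 0 < ν (sideOf x) then |lam| ^ (1 - ε₁) else 1 := by
  filter_upwards [eventually_gCut_zero_le m V f ν ε₁ η, eventually_le_abs 1] with lam h0 hl x hx
  unfold wt
  split_ifs with hν
  · have hexp : 0 < 1 - ε₁ := sub_pos.2 hε₁.2
    have h1 := (rpow_le_gCut hν x).trans (hA.gCut_le (m := m) (η := η) hε₁
      (fun h => absurd h.2 (not_le.2 hν)) (h0 _) (sideOf_nonneg x) (side_le_delta hx _))
    have h2 : 1 ≤ |lam| ^ (1 - ε₁) := Real.one_le_rpow hl hexp.le
    rcases le_total (|f x| ^ ν (sideOf x)) 1 with h | h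
    · rw [max_eq_left h]; simpa using h2
    · rw [max_eq_right h]
      calc (|f x| ^ ν (sideOf x)) ^ 2 = (|f x| ^ (2 * ν (sideOf x) / (1 - ε₁))) ^ (1 - ε₁) := by
            rw [← Real.rpow_mul (abs_nonneg _), div_mul_cancel₀ _ hexp.ne', mul_comm,
              Real.rpow_mul (abs_nonneg _)]
            norm_num
        _ ≤ _ := Real.rpow_le_rpow (by positivity) h1 hexp.le
  · simp

end

end DiracWKB

end

noncomputable section

namespace DiracWKB

/-! ### Symbol estimates for the phase -/

/-- `λ^{-(k-1)} ψ'_{k-1}`. -/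
def Phi (m : ℝ) (V : ℝ → Matrix (Fin 2) (Fin 2) ℂ) (k : ℕ) (lam x : ℝ) : ℂ :=
  (lam : ℂ) ^ (1 - (k : ℤ)) * dpsi m V lam k x

/-- The logarithmic derivative of `K_λ`. -/
def logK (m : ℝ) (V : ℝ → Matrix (Fin 2) (Fin 2) ℂ) (lam x : ℝ) : ℂ :=
  -I * (V x 1 0 - V x 0 1) - deriv (zTwo m V lam) x * (zTwo m V lam x)⁻¹

/-- `|λ + m - V₂₂|`. -/
def rho (m : ℝ) (V : ℝ → Matrix (Fin 2) (Fin 2) ℂ) (lam x : ℝ) : ℝ := ‖zTwo m V lam x‖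

lemma Vlam_eq (m : ℝ) (V : ℝ → Matrix (Fin 2) (Fin 2) ℂ) (lam x : ℝ) :
    Vlam m V lam x = zOne m V lam x * zTwo m V lam x := rfl

section

variable {m : ℝ} {V : ℝ → Matrix (Fin 2) (Fin 2) ℂ} {N : ℕ} {f : ℝ → ℝ} {μ ε ν : Side → ℝ}
  {e : ℝ}

lemma eventually_nearReal (he : 0 < e) (he' : e ≤ 1 / 10) : ∀ᶠ lam in atBot ⊔ atTop,
    ∀ x ∈ dom m V e lam, NearReal e lam (zOne m V lam x) (zTwo m V lam x) := by
  filter_upwards [eventually_le_abs 1] with lam hl x hx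
  exact nearReal_of_mem_dom he he' (fun h => by simp [h] at hl; linarith) hx

lemma AssumptionA.eventually_isOpen_dom (hA : AssumptionA V N f μ ε ν) :
    ∀ᶠ lam in atBot ⊔ atTop, IsOpen (dom m V e lam) :=
  Eventually.of_forall fun _ => hA.isOpen_dom

/-- Both |λ| and |λ - m - V₁₁| are at most 2ρ, and each diagonal entry is a difference of such terms
and constants. Hence the single size ρ serves for both factors of V_λ and for the entries
themselves. -/
lemma eventually_diag_le_rho (he : 0 < e) (he' : e ≤ 1 / 10) (i : Fin 2) :
    ∀ᶠ lam in atBot ⊔ atTop, ∀ x ∈ dom m V e lam,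
      1 + ‖V x i i‖ ≤ 2 * (3 + |m|) * rho m V lam x := by
  filter_upwards [eventually_le_abs 1, eventually_nearReal (m := m) (V := V) he he'] with lam hl h x hx
  have hn := h x hx
  have h1 : |lam| ≤ 2 * rho m V lam x := by have := hn.norm_right'; unfold rho; linarith
  have h2 : ‖V x i i‖ ≤ |lam| + |m| + 2 * rho m V lam x := by
    fin_cases i
    · have : V x 0 0 = ((lam : ℂ) - m) - zOne m V lam x := by simp [zOne]
      simp only [Fin.zero_eta]
      rw [this]
      refine (norm_sub_le _ _).trans (add_le_add ((norm_sub_le _ _).trans ?_) hn.norm_le)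
      simp
    · have : V x 1 1 = ((lam : ℂ) + m) - zTwo m V lam x := by simp [zTwo]
      simp only [Fin.mk_one]
      rw [this]
      refine (norm_sub_le _ _).trans (add_le_add ((norm_add_le _ _).trans ?_) ?_)
      · simp
      · have : 0 ≤ rho m V lam x := norm_nonneg _
        change rho m V lam x ≤ _
        linarith
  have h3 : |m| ≤ |m| * |lam| := le_mul_of_one_le_right (abs_nonneg _) hl
  have h4 : |m| * |lam| ≤ |m| * (2 * rho m V lam x) := mul_le_mul_of_nonneg_left h1 (abs_nonneg _)
  linarith

lemma rho_pos {lam x : ℝ} {z : ℂ} (h : NearReal e lam z (zTwo m V lam x)) : 0 < rho m V lam x :=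
  norm_pos_iff.2 h.right_ne

variable (hA : AssumptionA V N f μ ε ν) (he : 0 < e) (he' : e ≤ 1 / 10)

include hA he he' in
lemma AssumptionA.sym_diag (i : Fin 2) :
    Sym (atBot ⊔ atTop) (dom m V e) (wt f ν) (N + 1) (rho m V) fun _ x => V x i i := by
  refine Sym.of_regW (fun _ => hA.diag_regW i) fun j hj => ?_
  obtain ⟨C, hC, h⟩ := hA.diag_bound i hj
  have hb : AEBound (atBot ⊔ atTop) (dom m V e)
      (fun _ x => wt f ν x ^ j * (1 + ‖V x i i‖)) fun _ => iteratedDeriv j fun x => V x i i :=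
    ⟨C, hC, Eventually.of_forall fun lam => h.mono fun x hx _ => hx⟩
  refine hb.mono (C := 2 * (3 + |m|)) (by positivity) ?_
  filter_upwards [eventually_diag_le_rho (m := m) (V := V) he he' i] with lam h x hx
  rw [mul_left_comm]
  exact mul_le_mul_of_nonneg_left (h x hx) (pow_nonneg (wt_nonneg f ν x) j)

lemma eventually_const_le_rho (he : 0 < e) (he' : e ≤ 1 / 10) (m' : ℝ) :
    ∀ᶠ lam in atBot ⊔ atTop, ∀ x ∈ dom m V e lam,
      ‖(lam : ℂ) + m'‖ ≤ 2 * (1 + |m'|) * rho m V lam x := by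
  filter_upwards [eventually_le_abs 1, eventually_nearReal (m := m) (V := V) he he'] with lam hl h x hx
  have h1 : |lam| ≤ 2 * rho m V lam x := by have := (h x hx).norm_right'; unfold rho; linarith
  have h2 : ‖(lam : ℂ) + m'‖ ≤ |lam| + |m'| := (norm_add_le _ _).trans (by simp)
  have h3 : |m'| ≤ |m'| * |lam| := le_mul_of_one_le_right (abs_nonneg _) hl
  have h4 : |m'| * |lam| ≤ |m'| * (2 * rho m V lam x) :=
    mul_le_mul_of_nonneg_left h1 (abs_nonneg _)
  linarith

include hA he he' in
lemma AssumptionA.sym_zOne :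
    Sym (atBot ⊔ atTop) (dom m V e) (wt f ν) (N + 1) (rho m V) (zOne m V) := by
  have h := (Sym.const (J := dom m V e) (W := wt f ν) (k := N + 1) (by positivity)
    (eventually_const_le_rho (m := m) (V := V) he he' (-m))).sub hA.eventually_isOpen_dom
    (hA.sym_diag he he' 0)
  simpa [zOne, sub_eq_add_neg] using! h

include hA he he' in
lemma AssumptionA.sym_zTwo :
    Sym (atBot ⊔ atTop) (dom m V e) (wt f ν) (N + 1) (rho m V) (zTwo m V) :=
  (Sym.const (J := dom m V e) (W := wt f ν) (k := N + 1) (by positivity)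
    (eventually_const_le_rho (m := m) (V := V) he he' m)).sub hA.eventually_isOpen_dom
    (hA.sym_diag he he' 1)

include hA he he' in
lemma AssumptionA.sym_inv_zOne :
    Sym (atBot ⊔ atTop) (dom m V e) (wt f ν) (N + 1) (fun lam x => (rho m V lam x)⁻¹)
      fun lam x => (zOne m V lam x)⁻¹ := by
  refine (hA.sym_zOne he he').inv hA.eventually_isOpen_dom (wt_nonneg f ν) (c := 1 / 2)
    (by norm_num) ?_
  filter_upwards [eventually_nearReal (m := m) (V := V) he he'] with lam h x hx
  have := (h x hx).norm_ge
  exact ⟨rho_pos (h x hx), by unfold rho; linarith⟩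

include hA he he' in
lemma AssumptionA.sym_inv_zTwo :
    Sym (atBot ⊔ atTop) (dom m V e) (wt f ν) (N + 1) (fun lam x => (rho m V lam x)⁻¹)
      fun lam x => (zTwo m V lam x)⁻¹ := by
  refine (hA.sym_zTwo he he').inv hA.eventually_isOpen_dom (wt_nonneg f ν) (c := 1)
    (by norm_num) ?_
  filter_upwards [eventually_nearReal (m := m) (V := V) he he'] with lam h x hx
  exact ⟨rho_pos (h x hx), by unfold rho; linarith⟩

include hA he he' in
lemma AssumptionA.sym_logDeriv {z : ℝ → ℝ → ℂ}
    (hz : Sym (atBot ⊔ atTop) (dom m V e) (wt f ν) (N + 1) (rho m V) z)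
    (hz' : Sym (atBot ⊔ atTop) (dom m V e) (wt f ν) (N + 1) (fun lam x => (rho m V lam x)⁻¹)
      fun lam x => (z lam x)⁻¹) :
    Sym (atBot ⊔ atTop) (dom m V e) (wt f ν) N (fun _ x => wt f ν x)
      fun lam x => deriv (z lam) x * (z lam x)⁻¹ := by
  refine (hz.2.2.mul hA.eventually_isOpen_dom hz'.pred).mono (wt_nonneg f ν) zero_le_one ?_
  filter_upwards [eventually_nearReal (m := m) (V := V) he he'] with lam h x hx
  have := rho_pos (h x hx)
  refine le_of_eq ?_
  field_simp

lemma AssumptionA.differentiable_diag (hA : AssumptionA V N f μ ε ν) (hN : 1 ≤ N) (i : Fin 2) :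
    Differentiable ℝ fun x => V x i i :=
  (hA.diag_regW i).2.1 hN

lemma AssumptionA.differentiable_zOne (hA : AssumptionA V N f μ ε ν) (hN : 1 ≤ N) (lam : ℝ) :
    Differentiable ℝ (zOne m V lam) :=
  (differentiable_const _).sub (hA.differentiable_diag hN 0)

lemma AssumptionA.differentiable_zTwo (hA : AssumptionA V N f μ ε ν) (hN : 1 ≤ N) (lam : ℝ) :
    Differentiable ℝ (zTwo m V lam) :=
  (differentiable_const _).sub (hA.differentiable_diag hN 1)

lemma AssumptionA.lipAt_zOne (hA : AssumptionA V N f μ ε ν) (lam x : ℝ) :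
    LipAt (zOne m V lam) x := by
  have := (lipAt_const ((lam : ℂ) - m) x).add ((lipAt_const (-1) x).mul ((hA.diag_regW 0).1 x))
  simpa [zOne, sub_eq_add_neg] using! this

lemma AssumptionA.lipAt_zTwo (hA : AssumptionA V N f μ ε ν) (lam x : ℝ) :
    LipAt (zTwo m V lam) x := by
  have := (lipAt_const ((lam : ℂ) + m) x).add ((lipAt_const (-1) x).mul ((hA.diag_regW 1).1 x))
  simpa [zTwo, sub_eq_add_neg] using! this

lemma contDiffAt_cpow_half {z : ℂ} (hz : z ∈ slitPlane) :
    ContDiffAt ℝ 1 (fun w : ℂ => w ^ (1 / 2 : ℂ)) z := by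
  have : (fun w : ℂ => w ^ (1 / 2 : ℂ)) =ᶠ[𝓝 z] fun w => exp (log w * (1 / 2 : ℂ)) := by
    filter_upwards [isOpen_slitPlane.mem_nhds hz] with w hw
    rw [cpow_def_of_ne_zero (slitPlane_ne_zero hw)]
  refine ContDiffAt.congr_of_eventuallyEq ?_ this
  have h1 : ContDiffAt ℂ 1 (fun w => exp (log w * (1 / 2 : ℂ))) z :=
    ((contDiffAt_log hz).mul contDiffAt_const).cexp
  exact h1.restrict_scalars ℝ

lemma AssumptionA.hasDerivAt_Vlam (hA : AssumptionA V N f μ ε ν) (hN : 1 ≤ N) (lam x : ℝ) :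
    HasDerivAt (Vlam m V lam) (deriv (zOne m V lam) x * zTwo m V lam x +
        zOne m V lam x * deriv (zTwo m V lam) x) x := by
  have h1 := (hA.differentiable_zOne (m := m) hN lam x).hasDerivAt
  have h2 := (hA.differentiable_zTwo (m := m) hN lam x).hasDerivAt
  exact h1.fun_mul h2

lemma hasDerivAt_cpow_half {g : ℝ → ℂ} {g' : ℂ} {x : ℝ} (hg : HasDerivAt g g' x)
    (hs : g x ∈ slitPlane) :
    HasDerivAt (fun y => g y ^ (1 / 2 : ℂ)) (1 / 2 * g' / g x * g x ^ (1 / 2 : ℂ)) x := by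
  have hc := (hasStrictDerivAt_cpow_const (c := 1 / 2) hs).hasDerivAt.scomp x hg
  have h0 := slitPlane_ne_zero hs
  refine hc.congr_deriv ?_
  rw [cpow_sub _ _ h0, cpow_one, smul_eq_mul]
  field_simp

include hA he he' in
-- The logarithmic derivative of V_λ^{1/2} is half the sum of those of its two factors, which are
-- symbols of size w; this spares repeated differentiation of the root. The size follows from |V_λ|
-- ≤ 2ρ².
lemma AssumptionA.sym_sqrt (hN : 1 ≤ N) :
    Sym (atBot ⊔ atTop) (dom m V e) (wt f ν) (N + 1) (rho m V)
      fun lam x => Vlam m V lam x ^ (1 / 2 : ℂ) := by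
  have h1 := hA.sym_logDeriv he he' (hA.sym_zOne (m := m) he he') (hA.sym_inv_zOne he he')
  have h2 := hA.sym_logDeriv he he' (hA.sym_zTwo (m := m) he he') (hA.sym_inv_zTwo he he')
  refine Sym.of_logDeriv hA.eventually_isOpen_dom
    ((h1.add hA.eventually_isOpen_dom h2).const_mul hA.eventually_isOpen_dom (1 / 2)) ?_ ?_
  · refine ⟨2, by norm_num, ?_⟩
    filter_upwards [eventually_nearReal (m := m) (V := V) he he'] with lam h
    refine ae_of_all _ fun x hx => ?_
    have h3 := norm_cpow_half_sq (Vlam m V lam x)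
    have h4 := (h x hx).norm_le
    refine (abs_le_of_sq_le_sq' ?_ (by unfold rho; positivity)).2
    rw [h3, Vlam_eq, norm_mul]
    unfold rho
    nlinarith [norm_nonneg (zTwo m V lam x)]
  · filter_upwards [eventually_nearReal (m := m) (V := V) he he'] with lam h x hx
    have hs : Vlam m V lam x ∈ slitPlane := (h x hx).mul_mem_slitPlane
    constructor
    · have hL : LipAt (Vlam m V lam) x := (hA.lipAt_zOne lam x).mul (hA.lipAt_zTwo lam x)
      exact LipAt.comp (g := fun w => w ^ (1 / 2 : ℂ)) hL (contDiffAt_cpow_half hs)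
    · have hd' := hA.hasDerivAt_Vlam (m := m) hN lam x
      have ho := (h x hx).left_ne
      have ht := (h x hx).right_ne
      refine (hasDerivAt_cpow_half hd' hs).congr_deriv ?_
      congr 1
      rw [Vlam_eq]
      field_simp

lemma Phi_zero {lam : ℝ} (hl : lam ≠ 0) (x : ℝ) :
    Phi m V 0 lam x = (Real.sign lam : ℂ) * I * Vlam m V lam x ^ (1 / 2 : ℂ) := by
  have : (lam : ℂ) ≠ 0 := by exact_mod_cast hl
  rw [Phi, dpsi]
  simp only [Nat.cast_zero, sub_zero, zpow_one]
  field_simp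

lemma norm_sign_mul_I {lam : ℝ} (hl : lam ≠ 0) : ‖(Real.sign lam : ℂ) * I‖ = 1 := by
  rcases lt_or_gt_of_ne hl with h | h
  · simp [Real.sign_of_neg h]
  · simp [Real.sign_of_pos h]

lemma Phi_zero_sq {lam : ℝ} (hl : lam ≠ 0) (x : ℝ) : Phi m V 0 lam x ^ 2 = -Vlam m V lam x := by
  rw [Phi_zero hl, mul_pow, sq_cpow_half, mul_pow, I_sq]
  rcases lt_or_gt_of_ne hl with h | h
  · simp [Real.sign_of_neg h]
  · simp [Real.sign_of_pos h]

lemma eventually_ne_zero : ∀ᶠ lam : ℝ in atBot ⊔ atTop, lam ≠ 0 := by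
  filter_upwards [eventually_le_abs 1] with lam hl h
  simp [h] at hl
  linarith

include hA he he' in
lemma AssumptionA.sym_Phi_zero (hN : 1 ≤ N) :
    Sym (atBot ⊔ atTop) (dom m V e) (wt f ν) (N + 1) (rho m V) (Phi m V 0) := by
  have hc : Sym (atBot ⊔ atTop) (dom m V e) (wt f ν) (N + 1) (fun _ _ => 1)
      fun lam _ => (Real.sign lam : ℂ) * I := by
    refine Sym.const zero_le_one ?_
    filter_upwards [eventually_ne_zero] with lam hl x _
    rw [norm_sign_mul_I hl, mul_one]
  have h := hc.mul hA.eventually_isOpen_dom (hA.sym_sqrt (m := m) he he' hN)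
  simp only [one_mul] at h
  refine h.congr hA.eventually_isOpen_dom ?_
  filter_upwards [eventually_ne_zero] with lam hl
  exact ⟨ae_of_all _ fun x _ => (Phi_zero hl x).symm, fun _ x _ => (Phi_zero hl x).symm⟩

lemma norm_Phi_zero_sq {lam : ℝ} (hl : lam ≠ 0) (x : ℝ) :
    ‖Phi m V 0 lam x‖ ^ 2 = ‖zOne m V lam x‖ * ‖zTwo m V lam x‖ := by
  rw [← norm_pow, Phi_zero_sq hl, norm_neg, Vlam_eq, norm_mul]

lemma eventually_rho_le_Phi_zero (he : 0 < e) (he' : e ≤ 1 / 10) : ∀ᶠ lam in atBot ⊔ atTop,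
    ∀ x ∈ dom m V e lam, 0 < rho m V lam x ∧ 1 / 2 * rho m V lam x ≤ ‖Phi m V 0 lam x‖ := by
  filter_upwards [eventually_nearReal (m := m) (V := V) he he', eventually_ne_zero] with lam h hl x hx
  have h4 := (h x hx).norm_ge
  refine ⟨rho_pos (h x hx), ?_⟩
  refine (abs_le_of_sq_le_sq' ?_ (norm_nonneg _)).2
  rw [norm_Phi_zero_sq hl]
  unfold rho
  nlinarith [norm_nonneg (zTwo m V lam x)]

include hA he he' in
lemma AssumptionA.sym_inv_Phi_zero (hN : 1 ≤ N) :
    Sym (atBot ⊔ atTop) (dom m V e) (wt f ν) (N + 1) (fun lam x => (rho m V lam x)⁻¹)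
      fun lam x => (Phi m V 0 lam x)⁻¹ :=
  (hA.sym_Phi_zero he he' hN).inv hA.eventually_isOpen_dom (wt_nonneg f ν) (c := 1 / 2)
    (by norm_num) (eventually_rho_le_Phi_zero he he')

include hA he he' in
lemma AssumptionA.sym_logK (hN : 1 ≤ N) :
    Sym (atBot ⊔ atTop) (dom m V e) (wt f ν) N (fun _ x => wt f ν x) (logK m V) := by
  refine Sym.sub hA.eventually_isOpen_dom (Sym.const_mul hA.eventually_isOpen_dom _ ?_)
    (hA.sym_logDeriv he he' (hA.sym_zTwo he he') (hA.sym_inv_zTwo he he'))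
  refine Sym.of_regW (fun _ => hA.sub_regW hN) fun j hj => ?_
  obtain ⟨C, hC, h⟩ := hA.sub_bound hN hj
  exact ⟨C, hC, Eventually.of_forall fun lam => h.mono fun x hx _ => by
    simpa only [pow_succ] using! hx⟩

lemma hasDerivAt_k₁ (h : Continuous fun x => V x 1 0) (x : ℝ) :
    HasDerivAt (k₁ V) (-I * V x 1 0 * k₁ V x) x := by
  have h1 := (intervalIntegral.integral_hasDerivAt_right (h.intervalIntegrable 0 x)
    h.stronglyMeasurable.stronglyMeasurableAtFilter h.continuousAt).const_mul (-I)
  refine h1.cexp.congr_deriv ?_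
  rw [k₁]
  ring

lemma hasDerivAt_k₂ (h : Continuous fun x => V x 0 1) (x : ℝ) :
    HasDerivAt (k₂ V) (-I * V x 0 1 * k₂ V x) x := by
  have h1 := (intervalIntegral.integral_hasDerivAt_right (h.intervalIntegrable 0 x)
    h.stronglyMeasurable.stronglyMeasurableAtFilter h.continuousAt).const_mul (-I)
  refine h1.cexp.congr_deriv ?_
  rw [k₂]
  ring

lemma k₁_ne_zero (V : ℝ → Matrix (Fin 2) (Fin 2) ℂ) (x : ℝ) : k₁ V x ≠ 0 := exp_ne_zero _

lemma k₂_ne_zero (V : ℝ → Matrix (Fin 2) (Fin 2) ℂ) (x : ℝ) : k₂ V x ≠ 0 := exp_ne_zero _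

lemma AssumptionA.hasDerivAt_Klam (hA : AssumptionA V N f μ ε ν) (hN : 1 ≤ N) {lam x : ℝ}
    (hz : zTwo m V lam x ≠ 0) : HasDerivAt (Klam m V lam) (logK m V lam x * Klam m V lam x) x := by
  have h1 := hasDerivAt_k₁ (hA.off_continuous hN 1 0 (by simp)) x
  have h2 := hasDerivAt_k₂ (hA.off_continuous hN 0 1 (by simp)) x
  have h3 := (hA.differentiable_zTwo (m := m) hN lam x).hasDerivAt
  have h4 := (h1.fun_div h2 (k₂_ne_zero V x)).fun_mul (h3.fun_inv hz)
  have e1 : Klam m V lam = fun x => k₁ V x / k₂ V x * (zTwo m V lam x)⁻¹ := by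
    ext y; simp [Klam, zTwo]
  have hk := k₂_ne_zero V x
  rw [e1]
  refine h4.congr_deriv ?_
  rw [logK]
  field_simp
  ring

lemma AssumptionA.deriv_Klam_div (hA : AssumptionA V N f μ ε ν) (hN : 1 ≤ N) {lam x : ℝ}
    (hz : zTwo m V lam x ≠ 0) : deriv (Klam m V lam) x / Klam m V lam x = logK m V lam x := by
  have : Klam m V lam x ≠ 0 := by
    have : Klam m V lam x = k₁ V x / k₂ V x * (1 / zTwo m V lam x) := rfl
    rw [this]
    exact mul_ne_zero (div_ne_zero (k₁_ne_zero V x) (k₂_ne_zero V x)) (one_div_ne_zero hz)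
  rw [(hA.hasDerivAt_Klam hN hz).deriv, mul_div_cancel_right₀ _ this]

/-- The recursion for the rescaled phase functions. -/
lemma AssumptionA.Phi_succ (hA : AssumptionA V N f μ ε ν) (hN : 1 ≤ N) {lam x : ℝ} (hl : lam ≠ 0)
    (hz : zTwo m V lam x ≠ 0) (k : ℕ) : Phi m V (k + 1) lam x =
      (1 / 2) * ((Phi m V 0 lam x)⁻¹ * (deriv (Phi m V k lam) x + logK m V lam x * Phi m V k lam x
        - ∑ j : Fin k, Phi m V (j + 1) lam x * Phi m V (k - j) lam x)) := by
  have hlc : (lam : ℂ) ≠ 0 := by exact_mod_cast hl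
  have hd : deriv (Phi m V k lam) x = (lam : ℂ) ^ (1 - (k : ℤ)) * deriv (dpsi m V lam k) x :=
    deriv_const_mul_field _
  have hs : ∑ j : Fin k, Phi m V (j + 1) lam x * Phi m V (k - j) lam x =
      (lam : ℂ) ^ (1 - (k : ℤ)) *
        ∑ j : Fin k, dpsi m V lam (j + 1) x * dpsi m V lam (k - j) x := by
    rw [Finset.mul_sum]
    refine Finset.sum_congr rfl fun j _ => ?_
    have hj := j.2
    have : (lam : ℂ) ^ (1 - (k : ℤ)) =
        (lam : ℂ) ^ (1 - ((j + 1 : ℕ) : ℤ)) * (lam : ℂ) ^ (1 - ((k - j : ℕ) : ℤ)) := by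
      rw [← zpow_add₀ hlc]
      congr 1
      omega
    rw [this, Phi, Phi]
    ring
  rw [hd, hs]
  have e0 : Phi m V 0 lam x = lam * dpsi m V lam 0 x := by simp [Phi]
  have e1 : (lam : ℂ) ^ (1 - ((k + 1 : ℕ) : ℤ)) = (lam : ℂ) ^ (1 - (k : ℤ)) * (lam : ℂ)⁻¹ := by
    rw [← zpow_sub_one₀ hlc]
    congr 1
    push_cast
    ring
  rw [e0, mul_inv, ← hA.deriv_Klam_div hN hz]
  conv_lhs => rw [Phi, dpsi, e1]
  rw [Phi]
  ring

/-- The size of the rescaled phase functions. -/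
def wPhi (m : ℝ) (V : ℝ → Matrix (Fin 2) (Fin 2) ℂ) (f : ℝ → ℝ) (ν : Side → ℝ) (k : ℕ)
    (lam x : ℝ) : ℝ := wt f ν x ^ k * (rho m V lam x * (rho m V lam x)⁻¹ ^ k)

include hA he he' in
-- Each step of the recursion uses up one derivative. All three terms of the bracket have size
-- w^{k+1} ρ^{1-k}: for the derivative and for K'/K the extra factor is w, and in the sum the
-- indices add up to k + 1. Division by Φ₀ supplies the missing ρ⁻¹. For k = N + 1 only an almost
-- everywhere bound is left.
lemma AssumptionA.sym_Phi (hN : 1 ≤ N) {k : ℕ} (hk : k ≤ N + 1) :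
    Sym (atBot ⊔ atTop) (dom m V e) (wt f ν) (N + 1 - k) (wPhi m V f ν k) (Phi m V k) := by
  have hJ := hA.eventually_isOpen_dom (m := m) (e := e)
  induction k using Nat.strong_induction_on with
  | _ k ih =>
    cases k with
    | zero =>
      have : wPhi m V f ν 0 = rho m V := by ext; simp [wPhi]
      rw [this]
      exact hA.sym_Phi_zero he he' hN
    | succ k =>
      have hk' : k ≤ N := by omega
      have ho := ih k (by omega) (by omega)
      rw [show N + 1 - k = (N - k) + 1 by omega] at ho
      have hρ := eventually_nearReal (m := m) (V := V) he he'
      have t1 : Sym (atBot ⊔ atTop) (dom m V e) (wt f ν) (N - k)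
          (fun lam x => wt f ν x * wPhi m V f ν k lam x) fun lam x => deriv (Phi m V k lam) x :=
        ho.2.2
      have t2 := ((hA.sym_logK (m := m) he he' hN).of_le (j := N - k) (by omega)).mul hJ ho.pred
      have t3 : Sym (atBot ⊔ atTop) (dom m V e) (wt f ν) (N - k)
          (fun lam x => wt f ν x * wPhi m V f ν k lam x)
          fun lam x => ∑ j : Fin k, Phi m V (j + 1) lam x * Phi m V (k - j) lam x := by
        refine Sym.sum hJ _ fun j _ => ?_
        have hj := j.2
        have a1 := (ih (j + 1) (by omega) (by omega)).of_le (j := N - k) (by omega)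
        have a2 := (ih (k - j) (by omega) (by omega)).of_le (j := N - k) (by omega)
        refine (a1.mul hJ a2).mono (wt_nonneg f ν) zero_le_one ?_
        filter_upwards [hρ] with lam h x hx
        have hr := rho_pos (h x hx)
        refine le_of_eq ?_
        have hp : wt f ν x ^ (j + 1 : ℕ) * wt f ν x ^ (k - j : ℕ) = wt f ν x * wt f ν x ^ k := by
          rw [← pow_add, ← pow_succ']
          congr 1
          omega
        have hp' : (rho m V lam x)⁻¹ ^ (j + 1 : ℕ) * (rho m V lam x)⁻¹ ^ (k - j : ℕ) =
            (rho m V lam x)⁻¹ * (rho m V lam x)⁻¹ ^ k := by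
          rw [← pow_add, ← pow_succ']
          congr 1
          omega
        simp only [wPhi]
        calc _ = (wt f ν x ^ (j + 1 : ℕ) * wt f ν x ^ (k - j : ℕ)) * (rho m V lam x *
              rho m V lam x *
              ((rho m V lam x)⁻¹ ^ (j + 1 : ℕ) * (rho m V lam x)⁻¹ ^ (k - j : ℕ))) := by ring
          _ = _ := by
            rw [hp, hp']
            field_simp
      have t4 := ((((hA.sym_inv_Phi_zero (m := m) he he' hN).of_le (j := N - k) (by omega)).mul hJ
        ((t1.add hJ t2).sub hJ t3)).const_mul hJ (1 / 2)).mono (w' := wPhi m V f ν (k + 1))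
        (wt_nonneg f ν) zero_le_one (by
          refine Eventually.of_forall fun lam x _ => le_of_eq ?_
          simp only [wPhi, pow_succ]
          ring)
      rw [show N + 1 - (k + 1) = N - k by omega]
      refine t4.congr hJ ?_
      filter_upwards [hρ, eventually_ne_zero] with lam h hl
      have key (x : ℝ) (hx : x ∈ dom m V e lam) := (hA.Phi_succ hN hl (h x hx).right_ne k).symm
      exact ⟨ae_of_all _ key, fun _ => key⟩

end

end DiracWKB

end

noncomputable section

namespace DiracWKB

/-! ### The phase and the remainder of the WKB expansion -/

lemma sum_antidiagonal_succ_mul (a : ℕ → ℂ) (k : ℕ) :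
    ∑ p ∈ Finset.HasAntidiagonal.antidiagonal (k + 1), a p.1 * a p.2 =
      2 * a 0 * a (k + 1) + ∑ j : Fin k, a (j + 1) * a (k - j) := by
  rw [Finset.Nat.sum_antidiagonal_eq_sum_range_succ (fun i j => a i * a j), Finset.sum_range_succ,
    Finset.sum_range_succ', Finset.sum_range (n := k)]
  have : ∀ j : Fin k, a (j + 1) * a (k + 1 - (j + 1)) = a (j + 1) * a (k - j) := fun j => by
    congr 2; omega
  simp only [this, Nat.sub_zero, Nat.sub_self]
  ring

/-- Truncation of the square of a finite sum. -/
lemma sum_range_sq (a : ℕ → ℂ) {N : ℕ} :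
    (∑ k ∈ Finset.range (N + 1), a k) ^ 2 = a 0 ^ 2
      + ∑ k ∈ Finset.range (N + 1), (2 * a 0 * a (k + 1) + ∑ j : Fin k, a (j + 1) * a (k - j))
      - 2 * a 0 * a (N + 1)
      + ∑ p ∈ (Finset.range (N + 1) ×ˢ Finset.range (N + 1)) with N + 2 ≤ p.1 + p.2,
          a p.1 * a p.2 := by
  classical
  set g : ℕ × ℕ → ℂ := fun p => a p.1 * a p.2
  have h1 : (∑ k ∈ Finset.range (N + 1), a k) ^ 2 =
      ∑ p ∈ Finset.range (N + 1) ×ˢ Finset.range (N + 1), g p := by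
    rw [sq, Finset.sum_mul_sum, Finset.sum_product]
  have h2 : a 0 ^ 2 + ∑ k ∈ Finset.range (N + 1),
      (2 * a 0 * a (k + 1) + ∑ j : Fin k, a (j + 1) * a (k - j)) =
      ∑ n ∈ Finset.range (N + 2), ∑ p ∈ Finset.HasAntidiagonal.antidiagonal n, g p := by
    rw [Finset.sum_range_succ' _ (N + 1)]
    simp only [g, sum_antidiagonal_succ_mul, Finset.Nat.antidiagonal_zero, Finset.sum_singleton]
    ring
  set s := (Finset.range (N + 2) ×ˢ Finset.range (N + 2)).filter fun p => p.1 + p.2 ≤ N + 1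
  have h3 : ∑ n ∈ Finset.range (N + 2), ∑ p ∈ Finset.HasAntidiagonal.antidiagonal n, g p = ∑ p ∈ s, g p := by
    rw [← Finset.sum_fiberwise_of_maps_to (s := s) (t := Finset.range (N + 2))
      (g := fun p => p.1 + p.2)]
    · refine Finset.sum_congr rfl fun n hn => Finset.sum_congr ?_ fun _ _ => rfl
      ext p
      simp only [Finset.HasAntidiagonal.mem_antidiagonal, s, Finset.mem_filter, Finset.mem_product,
        Finset.mem_range] at hn ⊢
      omega
    · intro p hp
      simp only [s, Finset.mem_filter, Finset.mem_product, Finset.mem_range] at hp ⊢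
      omega
  set t := (Finset.range (N + 1) ×ˢ Finset.range (N + 1)).filter fun p => ¬ N + 2 ≤ p.1 + p.2
  -- Among the pairs with i + j ≤ N + 1, only (0, N + 1) and (N + 1, 0) have an index above N; they
  -- give the term 2 a₀ a_{N+1} that the square does not contain.
  have h4 : s = insert (0, N + 1) (insert (N + 1, 0) t) := by
    ext ⟨i, j⟩
    simp only [s, t, Finset.mem_filter, Finset.mem_product, Finset.mem_range, Finset.mem_insert,
      Prod.mk.injEq]
    omega
  have h5 : ∑ p ∈ s, g p = 2 * a 0 * a (N + 1) + ∑ p ∈ t, g p := by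
    rw [h4, Finset.sum_insert, Finset.sum_insert]
    · simp only [g]; ring
    · simp [t]
    · simp [t]
  rw [h1, h2, h3, h5, ← Finset.sum_filter_add_sum_filter_not _ fun p => N + 2 ≤ p.1 + p.2]
  ring

/-- The derivative of the phase. -/
def dPhase (m : ℝ) (V : ℝ → Matrix (Fin 2) (Fin 2) ℂ) (N : ℕ) (lam x : ℝ) : ℂ :=
  ∑ k ∈ Finset.range (N + 1), Phi m V k lam x

/-- The WKB remainder `P'² - P'' - (K'/K) P' + V_λ`. -/
def remainder (m : ℝ) (V : ℝ → Matrix (Fin 2) (Fin 2) ℂ) (N : ℕ) (lam x : ℝ) : ℂ :=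
  dPhase m V N lam x ^ 2 - deriv (dPhase m V N lam) x - logK m V lam x * dPhase m V N lam x
    + Vlam m V lam x

section

variable {m : ℝ} {V : ℝ → Matrix (Fin 2) (Fin 2) ℂ} {N : ℕ} {f : ℝ → ℝ} {μ ε ν : Side → ℝ}
  {e ε₁ η : ℝ}

lemma zero_mem_dom {lam x : ℝ} (hx : x ∈ dom m V e lam) : (0 : ℝ) ∈ dom m V e lam := by
  have h : (dom m V e lam).Nonempty := ⟨x, hx⟩
  exact mem_connectedComponentIn (connectedComponentIn_nonempty_iff.1 h)

lemma uIcc_subset_dom {lam x : ℝ} (hx : x ∈ dom m V e lam) : Set.uIcc 0 x ⊆ dom m V e lam :=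
  ordConnected_dom.uIcc_subset (zero_mem_dom hx) hx

variable (hA : AssumptionA V N f μ ε ν) (he : 0 < e) (he' : e ≤ 1 / 10)

include hA he he' in
lemma AssumptionA.eventually_lipAt_Phi (hN : 1 ≤ N) : ∀ᶠ lam in atBot ⊔ atTop,
    ∀ k ∈ Finset.range (N + 1), ∀ x ∈ dom m V e lam, LipAt (Phi m V k lam) x := by
  rw [eventually_all_finset]
  intro k hk
  rw [Finset.mem_range] at hk
  exact (hA.sym_Phi (m := m) he he' hN (k := k) (by omega)).lipAt (by omega)

lemma lipAt_sum {ι : Type*} (s : Finset ι) {u : ι → ℝ → ℂ} {x : ℝ}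
    (h : ∀ i ∈ s, LipAt (u i) x) : LipAt (fun y => ∑ i ∈ s, u i y) x := by
  classical
  induction s using Finset.induction_on with
  | empty => simpa using lipAt_const 0 x
  | insert i s hi ih =>
    simp only [Finset.sum_insert hi]
    exact (h i (by simp)).add (ih fun j hj => h j (by simp [hj]))

include hA he he' in
lemma AssumptionA.eventually_lipAt_dPhase (hN : 1 ≤ N) : ∀ᶠ lam in atBot ⊔ atTop,
    ∀ x ∈ dom m V e lam, LipAt (dPhase m V N lam) x := by
  filter_upwards [hA.eventually_lipAt_Phi (m := m) he he' hN] with lam h x hx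
  exact lipAt_sum _ fun k hk => h k hk x hx

include hA he he' in
/-- The phase is a primitive of `dPhase` on the domain. -/
lemma AssumptionA.eventually_phase_eq (hN : 1 ≤ N) : ∀ᶠ lam in atBot ⊔ atTop,
    ∀ x ∈ dom m V e lam, phase m V N lam x = ∫ t in (0 : ℝ)..x, dPhase m V N lam t := by
  filter_upwards [hA.eventually_lipAt_Phi (m := m) he he' hN] with lam h x hx
  have hsub := uIcc_subset_dom hx
  simp only [dPhase]
  rw [intervalIntegral.integral_finsetSum]
  · refine Finset.sum_congr rfl fun k _ => ?_
    rw [← intervalIntegral.integral_const_mul]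
    rfl
  · intro k hk
    refine ContinuousOn.intervalIntegrable fun y hy => ?_
    exact (h k hk y (hsub hy)).continuousAt.continuousWithinAt

include hA he he' in
lemma AssumptionA.eventually_hasDerivAt_phase (hN : 1 ≤ N) : ∀ᶠ lam in atBot ⊔ atTop,
    ∀ x ∈ dom m V e lam, HasDerivAt (phase m V N lam) (dPhase m V N lam x) x := by
  filter_upwards [hA.eventually_lipAt_dPhase (m := m) he he' hN,
    hA.eventually_phase_eq (m := m) he he' hN] with lam h1 h2 x hx
  have hc : ContinuousOn (dPhase m V N lam) (dom m V e lam) := fun y hy =>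
    (h1 y hy).continuousAt.continuousWithinAt
  have hd := intervalIntegral.integral_hasDerivAt_right
    ((hc.mono (uIcc_subset_dom hx)).intervalIntegrable)
    (hc.stronglyMeasurableAtFilter hA.isOpen_dom x hx) (h1 x hx).continuousAt
  refine hd.congr_of_eventuallyEq ?_
  exact eventually_of_mem (hA.isOpen_dom.mem_nhds hx) fun y hy => h2 y hy

include hA he he' in
/-- The eikonal and transport equations cancel all but the high order terms. -/
lemma AssumptionA.eventually_remainder_eq (hN : 1 ≤ N) : ∀ᶠ lam in atBot ⊔ atTop,
    ∀ᵐ x, x ∈ dom m V e lam → remainder m V N lam x =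
      -2 * (Phi m V 0 lam x * Phi m V (N + 1) lam x) +
      ∑ p ∈ (Finset.range (N + 1) ×ˢ Finset.range (N + 1)) with N + 2 ≤ p.1 + p.2,
          Phi m V p.1 lam x * Phi m V p.2 lam x := by
  filter_upwards [hA.eventually_lipAt_Phi (m := m) he he' hN, eventually_ne_zero,
    eventually_nearReal (m := m) (V := V) he he', eventually_rho_le_Phi_zero (m := m) (V := V) he he']
    with lam h1 hl h2 h3
  have hdiff : ∀ᵐ x, ∀ k ∈ Finset.range (N + 1), x ∈ dom m V e lam →
      DifferentiableAt ℝ (Phi m V k lam) x := by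
    rw [eventually_all_finset]
    exact fun k hk => ae_differentiableAt_of_lipAt (h1 k hk)
  filter_upwards [hdiff] with x hx hJ
  have hz := (h2 x hJ).right_ne
  have h0 : Phi m V 0 lam x ≠ 0 := by
    obtain ⟨a, b⟩ := h3 x hJ
    exact norm_pos_iff.1 (lt_of_lt_of_le (by positivity) b)
  have hd : deriv (dPhase m V N lam) x = ∑ k ∈ Finset.range (N + 1), deriv (Phi m V k lam) x :=
    deriv_fun_sum fun k hk => hx k hk hJ
  -- The recursion multiplied by 2Φ₀. Its right-hand side is the sum of all products Φ_iΦ_j with i +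
  -- j = k + 1, so that summation over k ≤ N matches P'' + (K'/K) P' with the low orders of P'².
  have hrec (k : ℕ) : deriv (Phi m V k lam) x + logK m V lam x * Phi m V k lam x =
      2 * Phi m V 0 lam x * Phi m V (k + 1) lam x +
        ∑ j : Fin k, Phi m V (j + 1) lam x * Phi m V (k - j) lam x := by
    rw [hA.Phi_succ hN hl hz k]
    field_simp
    ring
  have hsum : deriv (dPhase m V N lam) x + logK m V lam x * dPhase m V N lam x =
      ∑ k ∈ Finset.range (N + 1), (2 * Phi m V 0 lam x * Phi m V (k + 1) lam x +
        ∑ j : Fin k, Phi m V (j + 1) lam x * Phi m V (k - j) lam x) := by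
    rw [hd, dPhase, Finset.mul_sum, ← Finset.sum_add_distrib]
    exact Finset.sum_congr rfl fun k _ => hrec k
  have hsq := sum_range_sq (fun k => Phi m V k lam x) (N := N)
  rw [← hsum, Phi_zero_sq hl] at hsq
  rw [remainder]
  simp only [dPhase] at hsq ⊢
  linear_combination hsq

/-- The sum of the two rates, together with a bound on the weight, on the core. -/
lemma AssumptionA.eventually_wt_pow_le (hA : AssumptionA V N f μ ε ν)
    (hε₁ : ε₁ ∈ Set.Ioo (0 : ℝ) 1) : ∀ᶠ lam in atBot ⊔ atTop,
    ∀ x ∈ core m V f ν ε₁ η lam, wt f ν x ^ 2 ≤ |lam| ^ (1 - ε₁) ∧ wt f ν x ≤ |lam| ∧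
      wt f ν x ^ (N + 1) * |lam|⁻¹ ^ N ≤ rate ν ε₁ N .minus lam + rate ν ε₁ N .plus lam := by
  filter_upwards [hA.wt_sq_le (m := m) (η := η) hε₁, eventually_le_abs 1] with lam h hl x hx
  have hl0 : 0 < |lam| := zero_lt_one.trans_le hl
  have h1 := h x hx
  have h2 : 1 ≤ |lam| ^ (1 - ε₁) := Real.one_le_rpow hl (sub_nonneg.2 hε₁.2.le)
  have h3 : wt f ν x ^ 2 ≤ |lam| ^ (1 - ε₁) := by
    split_ifs at h1
    · exact h1
    · exact h1.trans h2
  have h4 := one_le_wt f ν x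
  refine ⟨h3, ?_, ?_⟩
  · calc wt f ν x ≤ wt f ν x ^ 2 := le_self_pow₀ h4 two_ne_zero
      _ ≤ |lam| ^ (1 - ε₁) := h3
      _ ≤ |lam| ^ (1 : ℝ) := Real.rpow_le_rpow_of_exponent_le hl (by linarith [hε₁.1])
      _ = |lam| := Real.rpow_one _
  · have hr (s : Side) : 0 ≤ rate ν ε₁ N s lam := by unfold rate; split_ifs <;> positivity
    -- For ν_± > 0 the weight is at most |λ|^{(1-ε₁)/2}, and (1 - ε₁)(N + 1)/2 - N = 1 - (1 + ε₁)(N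
    -- + 1)/2; otherwise the weight is 1.
    have key : wt f ν x ^ (N + 1) * |lam|⁻¹ ^ N ≤ rate ν ε₁ N (sideOf x) lam := by
      by_cases hν : 0 < ν (sideOf x)
      · rw [rate, if_neg (not_le.2 hν)]
        have e1 : wt f ν x ≤ |lam| ^ ((1 - ε₁) / 2) := by
          refine (abs_le_of_sq_le_sq' ?_ (by positivity)).2
          rw [← Real.rpow_natCast (|lam| ^ ((1 - ε₁) / 2)), ← Real.rpow_mul hl0.le]
          norm_num
          exact h3
        calc wt f ν x ^ (N + 1) * |lam|⁻¹ ^ N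
            ≤ (|lam| ^ ((1 - ε₁) / 2)) ^ (N + 1) * |lam|⁻¹ ^ N := by
              gcongr
          _ = |lam| ^ (-((1 + ε₁) / 2 * (N + 1)) + 1) := by
              rw [← Real.rpow_natCast (|lam| ^ ((1 - ε₁) / 2)), ← Real.rpow_mul hl0.le, inv_pow,
                ← Real.rpow_natCast |lam| N, ← Real.rpow_neg hl0.le, ← Real.rpow_add hl0]
              congr 1
              push_cast
              ring
      · rw [rate, if_pos (not_lt.1 hν), wt, if_neg hν, one_pow, one_mul, inv_pow,
          Real.rpow_neg hl0.le, Real.rpow_natCast]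
    cases hs : sideOf x <;> rw [hs] at key
    · linarith [hr .plus]
    · linarith [hr .minus]

include hA he he' in
lemma AssumptionA.Phi_aeBound (hN : 1 ≤ N) : ∃ C : ℝ, 0 ≤ C ∧ ∀ᶠ lam in atBot ⊔ atTop, ∀ᵐ x,
    x ∈ dom m V e lam → ∀ k ∈ Finset.range (N + 2), ‖Phi m V k lam x‖ ≤ C * wPhi m V f ν k lam x := by
  have h (k : ℕ) : ∃ C : ℝ, 0 ≤ C ∧ (k ∈ Finset.range (N + 2) → ∀ᶠ lam in atBot ⊔ atTop, ∀ᵐ x,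
      x ∈ dom m V e lam → ‖Phi m V k lam x‖ ≤ C * wPhi m V f ν k lam x) := by
    by_cases hk : k ∈ Finset.range (N + 2)
    · obtain ⟨C, hC, h⟩ := (hA.sym_Phi (m := m) he he' hN (k := k)
        (by rw [Finset.mem_range] at hk; omega)).aeBound
      exact ⟨C, hC, fun _ => h⟩
    · exact ⟨0, le_rfl, fun h => absurd h hk⟩
  choose C hC h using h
  refine ⟨∑ k ∈ Finset.range (N + 2), C k, Finset.sum_nonneg fun k _ => hC k, ?_⟩
  have h' : ∀ᶠ lam in atBot ⊔ atTop, ∀ k ∈ Finset.range (N + 2), ∀ᵐ x,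
      x ∈ dom m V e lam → ‖Phi m V k lam x‖ ≤ C k * wPhi m V f ν k lam x := by
    rw [eventually_all_finset]
    exact fun k hk => h k hk
  filter_upwards [h'] with lam hl
  have hl' : ∀ᵐ x, ∀ k ∈ Finset.range (N + 2),
      x ∈ dom m V e lam → ‖Phi m V k lam x‖ ≤ C k * wPhi m V f ν k lam x := by
    rw [eventually_all_finset]
    exact hl
  filter_upwards [hl'] with x hx hJ k hk
  refine (hx k hk hJ).trans (mul_le_mul_of_nonneg_right
    (Finset.single_le_sum (fun k _ => hC k) hk) ?_)
  have := wt_nonneg f ν x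
  unfold wPhi rho
  positivity

/-- On the core, `wPhi` is bounded by powers of `wt / |λ|`. -/
lemma wPhi_le {lam x : ℝ} {z : ℂ} (h : NearReal e lam z (zTwo m V lam x))
    (hw : wt f ν x ≤ |lam|) (k : ℕ) :
    wPhi m V f ν k lam x ≤ 2 ^ k * rho m V lam x * (wt f ν x * |lam|⁻¹) ^ k ∧
      wt f ν x * |lam|⁻¹ ≤ 1 := by
  have hl : 0 < |lam| := abs_pos.2 h.ne
  have hr := rho_pos h
  have h1 : (rho m V lam x)⁻¹ ≤ 2 * |lam|⁻¹ := by
    rw [inv_le_comm₀ hr (by positivity), mul_inv, inv_inv]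
    have := h.norm_right'
    unfold rho
    linarith
  have hw0 := wt_nonneg f ν x
  constructor
  · calc wPhi m V f ν k lam x ≤ wt f ν x ^ k * (rho m V lam x * (2 * |lam|⁻¹) ^ k) := by
          unfold wPhi
          gcongr
      _ = _ := by rw [mul_pow, mul_pow]; ring
  · rw [← div_eq_mul_inv]
    exact div_le_one_of_le₀ hw hl.le

/-- The product is w^{a+b} ρ^{2-a-b}. One factor ρ is kept, to be cancelled by the denominator λ + m
- V₂₂ of the residual; the others are traded for |λ| through ρ⁻¹ ≤ 2|λ|⁻¹, and the surplus powers of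
w/|λ| ≤ 1 are dropped. -/
lemma wPhi_mul_le {lam x : ℝ} {z : ℂ} (h : NearReal e lam z (zTwo m V lam x))
    (hw : wt f ν x ≤ |lam|) {a b : ℕ} (hab : N + 1 ≤ a + b) :
    wPhi m V f ν a lam x * wPhi m V f ν b lam x ≤
      2 ^ (a + b) * rho m V lam x * (wt f ν x ^ (N + 1) * |lam|⁻¹ ^ N) := by
  have hl : 0 < |lam| := abs_pos.2 h.ne
  have hr := rho_pos h
  have hw0 := wt_nonneg f ν x
  obtain ⟨n, hn⟩ := Nat.exists_eq_add_of_le hab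
  have h1 : (rho m V lam x)⁻¹ ≤ 2 * |lam|⁻¹ := by
    rw [inv_le_comm₀ hr (by positivity), mul_inv, inv_inv]
    have := h.norm_right'
    unfold rho
    linarith
  have h2 := (wPhi_le (f := f) (ν := ν) h hw 0).2
  calc wPhi m V f ν a lam x * wPhi m V f ν b lam x
      = rho m V lam x * (wt f ν x ^ (a + b) *
          (rho m V lam x * (rho m V lam x)⁻¹ ^ (a + b))) := by
        unfold wPhi
        rw [pow_add, pow_add]
        ring
    _ = rho m V lam x * (wt f ν x ^ (N + 1 + n) * (rho m V lam x)⁻¹ ^ (N + n)) := by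
        rw [hn, show N + 1 + n = (N + n) + 1 by ring, pow_succ (rho m V lam x)⁻¹]
        field_simp
    _ ≤ rho m V lam x * (wt f ν x ^ (N + 1 + n) * (2 * |lam|⁻¹) ^ (N + n)) := by gcongr
    _ = 2 ^ (N + n) * rho m V lam x * (wt f ν x ^ (N + 1) * |lam|⁻¹ ^ N) *
          (wt f ν x * |lam|⁻¹) ^ n := by
        rw [mul_pow, mul_pow, pow_add, pow_add |lam|⁻¹]
        ring
    _ ≤ 2 ^ (N + n) * rho m V lam x * (wt f ν x ^ (N + 1) * |lam|⁻¹ ^ N) * 1 := by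
        gcongr
        exact pow_le_one₀ (by positivity) h2
    _ ≤ _ := by
        rw [mul_one]
        have : (2 : ℝ) ^ (N + n) ≤ 2 ^ (a + b) := pow_le_pow_right₀ one_le_two (by omega)
        gcongr

include hA he he' in
/-- The size of the remainder. -/
lemma AssumptionA.remainder_bound (hN : 1 ≤ N) (hε₁ : ε₁ ∈ Set.Ioo (0 : ℝ) 1) :
    ∃ C : ℝ, 0 ≤ C ∧ ∀ᶠ lam in atBot ⊔ atTop, ∀ᵐ x, x ∈ dom m V e lam →
      x ∈ core m V f ν ε₁ η lam → ‖remainder m V N lam x‖ ≤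
        C * (rate ν ε₁ N .minus lam + rate ν ε₁ N .plus lam) * rho m V lam x := by
  obtain ⟨C, hC, h⟩ := hA.Phi_aeBound (m := m) he he' hN
  set S := (Finset.range (N + 1) ×ˢ Finset.range (N + 1)).filter fun p => N + 2 ≤ p.1 + p.2
  refine ⟨2 * (C ^ 2 * 2 ^ (N + 1)) + ∑ p ∈ S, C ^ 2 * 2 ^ (p.1 + p.2), by positivity, ?_⟩
  filter_upwards [h, hA.eventually_remainder_eq (m := m) he he' hN,
    hA.eventually_wt_pow_le (m := m) (η := η) hε₁, eventually_nearReal (m := m) (V := V) he he']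
    with lam h1 h2 h3 h4
  filter_upwards [h1, h2] with x hx1 hx2 hJ hc
  obtain ⟨-, hw, hrate⟩ := h3 x hc
  have hr := rho_pos (h4 x hJ)
  set r := rate ν ε₁ N .minus lam + rate ν ε₁ N .plus lam
  have key (a b : ℕ) (ha : a < N + 2) (hb : b < N + 2) (hab : N + 1 ≤ a + b) :
      ‖Phi m V a lam x * Phi m V b lam x‖ ≤ C ^ 2 * 2 ^ (a + b) * (r * rho m V lam x) := by
    have b1 := hx1 hJ a (Finset.mem_range.2 ha)
    have b2 := hx1 hJ b (Finset.mem_range.2 hb)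
    rw [norm_mul]
    calc _ ≤ (C * wPhi m V f ν a lam x) * (C * wPhi m V f ν b lam x) :=
          mul_le_mul b1 b2 (norm_nonneg _) ((norm_nonneg _).trans b1)
      _ = C ^ 2 * (wPhi m V f ν a lam x * wPhi m V f ν b lam x) := by ring
      _ ≤ C ^ 2 * (2 ^ (a + b) * rho m V lam x * (wt f ν x ^ (N + 1) * |lam|⁻¹ ^ N)) := by
          exact mul_le_mul_of_nonneg_left (wPhi_mul_le (h4 x hJ) hw hab) (sq_nonneg C)
      _ ≤ C ^ 2 * (2 ^ (a + b) * rho m V lam x * r) := by gcongr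
      _ = _ := by ring
  rw [hx2 hJ]
  refine (norm_add_le _ _).trans ?_
  rw [mul_assoc, add_mul]
  refine add_le_add ?_ ((norm_sum_le _ _).trans ?_)
  · rw [norm_mul, norm_neg, mul_assoc]
    have := key 0 (N + 1) (by omega) (by omega) (by omega)
    rw [zero_add] at this
    simpa using this
  · rw [Finset.sum_mul]
    refine Finset.sum_le_sum fun p hp => ?_
    simp only [Finset.mem_filter, Finset.mem_product, Finset.mem_range] at hp
    exact key p.1 p.2 (by omega) (by omega) (by omega)

end

end DiracWKB

end

noncomputable section

namespace DiracWKB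

/-! ### The function `F` -/

/-- An integral whose integrand is bounded on `|t| ≤ a` and has a sign for `|t| > a`. -/
lemma intervalIntegral_le_of_side {s : Side} {x a B : ℝ} (hx : 0 ≤ s.sgn * x) (ha : 0 ≤ a)
    (hB : 0 ≤ B) {φ : ℝ → ℝ} (hφ : IntervalIntegrable φ volume 0 x)
    (h1 : ∀ᵐ t, t ∈ Set.uIcc 0 x → |t| ≤ a → s.sgn * φ t ≤ B)
    (h2 : ∀ᵐ t, t ∈ Set.uIcc 0 x → a < |t| → s.sgn * φ t ≤ 0) :
    ∫ t in (0 : ℝ)..x, φ t ≤ B * a := by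
  have hsplit : ∫ t in (0 : ℝ)..x, φ t = ∫ t in (0 : ℝ)..(s.sgn * x), s.sgn * φ (s.sgn * t) := by
    cases s
    · simp only [Side.sgn, neg_mul, one_mul, intervalIntegral.integral_neg]
      rw [intervalIntegral.integral_comp_neg, neg_neg, neg_zero, ← intervalIntegral.integral_symm]
    · simp [Side.sgn]
  have hint : IntervalIntegrable (fun t => s.sgn * φ (s.sgn * t)) volume 0 (s.sgn * x) := by
    have := (hφ.comp_mul_left (c := s.sgn)).const_mul s.sgn
    cases s
    · simpa [Side.sgn, div_neg] using this
    · simpa [Side.sgn] using this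
  have hae {p : ℝ → Prop} (hp : ∀ᵐ t, p t) : ∀ᵐ t, p (s.sgn * t) := by
    cases s
    · simpa [Side.sgn] using (quasiMeasurePreserving_neg (volume : Measure ℝ)).ae hp
    · simpa [Side.sgn] using hp
  have hmem {t : ℝ} (ht : t ∈ Set.Icc 0 (s.sgn * x)) : s.sgn * t ∈ Set.uIcc 0 x := by
    cases s
    · simp only [Side.sgn, neg_mul, one_mul, Set.mem_Icc] at ht ⊢
      rw [Set.mem_uIcc]
      right
      constructor <;> linarith
    · simp only [Side.sgn, one_mul, Set.mem_Icc] at ht ⊢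
      rw [Set.mem_uIcc]
      exact Or.inl ht
  set y := s.sgn * x
  set ψ : ℝ → ℝ := fun t => s.sgn * φ (s.sgn * t)
  have k1 : ∀ᵐ t, t ∈ Set.Icc 0 y → t ≤ a → ψ t ≤ B := by
    filter_upwards [hae h1] with t ht hty hta
    refine ht (hmem hty) ?_
    rw [abs_mul, s.abs_sgn, one_mul, abs_of_nonneg hty.1]
    exact hta
  have k2 : ∀ᵐ t, t ∈ Set.Icc 0 y → a < t → ψ t ≤ 0 := by
    filter_upwards [hae h2] with t ht hty hta
    refine ht (hmem hty) ?_
    rw [abs_mul, s.abs_sgn, one_mul, abs_of_nonneg hty.1]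
    exact hta
  rw [hsplit]
  have hm0 : 0 ≤ min y a := le_min hx ha
  have i1 : IntervalIntegrable ψ volume 0 (min y a) := hint.mono_set (by
    rw [Set.uIcc_of_le hm0, Set.uIcc_of_le hx]
    exact Set.Icc_subset_Icc_right (min_le_left _ _))
  have i2 : IntervalIntegrable ψ volume (min y a) y := hint.mono_set (by
    rw [Set.uIcc_of_le (min_le_left _ _), Set.uIcc_of_le hx]
    exact Set.Icc_subset_Icc_left hm0)
  rw [← intervalIntegral.integral_add_adjacent_intervals i1 i2]
  have b1 : ∫ t in (0 : ℝ)..(min y a), ψ t ≤ ∫ _ in (0 : ℝ)..(min y a), B := by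
    refine intervalIntegral.integral_mono_ae_restrict hm0 i1 intervalIntegrable_const ?_
    refine (ae_restrict_iff' measurableSet_Icc).2 ?_
    filter_upwards [k1] with t ht hty
    exact ht ⟨hty.1, hty.2.trans (min_le_left _ _)⟩ (hty.2.trans (min_le_right _ _))
  have b2 : ∫ t in (min y a)..y, ψ t ≤ ∫ _ in (min y a)..y, (0 : ℝ) := by
    rcases le_or_gt y a with hya | hya
    · simp [min_eq_left hya]
    refine intervalIntegral.integral_mono_ae_restrict (min_le_left _ _) i2
      intervalIntegrable_const ?_
    refine (ae_restrict_iff' measurableSet_Icc).2 ?_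
    -- The sign is known only for t > a, so the endpoint is removed as a null set.
    have hne : ∀ᵐ t : ℝ, t ≠ a := by simp [ae_iff, measure_singleton]
    filter_upwards [k2, hne] with t ht htne hty
    rw [min_eq_right hya.le] at hty
    exact ht ⟨ha.trans hty.1, hty.2⟩ (lt_of_le_of_ne hty.1 htne.symm)
  simp only [intervalIntegral.integral_const, smul_eq_mul, sub_zero, mul_zero] at b1 b2
  have : min y a * B ≤ a * B := mul_le_mul_of_nonneg_right (min_le_right _ _) hB
  linarith

section

variable {m : ℝ} {V : ℝ → Matrix (Fin 2) (Fin 2) ℂ} {N : ℕ} {f : ℝ → ℝ} {μ ε ν : Side → ℝ}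

lemma AssumptionA.continuous_imDiag (hA : AssumptionA V N f μ ε ν) : Continuous (imDiag V) :=
  (continuous_im.comp (hA.diag_continuous 0)).add (continuous_im.comp (hA.diag_continuous 1))

lemma AssumptionA.hasDerivAt_bigF (hA : AssumptionA V N f μ ε ν) (x : ℝ) :
    HasDerivAt (bigF V) (imDiag V x) x :=
  intervalIntegral.integral_hasDerivAt_right (hA.continuous_imDiag.intervalIntegrable _ _)
    hA.continuous_imDiag.stronglyMeasurable.stronglyMeasurableAtFilter
    hA.continuous_imDiag.continuousAt

lemma AssumptionA.exists_imDiag_lower (hA : AssumptionA V N f μ ε ν) :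
    ∃ c > 0, ∃ a > 0, ∀ (s : Side) (x : ℝ), a ≤ s.sgn * x → c ≤ s.sgn * imDiag V x := by
  obtain ⟨c1, h1, h1'⟩ := EReal.lt_iff_exists_real_btwn.1 hA.limsup_neg
  obtain ⟨c2, h2, h2'⟩ := EReal.lt_iff_exists_real_btwn.1 hA.liminf_pos
  obtain ⟨a1, ha1⟩ := eventually_atBot.1 (eventually_lt_of_limsup_lt h1)
  obtain ⟨a2, ha2⟩ := eventually_atTop.1 (eventually_lt_of_lt_liminf h2')
  rw [EReal.coe_neg'] at h1'
  rw [EReal.coe_pos] at h2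
  refine ⟨min (-c1) c2, lt_min (by linarith) h2, max 1 (max (-a1) a2), by positivity,
    fun s x hx => ?_⟩
  have hm := (le_max_right 1 (max (-a1) a2)).trans hx
  cases s
  · simp only [Side.sgn, neg_mul, one_mul] at hm ⊢
    have := EReal.coe_lt_coe_iff.1 (ha1 x (by linarith [(le_max_left (-a1) a2).trans hm]))
    linarith [min_le_left (-c1) c2]
  · simp only [Side.sgn, one_mul] at hm ⊢
    have := EReal.coe_lt_coe_iff.1 (ha2 x ((le_max_right (-a1) a2).trans hm))
    linarith [min_le_right (-c1) c2]

/-- Linear growth of `F`. -/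
lemma AssumptionA.exists_bigF_lower (hA : AssumptionA V N f μ ε ν) :
    ∃ c > 0, ∃ C, 0 ≤ C ∧ ∀ x, c * |x| ≤ bigF V x + C := by
  obtain ⟨c, hc, a, ha, h⟩ := hA.exists_imDiag_lower
  obtain ⟨D, hD⟩ := (isCompact_Icc (a := -a) (b := a)).exists_bound_of_continuousOn
    hA.continuous_imDiag.continuousOn
  have hD0 : 0 ≤ D := (norm_nonneg _).trans (hD 0 ⟨by linarith, ha.le⟩)
  refine ⟨c, hc, (c + D) * a, by positivity, fun x => ?_⟩
  obtain ⟨s, hs⟩ := exists_side x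
  have key := intervalIntegral_le_of_side (φ := fun t => c * s.sgn - imDiag V t) hs ha.le
    (B := c + D) (by positivity)
    ((continuous_const.sub hA.continuous_imDiag).intervalIntegrable _ _)
    (ae_of_all _ fun t _ ht => ?_) (ae_of_all _ fun t ht hta => ?_)
  · rw [intervalIntegral.integral_sub (by simp) (hA.continuous_imDiag.intervalIntegrable _ _)]
      at key
    simp only [intervalIntegral.integral_const, sub_zero, smul_eq_mul] at key
    rw [Side.abs_eq hs]
    change _ - bigF V x ≤ _ at key
    linarith [mul_left_comm x c s.sgn, mul_comm x s.sgn]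
  · have := (abs_le.1 (hD t (abs_le.1 ht))).1
    have h2 := (abs_le.1 (hD t (abs_le.1 ht))).2
    cases s <;> simp only [Side.sgn] <;> linarith
  · have h0 : 0 ≤ s.sgn * t := by
      cases s
      · simp only [Side.sgn, neg_mul, one_mul] at hs ⊢
        rw [Set.uIcc_of_ge (by linarith)] at ht
        linarith [ht.2]
      · simp only [Side.sgn, one_mul] at hs ⊢
        rw [Set.uIcc_of_le hs] at ht
        exact ht.1
    rw [Side.abs_eq h0] at hta
    have := h s t hta.le
    have h1 := s.sgn_mul_self
    nlinarith

/-- `F` is monotone near the ends. -/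
lemma AssumptionA.exists_bigF_mono (hA : AssumptionA V N f μ ε ν) :
    ∃ a > 0, ∀ (s : Side) (x y : ℝ), a ≤ x → x ≤ y → bigF V (s.sgn * x) ≤ bigF V (s.sgn * y) := by
  obtain ⟨c, hc, a, ha, h⟩ := hA.exists_imDiag_lower
  refine ⟨a, ha, fun s x y hx hxy => ?_⟩
  have hd (t : ℝ) : HasDerivAt (fun t => bigF V (s.sgn * t)) (imDiag V (s.sgn * t) * s.sgn) t := by
    have := (hA.hasDerivAt_bigF (s.sgn * t)).comp t ((hasDerivAt_id t).const_mul s.sgn)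
    simpa [Function.comp_def] using this
  refine monotoneOn_of_deriv_nonneg (convex_Ici a) (fun t _ => (hd t).continuousAt.continuousWithinAt)
    (fun t _ => (hd t).differentiableAt.differentiableWithinAt) (fun t ht => ?_)
    (Set.mem_Ici.2 hx) (Set.mem_Ici.2 (hx.trans hxy)) hxy
  rw [(hd t).deriv, mul_comm]
  rw [interior_Ici, Set.mem_Ioi] at ht
  exact hc.le.trans (h s _ (by rw [s.sgn_mul_sgn_mul]; exact ht.le))

/-- The integral of `Im V₁₂ + Im V₂₁` is dominated by `F`. -/
lemma AssumptionA.exists_off_bound (hA : AssumptionA V N f μ ε ν) (hN : 1 ≤ N) (s : Side) :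
    ∃ C, 0 ≤ C ∧ ∀ x, 0 ≤ s.sgn * x →
      ∫ t in (0 : ℝ)..x, ((V t 0 1).im + (V t 1 0).im) ≤ 2 * ε s * bigF V x + C := by
  obtain ⟨a, ha, h⟩ := hA.off_control s
  have hc : Continuous fun t => (V t 0 1).im + (V t 1 0).im :=
    (continuous_im.comp (hA.off_continuous hN 0 1 (by simp))).add
      (continuous_im.comp (hA.off_continuous hN 1 0 (by simp)))
  have hF : Continuous (bigF V) :=
    continuous_iff_continuousAt.2 fun x => (hA.hasDerivAt_bigF x).continuousAt
  have hG : Continuous fun x =>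
      (∫ t in (0 : ℝ)..x, ((V t 0 1).im + (V t 1 0).im)) - 2 * ε s * bigF V x :=
    (intervalIntegral.continuous_primitive (fun _ _ => hc.intervalIntegrable _ _) 0).sub
      (continuous_const.mul hF)
  obtain ⟨D, hD⟩ := (isCompact_Icc (a := -a) (b := a)).exists_bound_of_continuousOn
    hG.continuousOn
  have hD0 : 0 ≤ D := (norm_nonneg _).trans (hD 0 ⟨by linarith, ha.le⟩)
  refine ⟨D, hD0, fun x hx => ?_⟩
  rcases le_total a (s.sgn * x) with hxa | hxa
  · linarith [h x hxa]
  · rw [← Side.abs_eq hx] at hxa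
    linarith [(abs_le.1 (hD x (abs_le.1 hxa))).2]

end

end DiracWKB

end

noncomputable section

namespace DiracWKB

/-! ### The size of the WKB exponential -/

lemma Side.mul_mem_of_mem_uIcc {s : Side} {x t : ℝ} (hx : 0 ≤ s.sgn * x)
    (ht : t ∈ Set.uIcc 0 x) : 0 ≤ s.sgn * t := by
  cases s
  · simp only [Side.sgn, neg_mul, one_mul] at hx ⊢
    rw [Set.uIcc_of_ge (by linarith)] at ht
    linarith [ht.2]
  · simp only [Side.sgn, one_mul] at hx ⊢
    rw [Set.uIcc_of_le hx] at ht
    exact ht.1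

lemma hasDerivAt_log_norm {z : ℝ → ℂ} {z' : ℂ} {x : ℝ} (h : HasDerivAt z z' x) (h0 : z x ≠ 0) :
    HasDerivAt (fun y => Real.log ‖z y‖) (z' / z x).re x := by
  have h1 : HasDerivAt (fun y => (z y).re) z'.re x :=
    reCLM.hasFDerivAt.comp_hasDerivAt x h
  have h2 : HasDerivAt (fun y => (z y).im) z'.im x :=
    imCLM.hasFDerivAt.comp_hasDerivAt x h
  have h3 := (((h1.pow 2).add (h2.pow 2)).log (by
    have := normSq_pos.2 h0
    rw [normSq_apply] at this
    simp only [Pi.add_apply, Pi.pow_apply]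
    nlinarith)).const_mul (1 / 2)
  have hfun : (fun y => Real.log ‖z y‖) = fun y =>
      1 / 2 * Real.log (((fun y => (z y).re) ^ 2 + (fun y => (z y).im) ^ 2) y) := by
    funext y
    rw [Complex.norm_def, Real.log_sqrt (normSq_nonneg _), normSq_apply]
    simp only [Pi.add_apply, Pi.pow_apply, ← pow_two]
    ring
  rw [hfun]
  refine h3.congr_deriv ?_
  rw [div_re, normSq_apply]
  simp only [Pi.add_apply, Pi.pow_apply, ← pow_two]
  push_cast
  ring

/-- This keeps the boundary terms that the integration of Φ₁ produces in log |k₁ e^{-P}| bounded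
uniformly in λ and x. -/
lemma NearReal.abs_log_sub_le {e l : ℝ} {z w : ℂ} (h : NearReal e l z w) :
    |Real.log ‖z‖ - Real.log ‖w‖| ≤ Real.log 2 := by
  have hz := norm_pos_iff.2 h.left_ne
  have hw := norm_pos_iff.2 h.right_ne
  have h1 := Real.log_le_log hz h.norm_le
  have h2 := Real.log_le_log hw h.norm_ge
  rw [Real.log_mul two_ne_zero hw.ne'] at h1
  rw [Real.log_mul two_ne_zero hz.ne'] at h2
  rw [abs_le]
  constructor <;> linarith

section

variable {m : ℝ} {V : ℝ → Matrix (Fin 2) (Fin 2) ℂ} {N : ℕ} {f : ℝ → ℝ} {μ ε ν : Side → ℝ}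
  {e ε₁ η : ℝ}

/-- Two factors w and one ρ⁻¹ give at most 2|λ|^{1-ε₁}|λ|⁻¹ = 2|λ|^{-ε₁}; each further factor w/ρ is
at most 2. This is where ε₁ > 0 makes the terms of index at least 2 small. -/
lemma wPhi_le_rpow {lam x : ℝ} {z : ℂ} (h : NearReal e lam z (zTwo m V lam x))
    (hw : wt f ν x ≤ |lam|) (hw2 : wt f ν x ^ 2 ≤ |lam| ^ (1 - ε₁)) (n : ℕ) :
    wPhi m V f ν (n + 2) lam x ≤ 2 ^ (n + 1) * |lam| ^ (-ε₁) := by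
  have hl : 0 < |lam| := abs_pos.2 h.ne
  have hr := rho_pos h
  have hw0 := wt_nonneg f ν x
  have h1 : (rho m V lam x)⁻¹ ≤ 2 * |lam|⁻¹ := by
    rw [inv_le_comm₀ hr (by positivity), mul_inv, inv_inv]
    have := h.norm_right'
    unfold rho
    linarith
  have h2 := (wPhi_le (f := f) (ν := ν) h hw 0).2
  calc wPhi m V f ν (n + 2) lam x
      = wt f ν x ^ 2 * (rho m V lam x)⁻¹ * (wt f ν x * (rho m V lam x)⁻¹) ^ n := by
        have hri := mul_inv_cancel₀ hr.ne'
        unfold wPhi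
        rw [mul_pow]
        linear_combination (wt f ν x ^ (n + 2) * (rho m V lam x)⁻¹ ^ (n + 1)) * hri
    _ ≤ |lam| ^ (1 - ε₁) * (2 * |lam|⁻¹) * (wt f ν x * (2 * |lam|⁻¹)) ^ n := by gcongr
    _ = 2 ^ (n + 1) * (|lam| ^ (1 - ε₁) * |lam|⁻¹) * (wt f ν x * |lam|⁻¹) ^ n := by
        rw [mul_left_comm (wt f ν x), mul_pow, pow_succ]
        ring
    _ ≤ 2 ^ (n + 1) * (|lam| ^ (1 - ε₁) * |lam|⁻¹) * 1 := by
        gcongr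
        exact pow_le_one₀ (by positivity) h2
    _ = _ := by
        rw [mul_one, ← Real.rpow_neg_one, ← Real.rpow_add hl]
        congr 2
        ring

variable (hA : AssumptionA V N f μ ε ν) (he : 0 < e) (he' : e ≤ 1 / 10)

include hA he he' in
/-- The terms of order at least two in the phase are small. -/
lemma AssumptionA.tail_bound (hN : 1 ≤ N) (hε₁ : ε₁ ∈ Set.Ioo (0 : ℝ) 1) {τ : ℝ} (hτ : 0 < τ) :
    ∀ᶠ lam in atBot ⊔ atTop, ∀ᵐ x, x ∈ dom m V e lam → x ∈ core m V f ν ε₁ η lam →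
      ‖dPhase m V N lam x - Phi m V 1 lam x - Phi m V 0 lam x‖ ≤ τ := by
  obtain ⟨C, hC, h⟩ := hA.Phi_aeBound (m := m) he he' hN
  obtain ⟨k, rfl⟩ := Nat.exists_eq_add_of_le' hN
  set S := ∑ i ∈ Finset.range k, C * 2 ^ (i + 1) with hS
  have hlim : Tendsto (fun lam : ℝ => S * |lam| ^ (-ε₁)) (atBot ⊔ atTop) (𝓝 0) := by
    simpa using ((tendsto_rpow_neg_atTop hε₁.1).comp tendsto_abs_atTop').const_mul S
  filter_upwards [h, hA.eventually_wt_pow_le (m := m) (η := η) hε₁,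
    eventually_nearReal (m := m) (V := V) he he', hlim.eventually (gt_mem_nhds hτ)]
    with lam h1 h2 h3 h4
  filter_upwards [h1] with x hx hJ hc
  obtain ⟨hw2, hw, -⟩ := h2 x hc
  have hsum : dPhase m V (k + 1) lam x - Phi m V 1 lam x - Phi m V 0 lam x =
      ∑ i ∈ Finset.range k, Phi m V (i + 2) lam x := by
    rw [dPhase, Finset.sum_range_succ', Finset.sum_range_succ']
    ring
  rw [hsum]
  refine (norm_sum_le _ _).trans (le_trans ?_ h4.le)
  rw [hS, Finset.sum_mul]
  refine Finset.sum_le_sum fun i hi => ?_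
  rw [Finset.mem_range] at hi
  rw [mul_assoc]
  exact (hx hJ (i + 2) (Finset.mem_range.2 (by omega))).trans
    (mul_le_mul_of_nonneg_left (wPhi_le_rpow (h3 x hJ) hw hw2 i) hC)

/-- The first transport term. -/
lemma AssumptionA.Phi_one (hA : AssumptionA V N f μ ε ν) (hN : 1 ≤ N) {lam x : ℝ}
    (h : NearReal e lam (zOne m V lam x) (zTwo m V lam x)) : Phi m V 1 lam x =
      1 / 4 * (deriv (zOne m V lam) x / zOne m V lam x - deriv (zTwo m V lam) x / zTwo m V lam x)
        - I / 2 * (V x 1 0 - V x 0 1) := by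
  have hq := hasDerivAt_cpow_half (hA.hasDerivAt_Vlam hN lam x)
    (by rw [Vlam_eq]; exact h.mul_mem_slitPlane)
  have hd : deriv (Phi m V 0 lam) x = 1 / 2 * (deriv (zOne m V lam) x * zTwo m V lam x +
      zOne m V lam x * deriv (zTwo m V lam) x) / Vlam m V lam x * Phi m V 0 lam x := by
    rw [show Phi m V 0 lam = fun y => (Real.sign lam : ℂ) * I * Vlam m V lam y ^ (1 / 2 : ℂ) from
      funext fun y => Phi_zero h.ne y, (hq.const_mul _).deriv]
    ring
  have hz := h.left_ne
  have hw := h.right_ne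
  have h0 : Phi m V 0 lam x ≠ 0 := by
    intro h0
    have := Phi_zero_sq (m := m) (V := V) h.ne x
    rw [h0, Vlam_eq] at this
    simp [hz, hw] at this
  rw [hA.Phi_succ hN h.ne hw 0, hd, logK, Vlam_eq]
  simp only [Finset.univ_eq_empty, Finset.sum_empty, sub_zero]
  field_simp
  ring

include hA he he' in
/-- The logarithm of the WKB exponential. -/
lemma AssumptionA.eventually_log_norm (hN : 1 ≤ N) : ∀ᶠ lam in atBot ⊔ atTop,
    ∀ x ∈ dom m V e lam, Real.log ‖k₁ V x * exp (-phase m V N lam x)‖ =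
      1 / 2 * (∫ t in (0 : ℝ)..x, ((V t 0 1).im + (V t 1 0).im))
        - 1 / 4 * (Real.log ‖zOne m V lam x‖ - Real.log ‖zTwo m V lam x‖)
        + 1 / 4 * (Real.log ‖zOne m V lam 0‖ - Real.log ‖zTwo m V lam 0‖)
        - ∫ t in (0 : ℝ)..x, (dPhase m V N lam t - Phi m V 1 lam t).re := by
  filter_upwards [hA.eventually_hasDerivAt_phase (m := m) he he' hN,
    hA.eventually_lipAt_dPhase (m := m) he he' hN, hA.eventually_lipAt_Phi (m := m) he he' hN,
    eventually_nearReal (m := m) (V := V) he he'] with lam h1 h2 h3 h4 x hx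
  have c01 := hA.off_continuous hN 0 1 (by simp)
  have c10 := hA.off_continuous hN 1 0 (by simp)
  have hoff : Continuous fun t => (V t 0 1).im + (V t 1 0).im :=
    (continuous_im.comp c01).add (continuous_im.comp c10)
  -- Re Φ₁ consists of ¼ (log |λ - m - V₁₁| - log |λ + m - V₂₂|)' and ½ Im(V₂₁ - V₁₂). Subtracting
  -- the latter from (log |k₁|)' = Im V₂₁ leaves ½ (Im V₁₂ + Im V₂₁), so D retains only the
  -- contribution of P' - Φ₁.
  set D : ℝ → ℝ := fun y => (-I * ∫ t in (0 : ℝ)..y, V t 1 0).re - (phase m V N lam y).re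
    - 1 / 2 * (∫ t in (0 : ℝ)..y, ((V t 0 1).im + (V t 1 0).im))
    + 1 / 4 * (Real.log ‖zOne m V lam y‖ - Real.log ‖zTwo m V lam y‖) with hD
  have hderiv : ∀ t ∈ Set.uIcc 0 x,
      HasDerivAt D (-(dPhase m V N lam t - Phi m V 1 lam t).re) t := by
    intro t ht
    have htJ := uIcc_subset_dom hx ht
    have hn := h4 t htJ
    have d1 : HasDerivAt (fun y => (-I * ∫ t in (0 : ℝ)..y, V t 1 0).re) (-I * V t 1 0).re t :=
      reCLM.hasFDerivAt.comp_hasDerivAt t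
        ((c10.integral_hasStrictDerivAt 0 t).hasDerivAt.const_mul (-I))
    have d2 : HasDerivAt (fun y => (phase m V N lam y).re) (dPhase m V N lam t).re t :=
      reCLM.hasFDerivAt.comp_hasDerivAt t (h1 t htJ)
    have d3 := (hoff.integral_hasStrictDerivAt 0 t).hasDerivAt.const_mul (1 / 2)
    have d4 := hasDerivAt_log_norm (hA.differentiable_zOne hN lam t).hasDerivAt hn.left_ne
    have d5 := hasDerivAt_log_norm (hA.differentiable_zTwo hN lam t).hasDerivAt hn.right_ne
    refine (((d1.sub d2).sub d3).add ((d4.sub d5).const_mul (1 / 4))).congr_deriv ?_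
    rw [hA.Phi_one hN hn]
    simp only [sub_re, mul_re, neg_re, I_re, I_im, sub_im, neg_im, div_ofNat_re, div_ofNat_im,
      one_re, one_im]
    ring
  have hint : IntervalIntegrable (fun t => -(dPhase m V N lam t - Phi m V 1 lam t).re)
      volume 0 x := by
    refine ContinuousOn.intervalIntegrable fun t ht => ?_
    have htJ := uIcc_subset_dom hx ht
    exact (continuous_re.continuousAt.comp ((h2 t htJ).continuousAt.sub
      (h3 1 (Finset.mem_range.2 (by omega)) t htJ).continuousAt)).neg.continuousWithinAt
  have key := intervalIntegral.integral_eq_sub_of_hasDerivAt hderiv hint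
  rw [intervalIntegral.integral_neg] at key
  have hphase0 : phase m V N lam 0 = 0 := by simp [phase]
  have hlog : Real.log ‖k₁ V x * exp (-phase m V N lam x)‖ =
      (-I * ∫ t in (0 : ℝ)..x, V t 1 0).re - (phase m V N lam x).re := by
    rw [k₁, ← exp_add, norm_exp, Real.log_exp, add_re, neg_re, ← sub_eq_add_neg]
  rw [hlog]
  simp only [hD, hphase0, intervalIntegral.integral_same, mul_zero, zero_re] at key
  linarith

end

end DiracWKB

end

/-! ### Two-sided bounds for the WKB exponential -/

noncomputable section

namespace DiracWKB

section

variable {m : ℝ} {V : ℝ → Matrix (Fin 2) (Fin 2) ℂ} {N : ℕ} {f : ℝ → ℝ} {μ ε ν : Side → ℝ}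
  {e ε₁ η : ℝ}

/-- The constant in the lower bound of `± Re Φ₀`. -/
def phaseGap (e : ℝ) (μ : Side → ℝ) (s : Side) : ℝ := (1 - e / μ s) / (2 * (1 + 2 * e))

lemma AssumptionA.exists_im_bound (hA : AssumptionA V N f μ ε ν) (a : ℝ) :
    ∃ D, 0 ≤ D ∧ ∀ x, |x| ≤ a → |(V x 0 0).im| + |(V x 1 1).im| ≤ D := by
  have hc : Continuous fun x => |(V x 0 0).im| + |(V x 1 1).im| :=
    (continuous_im.comp (hA.diag_continuous 0)).abs.add
      (continuous_im.comp (hA.diag_continuous 1)).abs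
  obtain ⟨D, hD⟩ := (isCompact_Icc (a := -a) (b := a)).exists_bound_of_continuousOn
    hc.continuousOn
  exact ⟨|D|, abs_nonneg _, fun x hx =>
    ((le_abs_self _).trans (hD x (abs_le.1 hx))).trans (le_abs_self D)⟩

lemma zOne_im (lam x : ℝ) : (zOne m V lam x).im = -(V x 0 0).im := by simp [zOne]

lemma zTwo_im (lam x : ℝ) : (zTwo m V lam x).im = -(V x 1 1).im := by simp [zTwo]

variable (hA : AssumptionA V N f μ ε ν) (he : 0 < e) (he' : e ≤ 1 / 10)

include hA he he' in
-- Although Φ₀ itself is of size ρ, its real part is at most |Im V₁₁| + |Im V₂₂|, which on a compact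
-- set does not depend on λ; the terms of index at least 2 add at most 1.
lemma AssumptionA.re_phase_bound (hN : 1 ≤ N) (hε₁ : ε₁ ∈ Set.Ioo (0 : ℝ) 1) (a : ℝ) :
    ∃ B, 0 ≤ B ∧ ∀ᶠ lam in atBot ⊔ atTop, ∀ᵐ x, x ∈ dom m V e lam →
      x ∈ core m V f ν ε₁ η lam → |x| ≤ a →
        |(dPhase m V N lam x - Phi m V 1 lam x).re| ≤ B := by
  obtain ⟨D, hD, h⟩ := hA.exists_im_bound a
  refine ⟨D + 1, by positivity, ?_⟩
  filter_upwards [hA.tail_bound (m := m) (η := η) he he' hN hε₁ one_pos,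
    eventually_nearReal (m := m) (V := V) he he'] with lam h1 h2
  filter_upwards [h1] with x hx hJ hc hxa
  have b1 := (abs_re_le_norm _).trans (hx hJ hc)
  have b2 := (h2 x hJ).abs_sign_re_le
  rw [← Vlam_eq, ← Phi_zero (h2 x hJ).ne, zOne_im, zTwo_im, abs_neg, abs_neg] at b2
  have b3 := abs_add_le (dPhase m V N lam x - Phi m V 1 lam x - Phi m V 0 lam x).re
    (Phi m V 0 lam x).re
  rw [← add_re, sub_add_cancel] at b3
  linarith [h x hxa]

include hA he he' in
-- Condition 1 on the imaginary parts enters through `NearReal.le_sign_re`, with the sign of the end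
-- for σ; the loss τ pays for the terms of index at least 2.
lemma AssumptionA.re_phase_lower (hN : 1 ≤ N) (hε₁ : ε₁ ∈ Set.Ioo (0 : ℝ) 1)
    (heμ : ∀ s, e ≤ μ s) {τ : ℝ} (hτ : 0 < τ) :
    ∃ a > 0, ∀ᶠ lam in atBot ⊔ atTop, ∀ᵐ x, x ∈ dom m V e lam →
      x ∈ core m V f ν ε₁ η lam → ∀ s : Side, a ≤ s.sgn * x →
        phaseGap e μ s * (s.sgn * imDiag V x) - τ ≤
          s.sgn * (dPhase m V N lam x - Phi m V 1 lam x).re := by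
  obtain ⟨c, hc, a, ha, hlow⟩ := hA.exists_imDiag_lower
  choose b hb hsign using hA.diag_sign
  refine ⟨max a (max (b .minus) (b .plus)), by positivity, ?_⟩
  filter_upwards [hA.tail_bound (m := m) (η := η) he he' hN hε₁ hτ,
    eventually_nearReal (m := m) (V := V) he he'] with lam h1 h2
  filter_upwards [h1] with x hx hJ hco s hs
  have hba : b s ≤ s.sgn * x := by
    refine le_trans ?_ ((le_max_right _ _).trans hs)
    cases s
    · exact le_max_left _ _
    · exact le_max_right _ _
  have hpos := hlow s x ((le_max_left _ _).trans hs)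
  have hsg := hsign s x hba
  rw [show (V x 0 0).im + (V x 1 1).im = imDiag V x from rfl, ← one_mul |imDiag V x|, ← s.abs_sgn,
    ← abs_mul, abs_of_pos (hc.trans_le hpos)] at hsg
  have key := (h2 x hJ).le_sign_re s.abs_sgn (hA.μ_mem s).1 (heμ s) (by
    rw [zOne_im, zTwo_im, abs_neg, abs_neg]
    refine hsg.trans (le_of_eq ?_)
    rw [imDiag]
    ring)
  rw [← Vlam_eq, ← Phi_zero (h2 x hJ).ne, zOne_im, zTwo_im] at key
  have b1 := (abs_re_le_norm _).trans (hx hJ hco)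
  rw [← one_mul |_|, ← s.abs_sgn, ← abs_mul] at b1
  have b2 := (abs_le.1 b1).1
  rw [sub_re, mul_sub] at b2
  rw [show -s.sgn * (-(V x 0 0).im + -(V x 1 1).im) = s.sgn * imDiag V x by rw [imDiag]; ring]
    at key
  unfold phaseGap
  linarith

include hA he he' in
/-- Exponential decay of the WKB exponential on the core. -/
lemma AssumptionA.exists_exp_upper (hN : 1 ≤ N) (hε₁ : ε₁ ∈ Set.Ioo (0 : ℝ) 1)
    (heμ : ∀ s, e ≤ μ s) (hgap : ∀ s, ε s < phaseGap e μ s)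
    (hsub : ∀ᶠ lam in atBot ⊔ atTop, core m V f ν ε₁ η lam ⊆ dom m V e lam) :
    ∃ d > 0, ∃ C > 0, ∀ᶠ lam in atBot ⊔ atTop, ∀ x ∈ core m V f ν ε₁ η lam,
      ‖k₁ V x * exp (-phase m V N lam x)‖ ≤ C * Real.exp (-d * bigF V x) := by
  obtain ⟨c₀, hc₀, C₂, hC₂, hF⟩ := hA.exists_bigF_lower
  choose C₁ hC₁ hoff using hA.exists_off_bound hN
  -- The net decay rate: the gain from Re Φ₀ minus the cost ε_± of the off-diagonal entries, at the
  -- worse of the two ends.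
  set d₀ := min (phaseGap e μ .minus - ε .minus) (phaseGap e μ .plus - ε .plus) with hd₀
  have hd₀pos : 0 < d₀ := lt_min (sub_pos.2 (hgap _)) (sub_pos.2 (hgap _))
  have hd₀le (s : Side) : d₀ ≤ phaseGap e μ s - ε s := by
    cases s
    · exact min_le_left _ _
    · exact min_le_right _ _
  -- By the linear growth c₀|x| ≤ F + C₂ the accumulated loss τ|x| is at most a quarter of d₀ (F +
  -- C₂), which leaves more than the rate d₀/2 that is claimed.
  set τ := c₀ * d₀ / 4 with hτ
  have hτpos : 0 < τ := by positivity
  obtain ⟨a, ha, hlow⟩ := hA.re_phase_lower (m := m) (η := η) he he' hN hε₁ heμ hτpos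
  obtain ⟨B, hB, hloc⟩ := hA.re_phase_bound (m := m) (η := η) he he' hN hε₁ a
  obtain ⟨D, hD, him⟩ := hA.exists_im_bound a
  have hgap_nonneg (s : Side) : 0 ≤ phaseGap e μ s := (hA.ε_mem s).1.le.trans (hgap s).le
  have hgap_le (s : Side) : phaseGap e μ s ≤ 1 := by
    unfold phaseGap
    rw [div_le_one (by positivity)]
    have : 0 ≤ e / μ s := div_nonneg he.le (hA.μ_mem s).1.le
    linarith
  refine ⟨d₀ / 2, by positivity, Real.exp ((C₁ .minus + C₁ .plus) + Real.log 2 + (D + B) * a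
    + (1 + d₀) * C₂), Real.exp_pos _, ?_⟩
  filter_upwards [hlow, hloc, hsub, hA.eventually_log_norm (m := m) he he' hN,
    eventually_nearReal (m := m) (V := V) he he',
    hA.eventually_lipAt_dPhase (m := m) he he' hN, hA.eventually_lipAt_Phi (m := m) he he' hN]
    with lam h1 h2 h3 h4 h5 h6 h7 x hx
  obtain ⟨s, hs⟩ := exists_side x
  have hxJ := h3 hx
  have hmem {t : ℝ} (ht : t ∈ Set.uIcc 0 x) : t ∈ core m V f ν ε₁ η lam :=
    ordConnected_core.uIcc_subset zero_mem_core hx ht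
  have hi1 : IntervalIntegrable (fun t => (dPhase m V N lam t - Phi m V 1 lam t).re)
      volume 0 x := by
    refine ContinuousOn.intervalIntegrable fun t ht => ?_
    have htJ := h3 (hmem ht)
    exact (continuous_re.continuousAt.comp ((h6 t htJ).continuousAt.sub
      (h7 1 (Finset.mem_range.2 (by omega)) t htJ).continuousAt)).continuousWithinAt
  have hi2 : IntervalIntegrable (fun t => phaseGap e μ s * imDiag V t) volume 0 x :=
    (continuous_const.mul hA.continuous_imDiag).intervalIntegrable _ _
  have hi3 : IntervalIntegrable (fun _ : ℝ => τ * s.sgn) volume 0 x := intervalIntegrable_const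
  -- The integrand compares Re(P' - Φ₁) with its lower bound. It has the favourable sign beyond a
  -- and is at most D + B before, so the integral of Re(P' - Φ₁) is at least the gap times F, minus
  -- τ|x| and a constant.
  have key := intervalIntegral_le_of_side hs ha.le (B := D + B) (by positivity)
    ((hi2.sub hi1).sub hi3) (by
      filter_upwards [h2] with t ht htx hta
      have e1 := ht (h3 (hmem htx)) (hmem htx) hta
      have e2 := him t hta
      have e3 : |imDiag V t| ≤ D := (abs_add_le _ _).trans e2
      have e4 : s.sgn * imDiag V t ≤ D := by
        refine (le_abs_self _).trans ?_
        rwa [abs_mul, s.abs_sgn, one_mul]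
      have e5 : -(s.sgn * (dPhase m V N lam t - Phi m V 1 lam t).re) ≤ B := by
        refine (neg_le_abs _).trans ?_
        rwa [abs_mul, s.abs_sgn, one_mul]
      have e6 : phaseGap e μ s * (s.sgn * imDiag V t) ≤ D :=
        (mul_le_mul_of_nonneg_left e4 (hgap_nonneg s)).trans
          (mul_le_of_le_one_left hD (hgap_le s))
      have e7 : s.sgn * (τ * s.sgn) = τ := by rw [mul_left_comm, s.sgn_mul_self, mul_one]
      rw [mul_sub, mul_sub, e7]
      linarith [mul_left_comm s.sgn (phaseGap e μ s) (imDiag V t)]) (by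
      filter_upwards [h1] with t ht htx hta
      rw [Side.abs_eq (Side.mul_mem_of_mem_uIcc hs htx)] at hta
      have e1 := ht (h3 (hmem htx)) (hmem htx) s hta.le
      have e7 : s.sgn * (τ * s.sgn) = τ := by rw [mul_left_comm, s.sgn_mul_self, mul_one]
      rw [mul_sub, mul_sub, e7]
      linarith [mul_left_comm s.sgn (phaseGap e μ s) (imDiag V t)])
  rw [intervalIntegral.integral_sub (hi2.sub hi1) hi3, intervalIntegral.integral_sub hi2 hi1,
    intervalIntegral.integral_const_mul, intervalIntegral.integral_const] at key
  change phaseGap e μ s * bigF V x - _ - _ ≤ _ at key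
  have hz1 := abs_le.1 (h5 x hxJ).abs_log_sub_le
  have hz0 := abs_le.1 (h5 0 (zero_mem_dom hxJ)).abs_log_sub_le
  have ho := hoff s x hs
  have hC₁s : C₁ s ≤ C₁ .minus + C₁ .plus := by
    cases s
    · linarith [hC₁ .plus]
    · linarith [hC₁ .minus]
  have hFx := hF x
  have hτx : τ * |x| ≤ d₀ / 4 * (bigF V x + C₂) := by
    rw [hτ]
    nlinarith
  rw [Side.abs_eq hs] at hτx
  have hFn : 0 ≤ bigF V x + C₂ := le_trans (by positivity) hFx
  have hmul := mul_nonneg (sub_nonneg.2 (hd₀le s)) hFn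
  have hpos : 0 < ‖k₁ V x * exp (-phase m V N lam x)‖ :=
    norm_pos_iff.2 (mul_ne_zero (k₁_ne_zero V x) (exp_ne_zero _))
  rw [← Real.exp_log hpos, ← Real.exp_add, Real.exp_le_exp, h4 x hxJ]
  simp only [sub_zero, smul_eq_mul] at key
  have hg1 : (phaseGap e μ s - ε s) * C₂ ≤ 1 * C₂ :=
    mul_le_mul_of_nonneg_right (by linarith [hgap_le s, (hA.ε_mem s).1]) hC₂
  have hC₁0 := hC₁ s
  have hdF : 0 ≤ d₀ * (bigF V x + C₂) := by positivity
  nlinarith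

include hA he he' in
/-- The WKB exponential is bounded below on `[0, 1]`. -/
lemma AssumptionA.exists_exp_lower (hN : 1 ≤ N) (hε₁ : ε₁ ∈ Set.Ioo (0 : ℝ) 1)
    (hsub : ∀ᶠ lam in atBot ⊔ atTop, core m V f ν ε₁ η lam ⊆ dom m V e lam) :
    ∃ c > 0, ∀ᶠ lam in atBot ⊔ atTop, ∀ x ∈ core m V f ν ε₁ η lam, x ∈ Set.Icc 0 1 →
      c ≤ ‖k₁ V x * exp (-phase m V N lam x)‖ := by
  obtain ⟨B, hB, hloc⟩ := hA.re_phase_bound (m := m) (η := η) he he' hN hε₁ 1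
  have hoff : Continuous fun t => (V t 0 1).im + (V t 1 0).im :=
    (continuous_im.comp (hA.off_continuous hN 0 1 (by simp))).add
      (continuous_im.comp (hA.off_continuous hN 1 0 (by simp)))
  obtain ⟨D, hD⟩ := (isCompact_Icc (a := (0 : ℝ)) (b := 1)).exists_bound_of_continuousOn
    (intervalIntegral.continuous_primitive (μ := volume)
      (fun _ _ => hoff.intervalIntegrable _ _) 0).continuousOn
  refine ⟨Real.exp (-(D + Real.log 2 + B)), Real.exp_pos _, ?_⟩
  filter_upwards [hloc, hsub, hA.eventually_log_norm (m := m) he he' hN,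
    eventually_nearReal (m := m) (V := V) he he'] with lam h1 h2 h3 h4 x hx hx1
  have hxJ := h2 hx
  have hmem {t : ℝ} (ht : t ∈ Set.uIcc 0 x) : t ∈ core m V f ν ε₁ η lam :=
    ordConnected_core.uIcc_subset zero_mem_core hx ht
  have hint : ‖∫ t in (0 : ℝ)..x, (dPhase m V N lam t - Phi m V 1 lam t).re‖ ≤ B * |x - 0| := by
    refine intervalIntegral.norm_integral_le_of_norm_le_const_ae ?_
    filter_upwards [h1] with t ht htx
    have htx' := Set.uIoc_subset_uIcc htx
    refine ht (h2 (hmem htx')) (hmem htx') ?_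
    rw [Set.uIcc_of_le hx1.1] at htx'
    rw [abs_of_nonneg htx'.1]
    exact htx'.2.trans hx1.2
  rw [sub_zero, abs_of_nonneg hx1.1] at hint
  have hBx : B * x ≤ B := mul_le_of_le_one_right hB hx1.2
  have e1 := (abs_le.1 hint).2
  have e2 := (abs_le.1 (hD x hx1)).1
  have hz1 := abs_le.1 (h4 x hxJ).abs_log_sub_le
  have hz0 := abs_le.1 (h4 0 (zero_mem_dom hxJ)).abs_log_sub_le
  have hD0 : 0 ≤ D := (norm_nonneg _).trans (hD x hx1)
  have hpos : 0 < ‖k₁ V x * exp (-phase m V N lam x)‖ :=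
    norm_pos_iff.2 (mul_ne_zero (k₁_ne_zero V x) (exp_ne_zero _))
  rw [← Real.exp_log hpos, Real.exp_le_exp, h3 x hxJ]
  linarith [hz1.1, hz1.2, hz0.1, hz0.2]

end

end DiracWKB

end

noncomputable section

namespace DiracWKB

/-! ### Cut-off functions -/

/-- The cut-off radius as a real number. -/
def radius (m : ℝ) (V : ℝ → Matrix (Fin 2) (Fin 2) ℂ) (f : ℝ → ℝ) (ν : Side → ℝ) (ε₁ η : ℝ)
    (s : Side) (lam : ℝ) : ℝ := (delta m V f ν ε₁ η s lam).toReal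

/-- The cut-off radii are finite and at least `R` at the ends with a cut-off. -/
def RadiusGE (m : ℝ) (V : ℝ → Matrix (Fin 2) (Fin 2) ℂ) (f : ℝ → ℝ) (ν : Side → ℝ) (ε₁ η : ℝ)
    (R lam : ℝ) : Prop :=
  ∀ s, ¬ NoCut V ν s → R ≤ radius m V f ν ε₁ η s lam ∧
    delta m V f ν ε₁ η s lam = (radius m V f ν ε₁ η s lam : EReal)

lemma iteratedDeriv_eq_zero_of_eventuallyEq_const {g : ℝ → ℝ} {c x : ℝ} (h : g =ᶠ[𝓝 x] fun _ => c)
    {j : ℕ} (hj : j ≠ 0) : iteratedDeriv j g x = 0 := by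
  rw [h.iteratedDeriv_eq j]
  simp [iteratedDeriv_const, hj]

lemma exists_smoothTransition_bound : ∃ C : ℝ, ∀ j : ℕ, (j = 1 ∨ j = 2) → ∀ x,
    |iteratedDeriv j Real.smoothTransition x| ≤ C := by
  have key (j : ℕ) (hj : j ≠ 0) : ∃ C : ℝ, ∀ x, |iteratedDeriv j Real.smoothTransition x| ≤ C := by
    have hc : Continuous (iteratedDeriv j Real.smoothTransition) :=
      (Real.smoothTransition.contDiff (n := (j : ℕ∞))).continuous_iteratedDeriv j le_rfl
    obtain ⟨C, hC⟩ := (isCompact_Icc (a := (0 : ℝ)) (b := 1)).exists_bound_of_continuousOn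
      hc.continuousOn
    refine ⟨C, fun x => ?_⟩
    have hC0 : 0 ≤ C := (norm_nonneg _).trans (hC 0 ⟨le_rfl, zero_le_one⟩)
    by_cases hx : x ∈ Set.Icc (0 : ℝ) 1
    · exact hC x hx
    · rw [Set.mem_Icc, not_and_or, not_le, not_le] at hx
      rcases hx with hx | hx
      · rw [iteratedDeriv_eq_zero_of_eventuallyEq_const (c := 0) _ hj]
        · simpa using hC0
        · filter_upwards [gt_mem_nhds hx] with y hy
          exact Real.smoothTransition.zero_of_nonpos hy.le
      · rw [iteratedDeriv_eq_zero_of_eventuallyEq_const (c := 1) _ hj]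
        · simpa using hC0
        · filter_upwards [lt_mem_nhds hx] with y hy
          exact Real.smoothTransition.one_of_one_le hy.le
  obtain ⟨C1, h1⟩ := key 1 one_ne_zero
  obtain ⟨C2, h2⟩ := key 2 two_ne_zero
  refine ⟨max C1 C2, ?_⟩
  rintro j (rfl | rfl) x
  · exact (h1 x).trans (le_max_left _ _)
  · exact (h2 x).trans (le_max_right _ _)

open Classical in
/-- The cut-off at the end `s`. -/
def cutSide (m : ℝ) (V : ℝ → Matrix (Fin 2) (Fin 2) ℂ) (f : ℝ → ℝ) (ν : Side → ℝ) (ε₁ η : ℝ)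
    (lam : ℝ) (s : Side) (x : ℝ) : ℝ :=
  if NoCut V ν s then 1 else
    Real.smoothTransition ((radius m V f ν ε₁ η s lam - s.sgn * x) * radius m V f ν ε₁ η s lam)

section

variable {m : ℝ} {V : ℝ → Matrix (Fin 2) (Fin 2) ℂ} {N : ℕ} {f : ℝ → ℝ} {μ ε ν : Side → ℝ}
  {ε₁ η lam C₀ : ℝ} {χ : ℝ → ℝ}

lemma AssumptionA.eventually_radiusGE (hA : AssumptionA V N f μ ε ν)
    (hε₁ : ε₁ ∈ Set.Ioo (0 : ℝ) 1) (hη : 0 < η) (R : ℝ) :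
    ∀ᶠ lam in atBot ⊔ atTop, RadiusGE m V f ν ε₁ η R lam := by
  have key (s : Side) : ∀ᶠ lam in atBot ⊔ atTop, ¬ NoCut V ν s →
      R ≤ radius m V f ν ε₁ η s lam ∧
        delta m V f ν ε₁ η s lam = (radius m V f ν ε₁ η s lam : EReal) := by
    by_cases hs : NoCut V ν s
    · exact Eventually.of_forall fun _ h => absurd hs h
    · filter_upwards [hA.delta_large (m := m) hε₁ hη hs R] with lam hd _
      obtain ⟨d, hRd, hd⟩ := hd
      rw [radius, hd]
      exact ⟨hRd, rfl⟩
  filter_upwards [key .minus, key .plus] with lam h1 h2 s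
  cases s
  · exact h1
  · exact h2

lemma RadiusGE.inv_mem (h : RadiusGE m V f ν ε₁ η 2 lam) {s : Side} (hs : ¬ NoCut V ν s) :
    0 < (radius m V f ν ε₁ η s lam)⁻¹ ∧ (radius m V f ν ε₁ η s lam)⁻¹ ≤ 1 / 2 := by
  have h2 := (h s hs).1
  refine ⟨by positivity, ?_⟩
  rw [one_div]
  exact inv_anti₀ two_pos h2

/-- The cut-off is one if the point is away from the cut-off radii. -/
lemma IsCutoff.eq_one_of_lt (h : IsCutoff m V f ν ε₁ η C₀ lam χ)
    (hr : RadiusGE m V f ν ε₁ η 2 lam) {x : ℝ}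
    (hx : ∀ s, ¬ NoCut V ν s →
      s.sgn * x < radius m V f ν ε₁ η s lam - (radius m V f ν ε₁ η s lam)⁻¹) : χ x = 1 := by
  refine h.eq_one x ?_ ?_
  · by_cases hs : NoCut V ν .minus
    · rw [delta_eq_top hs, Delta_eq_zero hs]
      simp
    · rw [Delta_eq_inv hs, (hr _ hs).2, EReal.toReal_coe]
      have := hx _ hs
      simp only [Side.sgn] at this
      norm_cast
      linarith
  · by_cases hs : NoCut V ν .plus
    · rw [delta_eq_top hs, Delta_eq_zero hs]
      simp
    · rw [Delta_eq_inv hs, (hr _ hs).2, EReal.toReal_coe]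
      have := hx _ hs
      simp only [Side.sgn] at this
      norm_cast
      linarith

/-- The cut-off vanishes beyond the cut-off radii. -/
lemma IsCutoff.eq_zero_of_le (h : IsCutoff m V f ν ε₁ η C₀ lam χ)
    (hr : RadiusGE m V f ν ε₁ η 2 lam) {x : ℝ} {s : Side} (hs : ¬ NoCut V ν s)
    (hx : radius m V f ν ε₁ η s lam ≤ s.sgn * x) : χ x = 0 := by
  refine h.eq_zero x fun hcon => ?_
  cases s
  · have h1 := hcon.1
    rw [(hr _ hs).2] at h1
    simp only [Side.sgn] at hx
    norm_cast at h1
    linarith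
  · have h1 := hcon.2
    rw [(hr _ hs).2] at h1
    simp only [Side.sgn] at hx
    norm_cast at h1
    linarith

/-- Location and size of the derivatives of a cut-off. -/
lemma IsCutoff.exists_side_of_deriv_ne (h : IsCutoff m V f ν ε₁ η C₀ lam χ)
    (hr : RadiusGE m V f ν ε₁ η 2 lam) {j : ℕ} (hj : j = 1 ∨ j = 2) {x : ℝ}
    (hx : iteratedDeriv j χ x ≠ 0) : ∃ s, ¬ NoCut V ν s ∧
      radius m V f ν ε₁ η s lam - (radius m V f ν ε₁ η s lam)⁻¹ ≤ s.sgn * x ∧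
      s.sgn * x ≤ radius m V f ν ε₁ η s lam ∧
      |iteratedDeriv j χ x| ≤ C₀ * radius m V f ν ε₁ η s lam ^ j := by
  have hj0 : j ≠ 0 := by omega
  by_cases hin : ∀ s, ¬ NoCut V ν s →
      s.sgn * x < radius m V f ν ε₁ η s lam - (radius m V f ν ε₁ η s lam)⁻¹
  · exfalso
    refine hx (iteratedDeriv_eq_zero_of_eventuallyEq_const (c := 1) ?_ hj0)
    have key (s : Side) : ∀ᶠ y in 𝓝 x, ¬ NoCut V ν s →
        s.sgn * y < radius m V f ν ε₁ η s lam - (radius m V f ν ε₁ η s lam)⁻¹ := by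
      by_cases hs : NoCut V ν s
      · exact Eventually.of_forall fun _ h => absurd hs h
      · filter_upwards [(continuous_const.mul continuous_id).continuousAt.eventually_lt_const
          (hin s hs)] with y hy _ using hy
    filter_upwards [key .minus, key .plus] with y h1 h2
    refine h.eq_one_of_lt hr fun s => ?_
    cases s
    · exact h1
    · exact h2
  · push Not at hin
    obtain ⟨s, hs, hge⟩ := hin
    have hi := hr.inv_mem hs
    have hR := (hr s hs).1
    refine ⟨s, hs, hge, ?_, ?_⟩
    · by_contra hcon
      rw [not_le] at hcon
      refine hx (iteratedDeriv_eq_zero_of_eventuallyEq_const (c := 0) ?_ hj0)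
      filter_upwards [(continuous_const.mul continuous_id).continuousAt.eventually_const_lt hcon]
        with y hy
      exact h.eq_zero_of_le hr hs hy.le
    · have hb := h.deriv_le s j hj x (by linarith)
      rw [Delta_eq_inv hs, inv_pow, ← div_eq_mul_inv, div_le_iff₀ (pow_pos (by
        change 0 < radius m V f ν ε₁ η s lam
        linarith) _)] at hb
      exact hb

lemma contDiff_cutSide (s : Side) : ContDiff ℝ ∞ (cutSide m V f ν ε₁ η lam s) := by
  unfold cutSide
  split_ifs
  · exact contDiff_const
  · exact Real.smoothTransition.contDiff.comp (by fun_prop)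

lemma cutSide_mem_Icc (s : Side) (x : ℝ) : cutSide m V f ν ε₁ η lam s x ∈ Set.Icc 0 1 := by
  unfold cutSide
  split_ifs
  · simp
  · exact ⟨Real.smoothTransition.nonneg _, Real.smoothTransition.le_one _⟩

lemma cutSide_eq_one (hr : RadiusGE m V f ν ε₁ η 2 lam) {s : Side} {x : ℝ}
    (hx : ¬ NoCut V ν s →
      s.sgn * x ≤ radius m V f ν ε₁ η s lam - (radius m V f ν ε₁ η s lam)⁻¹) :
    cutSide m V f ν ε₁ η lam s x = 1 := by
  unfold cutSide
  split_ifs with hs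
  · rfl
  · refine Real.smoothTransition.one_of_one_le ?_
    have h2 := (hr s hs).1
    have h0 : 0 < radius m V f ν ε₁ η s lam := by linarith
    rw [← div_le_iff₀ h0, one_div]
    linarith [hx hs]

/-- With r ≥ 2 one has r - 1/r ≥ 3/2. The strict margin up to 1 is what makes this factor constant
near every point of the opposite half-line, including 0. -/
lemma cutSide_eq_one_of_nonpos (hr : RadiusGE m V f ν ε₁ η 2 lam) {s : Side} {x : ℝ}
    (hx : s.sgn * x < 1) : cutSide m V f ν ε₁ η lam s x = 1 :=
  cutSide_eq_one hr fun hs => by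
    have := hr.inv_mem hs
    have h2 := (hr s hs).1
    linarith

/-- The argument of the transition function is affine in x with slope of modulus r, the radius; j
derivatives produce r^j, which Δ^j = r^{-j} cancels. -/
lemma cutSide_deriv_le {C : ℝ} (hC : ∀ j : ℕ, (j = 1 ∨ j = 2) → ∀ x,
      |iteratedDeriv j Real.smoothTransition x| ≤ C)
    (hr : RadiusGE m V f ν ε₁ η 2 lam) (s : Side) {j : ℕ} (hj : j = 1 ∨ j = 2) (x : ℝ) :
    |iteratedDeriv j (cutSide m V f ν ε₁ η lam s) x| * Delta m V f ν ε₁ η s lam ^ j ≤ C := by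
  have hC0 : 0 ≤ C := (abs_nonneg _).trans (hC 1 (Or.inl rfl) 0)
  have hj0 : j ≠ 0 := by omega
  by_cases hs : NoCut V ν s
  · rw [Delta_eq_zero hs, zero_pow hj0, mul_zero]
    exact hC0
  · have h2 := (hr s hs).1
    rw [Delta_eq_inv hs]
    change _ * (radius m V f ν ε₁ η s lam)⁻¹ ^ j ≤ _
    have hfun : cutSide m V f ν ε₁ η lam s = fun x => (fun y => Real.smoothTransition
        (y + radius m V f ν ε₁ η s lam * radius m V f ν ε₁ η s lam))
          (-(s.sgn * radius m V f ν ε₁ η s lam) * x) := by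
      funext y
      rw [cutSide, if_neg hs]
      congr 1
      ring
    have hsm : ContDiff ℝ j fun y => Real.smoothTransition
        (y + radius m V f ν ε₁ η s lam * radius m V f ν ε₁ η s lam) :=
      (Real.smoothTransition.contDiff (n := (j : ℕ∞))).comp (contDiff_id.add contDiff_const)
    rw [hfun, iteratedDeriv_comp_const_mul hsm]
    simp only [iteratedDeriv_comp_add_const]
    rw [abs_mul, abs_pow, abs_neg, abs_mul, s.abs_sgn, one_mul,
      abs_of_nonneg (by linarith), mul_right_comm, ← mul_pow, mul_inv_cancel₀ (by linarith),
      one_pow, one_mul]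
    exact hC j hj _

/-- Admissible cut-offs exist. -/
lemma AssumptionA.exists_isCutoff (hA : AssumptionA V N f μ ε ν)
    (hε₁ : ε₁ ∈ Set.Ioo (0 : ℝ) 1) (hη : 0 < η) : ∃ (C₀ : ℝ) (χ : ℝ → ℝ → ℝ),
      ∀ᶠ lam in atBot ⊔ atTop, IsCutoff m V f ν ε₁ η C₀ lam (χ lam) := by
  obtain ⟨C, hC⟩ := exists_smoothTransition_bound
  refine ⟨C, fun lam x => cutSide m V f ν ε₁ η lam .minus x * cutSide m V f ν ε₁ η lam .plus x, ?_⟩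
  filter_upwards [hA.eventually_radiusGE (m := m) hε₁ hη 2] with lam hr
  refine ⟨(contDiff_cutSide _).mul (contDiff_cutSide _), fun x => ?_, fun x h1 h2 => ?_,
    fun x hx => ?_, fun s j hj x hx => ?_⟩
  · have a := cutSide_mem_Icc (m := m) (V := V) (f := f) (ν := ν) (ε₁ := ε₁) (η := η)
      (lam := lam) .minus x
    have b := cutSide_mem_Icc (m := m) (V := V) (f := f) (ν := ν) (ε₁ := ε₁) (η := η)
      (lam := lam) .plus x
    exact ⟨mul_nonneg a.1 b.1, mul_le_one₀ a.2 b.1 b.2⟩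
  · rw [cutSide_eq_one hr fun hs => ?_, cutSide_eq_one hr fun hs => ?_, mul_one]
    · rw [Delta_eq_inv hs, (hr _ hs).2, EReal.toReal_coe] at h2
      simp only [Side.sgn]
      norm_cast at h2
      linarith
    · rw [Delta_eq_inv hs, (hr _ hs).2, EReal.toReal_coe] at h1
      simp only [Side.sgn]
      norm_cast at h1
      linarith
  · have key (s : Side) (hs : ¬ NoCut V ν s) (h : radius m V f ν ε₁ η s lam ≤ s.sgn * x) :
        cutSide m V f ν ε₁ η lam s x = 0 := by
      rw [cutSide, if_neg hs]
      have h2 := (hr s hs).1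
      exact Real.smoothTransition.zero_of_nonpos
        (mul_nonpos_of_nonpos_of_nonneg (by linarith) (by linarith))
    rw [not_and_or] at hx
    rcases hx with hx | hx
    · have hs : ¬ NoCut V ν .minus := fun hs => hx (by rw [delta_eq_top hs]; simp)
      rw [(hr _ hs).2] at hx
      norm_cast at hx
      rw [key .minus hs (by simp only [Side.sgn]; linarith), zero_mul]
    · have hs : ¬ NoCut V ν .plus := fun hs => hx (by rw [delta_eq_top hs]; simp)
      rw [(hr _ hs).2] at hx
      norm_cast at hx
      rw [key .plus hs (by simp only [Side.sgn]; linarith), mul_zero]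
  -- On the half-line of s the factor belonging to the other end is identically 1 near x, so only
  -- one factor is differentiated.
  · have heq : (fun x => cutSide m V f ν ε₁ η lam .minus x * cutSide m V f ν ε₁ η lam .plus x)
        =ᶠ[𝓝 x] cutSide m V f ν ε₁ η lam s := by
      cases s
      · simp only [Side.sgn] at hx
        filter_upwards [gt_mem_nhds (show x < 1 by linarith)] with y hy
        rw [cutSide_eq_one_of_nonpos hr (s := .plus) (by simpa [Side.sgn] using hy), mul_one]
      · simp only [Side.sgn] at hx
        filter_upwards [lt_mem_nhds (show -1 < x by linarith)] with y hy
        rw [cutSide_eq_one_of_nonpos hr (s := .minus) (by simp only [Side.sgn]; linarith), one_mul]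
    rw [heq.iteratedDeriv_eq j]
    exact cutSide_deriv_le hC hr s hj x

end

end DiracWKB

end

noncomputable section

namespace DiracWKB

/-! ### The WKB regime -/

/-- The estimates on the WKB phase that hold for large `|λ|`. -/
structure Regime (m : ℝ) (V : ℝ → Matrix (Fin 2) (Fin 2) ℂ) (N : ℕ) (f : ℝ → ℝ) (ν : Side → ℝ)
    (ε₁ η e C c d lam : ℝ) : Prop where
  one_le : 1 ≤ |lam|
  radius_ge : RadiusGE m V f ν ε₁ η 2 lam
  sub : core m V f ν ε₁ η lam ⊆ dom m V e lam
  near : ∀ x ∈ dom m V e lam, NearReal e lam (zOne m V lam x) (zTwo m V lam x)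
  hasDerivAt : ∀ x ∈ dom m V e lam, HasDerivAt (phase m V N lam) (dPhase m V N lam x) x
  lipAt : ∀ x ∈ dom m V e lam, LipAt (dPhase m V N lam) x
  dPhase_le : ∀ᵐ x, x ∈ core m V f ν ε₁ η lam → ‖dPhase m V N lam x‖ ≤ C * rho m V lam x
  logK_le : ∀ᵐ x, x ∈ core m V f ν ε₁ η lam → ‖logK m V lam x‖ ≤ C * rho m V lam x
  remainder_le : ∀ᵐ x, x ∈ core m V f ν ε₁ η lam → ‖remainder m V N lam x‖ ≤
    C * (rate ν ε₁ N .minus lam + rate ν ε₁ N .plus lam) * rho m V lam x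
  upper : ∀ x ∈ core m V f ν ε₁ η lam,
    ‖k₁ V x * exp (-phase m V N lam x)‖ ≤ C * Real.exp (-d * bigF V x)
  lower : ∀ x ∈ core m V f ν ε₁ η lam, x ∈ Set.Icc 0 1 →
    c ≤ ‖k₁ V x * exp (-phase m V N lam x)‖

section

variable {m : ℝ} {V : ℝ → Matrix (Fin 2) (Fin 2) ℂ} {N : ℕ} {f : ℝ → ℝ} {μ ε ν : Side → ℝ}
  {ε₁ η e : ℝ}

lemma rate_nonneg (ν : Side → ℝ) (ε₁ : ℝ) (N : ℕ) (s : Side) (lam : ℝ) :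
    0 ≤ rate ν ε₁ N s lam := by
  unfold rate
  split_ifs <;> positivity

lemma AssumptionA.eventually_regime (hA : AssumptionA V N f μ ε ν) (hN : 1 ≤ N)
    (hε₁ : ε₁ ∈ Set.Ioo (0 : ℝ) 1) (hη : 0 < η) (he' : 2 * η ≤ 1 / 10)
    (heμ : ∀ s, 2 * η ≤ μ s) (hgap : ∀ s, ε s < phaseGap (2 * η) μ s) :
    ∃ C c d : ℝ, 0 < C ∧ 0 < c ∧ 0 < d ∧
      ∀ᶠ lam in atBot ⊔ atTop, Regime m V N f ν ε₁ η (2 * η) C c d lam := by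
  have he : 0 < 2 * η := by positivity
  have hsub := hA.core_subset_dom (m := m) hε₁ hη
  obtain ⟨d, hd, C₁, hC₁, hup⟩ := hA.exists_exp_upper (m := m) he he' hN hε₁ heμ hgap hsub
  obtain ⟨c, hc, hlow⟩ := hA.exists_exp_lower (m := m) he he' hN hε₁ hsub
  obtain ⟨C₂, hC₂, hrem⟩ := hA.remainder_bound (m := m) (η := η) he he' hN hε₁
  obtain ⟨C₃, hC₃, hPhi⟩ := hA.Phi_aeBound (m := m) he he' hN
  obtain ⟨C₄, hC₄, hK⟩ := (hA.sym_logK (m := m) he he' hN).aeBound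
  set C₅ := ∑ k ∈ Finset.range (N + 1), C₃ * 2 ^ k with hC₅
  have hC₅0 : 0 ≤ C₅ := Finset.sum_nonneg fun _ _ => by positivity
  refine ⟨C₁ + C₂ + 2 * C₄ + C₅, c, d, by positivity, hc, hd, ?_⟩
  filter_upwards [eventually_le_abs 1, hA.eventually_radiusGE (m := m) hε₁ hη 2, hsub,
    eventually_nearReal (m := m) (V := V) he he',
    hA.eventually_hasDerivAt_phase (m := m) he he' hN,
    hA.eventually_lipAt_dPhase (m := m) he he' hN, hPhi, hK, hrem, hup, hlow,
    hA.eventually_wt_pow_le (m := m) (η := η) hε₁]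
    with lam l1 l2 l3 l4 l5 l6 l7 l8 l9 l10 l11 l12
  have hrho (x : ℝ) : 0 ≤ rho m V lam x := norm_nonneg _
  refine ⟨l1, l2, l3, l4, l5, l6, ?_, ?_, ?_, fun x hx => (l10 x hx).trans ?_, l11⟩
  · filter_upwards [l7] with x hx hc
    have hJ := l3 hc
    have h0 : ‖dPhase m V N lam x‖ ≤ C₅ * rho m V lam x := by
      rw [dPhase, hC₅, Finset.sum_mul]
      refine (norm_sum_le _ _).trans (Finset.sum_le_sum fun k hk => ?_)
      have h1 := hx hJ k (Finset.mem_range.2 (by rw [Finset.mem_range] at hk; omega))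
      obtain ⟨h2, h3⟩ := wPhi_le (f := f) (ν := ν) (l4 x hJ) (l12 x hc).2.1 k
      have h4 : (wt f ν x * |lam|⁻¹) ^ k ≤ 1 :=
        pow_le_one₀ (mul_nonneg (wt_nonneg f ν x) (by positivity)) h3
      rw [mul_assoc]
      refine h1.trans (mul_le_mul_of_nonneg_left (h2.trans ?_) hC₃)
      exact mul_le_of_le_one_right (mul_nonneg (by positivity) (hrho x)) h4
    exact h0.trans (mul_le_mul_of_nonneg_right (by linarith) (hrho x))
  · filter_upwards [l8] with x hx hc
    have hJ := l3 hc
    have h1 := hx hJ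
    have h2 : wt f ν x ≤ 2 * rho m V lam x := by
      have := (l4 x hJ).norm_right'
      have h3 := (l12 x hc).2.1
      unfold rho
      linarith
    have h3 : C₄ * wt f ν x ≤ C₄ * (2 * rho m V lam x) := mul_le_mul_of_nonneg_left h2 hC₄
    have h4 : 0 ≤ (C₁ + C₂ + C₅) * rho m V lam x := mul_nonneg (by positivity) (hrho x)
    linarith
  · filter_upwards [l9] with x hx hc
    refine (hx (l3 hc) hc).trans (mul_le_mul_of_nonneg_right (mul_le_mul_of_nonneg_right
      (by linarith) (add_nonneg (rate_nonneg _ _ _ _ _) (rate_nonneg _ _ _ _ _))) (hrho x))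
  · exact mul_le_mul_of_nonneg_right (by linarith) (Real.exp_pos _).le

end

/-! ### The pseudomode -/

lemma lipAt_of_hasDerivAt {g g' : ℝ → ℂ} {x : ℝ} (h : ∀ᶠ y in 𝓝 x, HasDerivAt g (g' y) y)
    (hc : ContinuousAt g' x) : LipAt g x := by
  obtain ⟨K, t, ht, hK⟩ := (hasStrictDerivAt_of_hasDerivAt_of_continuousAt h
    hc).hasStrictFDerivAt.exists_lipschitzOnWith
  exact ⟨K, t, ht, hK⟩

lemma isClosed_core {m : ℝ} {V : ℝ → Matrix (Fin 2) (Fin 2) ℂ} {f : ℝ → ℝ} {ν : Side → ℝ}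
    {ε₁ η lam : ℝ} : IsClosed (core m V f ν ε₁ η lam) := by
  have : core m V f ν ε₁ η lam = {x : ℝ | ((-x : ℝ) : EReal) ≤ delta m V f ν ε₁ η .minus lam} ∩
      {x : ℝ | (x : EReal) ≤ delta m V f ν ε₁ η .plus lam} := by
    ext x
    exact mem_core_iff
  rw [this]
  exact (isClosed_le (continuous_coe_real_ereal.comp continuous_neg) continuous_const).inter
    (isClosed_le continuous_coe_real_ereal continuous_const)

/-- The derivative of `u`. -/
def duFun (m : ℝ) (V : ℝ → Matrix (Fin 2) (Fin 2) ℂ) (N : ℕ) (lam : ℝ) (χ : ℝ → ℝ) (x : ℝ) : ℂ :=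
  ((deriv χ x : ℝ) - (χ x : ℂ) * dPhase m V N lam x) * exp (-phase m V N lam x)

/-- The second component of the pseudomode. -/
def compTwo (m : ℝ) (V : ℝ → Matrix (Fin 2) (Fin 2) ℂ) (N : ℕ) (lam : ℝ) (χ : ℝ → ℝ) (x : ℝ) : ℂ :=
  -I * (k₁ V x * duFun m V N lam χ x * (zTwo m V lam x)⁻¹)

/-- The first component of the pseudomode. -/
def compOne (m : ℝ) (V : ℝ → Matrix (Fin 2) (Fin 2) ℂ) (N : ℕ) (lam : ℝ) (χ : ℝ → ℝ) (x : ℝ) : ℂ :=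
  k₁ V x * exp (-phase m V N lam x) * χ x

/-- The terms of the residual. -/
def resTerm (m : ℝ) (V : ℝ → Matrix (Fin 2) (Fin 2) ℂ) (N : ℕ) (lam : ℝ) (g : ℝ → ℂ) (x : ℝ) :
    ℂ :=
  k₁ V x * exp (-phase m V N lam x) * (zTwo m V lam x)⁻¹ * g x

section

variable {m : ℝ} {V : ℝ → Matrix (Fin 2) (Fin 2) ℂ} {N : ℕ} {f : ℝ → ℝ} {μ ε ν : Side → ℝ}
  {ε₁ η e C c d lam C₀ : ℝ} {χ : ℝ → ℝ}

lemma IsCutoff.eventually_eq_zero (h : IsCutoff m V f ν ε₁ η C₀ lam χ) {x : ℝ}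
    (hx : x ∉ core m V f ν ε₁ η lam) : χ =ᶠ[𝓝 x] fun _ => 0 := by
  filter_upwards [isClosed_core.isOpen_compl.mem_nhds hx] with y hy
  refine h.eq_zero y fun hcon => hy ⟨hcon.1.le, hcon.2.le⟩

lemma IsCutoff.eq_zero_of_notMem (h : IsCutoff m V f ν ε₁ η C₀ lam χ) {x : ℝ}
    (hx : x ∉ core m V f ν ε₁ η lam) : χ x = 0 ∧ deriv χ x = 0 ∧ iteratedDeriv 2 χ x = 0 := by
  have h0 := h.eventually_eq_zero hx
  refine ⟨h0.self_of_nhds, ?_, iteratedDeriv_eq_zero_of_eventuallyEq_const h0 two_ne_zero⟩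
  rw [← iteratedDeriv_one]
  exact iteratedDeriv_eq_zero_of_eventuallyEq_const h0 one_ne_zero

lemma IsCutoff.hasDerivAt (h : IsCutoff m V f ν ε₁ η C₀ lam χ) (x : ℝ) :
    HasDerivAt (fun y => (χ y : ℂ)) ((deriv χ x : ℝ) : ℂ) x :=
  ((h.smooth.differentiable (by simp)) x).hasDerivAt.ofReal_comp

lemma IsCutoff.hasDerivAt_deriv (h : IsCutoff m V f ν ε₁ η C₀ lam χ) (x : ℝ) :
    HasDerivAt (fun y => ((deriv χ y : ℝ) : ℂ)) ((iteratedDeriv 2 χ x : ℝ) : ℂ) x := by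
  have h1 : ContDiff ℝ 1 (deriv χ) := (contDiff_succ_iff_deriv (n := 1)).1
    (h.smooth.of_le (by norm_cast)) |>.2.2
  have := ((h1.differentiable (by simp)) x).hasDerivAt.ofReal_comp
  rwa [iteratedDeriv_succ, iteratedDeriv_one]

lemma IsCutoff.continuous_iteratedDeriv_two (h : IsCutoff m V f ν ε₁ η C₀ lam χ) :
    Continuous fun x => ((iteratedDeriv 2 χ x : ℝ) : ℂ) :=
  continuous_ofReal.comp (h.smooth.continuous_iteratedDeriv 2 (by norm_cast))

lemma IsCutoff.continuous_deriv (h : IsCutoff m V f ν ε₁ η C₀ lam χ) :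
    Continuous fun x => ((deriv χ x : ℝ) : ℂ) :=
  continuous_iff_continuousAt.2 fun x => (h.hasDerivAt_deriv x).continuousAt

variable (hR : Regime m V N f ν ε₁ η e C c d lam) (hA : AssumptionA V N f μ ε ν) (hN : 1 ≤ N)
  (hχ : IsCutoff m V f ν ε₁ η C₀ lam χ)

include hR hχ in
-- The phase is controlled only on `dom`. Outside the closed core, the cut-off vanishes in a
-- neighbourhood, so the values of the phase there are irrelevant. The same dichotomy recurs below.
lemma Regime.hasDerivAt_uFun (x : ℝ) :
    HasDerivAt (uFun m V N lam χ) (duFun m V N lam χ x) x := by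
  by_cases hx : x ∈ core m V f ν ε₁ η lam
  · refine ((hχ.hasDerivAt x).mul (hR.hasDerivAt x (hR.sub hx)).neg.cexp).congr_deriv ?_
    simp only [duFun, Pi.neg_apply]
    ring
  · obtain ⟨h0, h1, -⟩ := hχ.eq_zero_of_notMem hx
    have : duFun m V N lam χ x = 0 := by simp [duFun, h0, h1]
    rw [this]
    refine (hasDerivAt_const x (0 : ℂ)).congr_of_eventuallyEq ?_
    filter_upwards [hχ.eventually_eq_zero hx] with y hy
    simp [uFun, hy]

include hR hχ in
lemma Regime.pseudomode_eq : pseudomode m V N lam χ =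
    fun x => !₂[compOne m V N lam χ x, compTwo m V N lam χ x] := by
  funext x
  have h1 : k₁ V x * uFun m V N lam χ x = compOne m V N lam χ x := by
    rw [uFun, compOne]
    ring
  have h2 : k₂ V x * vFun m V N lam χ x = compTwo m V N lam χ x := by
    rw [vFun, compTwo, (hR.hasDerivAt_uFun hχ x).deriv]
    have := k₂_ne_zero V x
    rw [zTwo]
    field_simp
  rw [pseudomode, h1, h2]

lemma hasDerivAt_exp_phase (hR : Regime m V N f ν ε₁ η e C c d lam) {x : ℝ}
    (hx : x ∈ dom m V e lam) : HasDerivAt (fun y => exp (-phase m V N lam y))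
      (-dPhase m V N lam x * exp (-phase m V N lam x)) x := by
  refine (hR.hasDerivAt x hx).neg.cexp.congr_deriv ?_
  rw [Pi.neg_apply]
  ring

lemma Regime.lipAt_exp_phase (hR : Regime m V N f ν ε₁ η e C c d lam)
    (hA : AssumptionA V N f μ ε ν) {x : ℝ} (hx : x ∈ dom m V e lam) :
    LipAt (fun y => exp (-phase m V N lam y)) x := by
  refine lipAt_of_hasDerivAt (g' := fun y => -dPhase m V N lam y * exp (-phase m V N lam y))
    (eventually_of_mem (hA.isOpen_dom.mem_nhds hx) fun y hy => hasDerivAt_exp_phase hR hy) ?_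
  exact (hR.lipAt x hx).continuousAt.neg.mul (hasDerivAt_exp_phase hR hx).continuousAt

lemma lipAt_k₁ (h : Continuous fun x => V x 1 0) (x : ℝ) : LipAt (k₁ V) x :=
  lipAt_of_hasDerivAt (Eventually.of_forall fun y => hasDerivAt_k₁ h y)
    ((continuous_const.mul h).continuousAt.mul (hasDerivAt_k₁ h x).continuousAt)

include hR hA hN hχ in
lemma Regime.lipAt_compOne (x : ℝ) : LipAt (compOne m V N lam χ) x := by
  by_cases hx : x ∈ core m V f ν ε₁ η lam
  · exact ((lipAt_k₁ (hA.off_continuous hN 1 0 (by simp)) x).mul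
      (hR.lipAt_exp_phase hA (hR.sub hx))).mul
      (lipAt_of_hasDerivAt (Eventually.of_forall hχ.hasDerivAt) hχ.continuous_deriv.continuousAt)
  · refine (lipAt_const 0 x).congr ?_
    filter_upwards [hχ.eventually_eq_zero hx] with y hy
    simp [compOne, hy]

include hχ in
lemma IsCutoff.duFun_eventuallyEq {x : ℝ} (hx : x ∉ core m V f ν ε₁ η lam) :
    duFun m V N lam χ =ᶠ[𝓝 x] fun _ => 0 := by
  filter_upwards [isClosed_core.isOpen_compl.mem_nhds hx] with y hy
  obtain ⟨h0, h1, -⟩ := hχ.eq_zero_of_notMem hy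
  simp [duFun, h0, h1]

include hR hA hN hχ in
lemma Regime.lipAt_compTwo (x : ℝ) : LipAt (compTwo m V N lam χ) x := by
  by_cases hx : x ∈ core m V f ν ε₁ η lam
  · have hJ := hR.sub hx
    have hd : LipAt (duFun m V N lam χ) x := by
      refine LipAt.mul ?_ (hR.lipAt_exp_phase hA hJ)
      have h1 := (lipAt_const (-1) x).mul ((lipAt_of_hasDerivAt
        (Eventually.of_forall hχ.hasDerivAt) hχ.continuous_deriv.continuousAt (x := x)).mul
          (hR.lipAt x hJ))
      have h2 := lipAt_of_hasDerivAt (Eventually.of_forall hχ.hasDerivAt_deriv)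
        hχ.continuous_iteratedDeriv_two.continuousAt (x := x)
      refine (h2.add h1).congr (Eventually.of_forall fun y => ?_)
      simp only
      ring
    exact (lipAt_const (-I) x).mul (((lipAt_k₁ (hA.off_continuous hN 1 0 (by simp)) x).mul hd).mul
      ((hA.lipAt_zTwo lam x).inv (hR.near x hJ).right_ne))
  · refine (lipAt_const 0 x).congr ?_
    filter_upwards [hχ.duFun_eventuallyEq (N := N) hx] with y hy
    simp [compTwo, hy]

include hR hA hN hχ in
/-- The second row of the eigenvalue equation holds exactly. -/
lemma Regime.deriv_compOne (x : ℝ) : -I * deriv (compOne m V N lam χ) x +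
    (V x 1 0 * compOne m V N lam χ x + (V x 1 1 - m) * compTwo m V N lam χ x) =
      lam * compTwo m V N lam χ x := by
  have h1 : compOne m V N lam χ = fun y => k₁ V y * uFun m V N lam χ y := by
    funext y
    rw [compOne, uFun]
    ring
  have h2 := (hasDerivAt_k₁ (hA.off_continuous hN 1 0 (by simp)) x).mul (hR.hasDerivAt_uFun hχ x)
  have h3 : (zTwo m V lam x) * compTwo m V N lam χ x = -I * (k₁ V x * duFun m V N lam χ x) := by
    by_cases hx : x ∈ core m V f ν ε₁ η lam
    · have := (hR.near x (hR.sub hx)).right_ne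
      rw [compTwo]
      field_simp
    · have := (hχ.duFun_eventuallyEq (N := N) hx).self_of_nhds
      simp [compTwo, this]
  have h4 : deriv (compOne m V N lam χ) x = -I * V x 1 0 * k₁ V x * uFun m V N lam χ x +
      k₁ V x * duFun m V N lam χ x := by
    rw [h1]
    exact h2.deriv
  rw [h4, show compOne m V N lam χ x = k₁ V x * uFun m V N lam χ x from congrFun h1 x]
  rw [zTwo] at h3
  linear_combination -h3 + V x 1 0 * k₁ V x * uFun m V N lam χ x * I_sq

include hR hA hN hχ in
/-- The residual in the first row. -/
lemma Regime.deriv_compTwo : ∀ᵐ x, -I * deriv (compTwo m V N lam χ) x +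
    (V x 0 1 * compTwo m V N lam χ x + (V x 0 0 + m) * compOne m V N lam χ x)
      - lam * compOne m V N lam χ x =
    -(resTerm m V N lam (fun x => ((iteratedDeriv 2 χ x : ℝ) : ℂ)) x
      - resTerm m V N lam (fun x => (2 * dPhase m V N lam x - logK m V lam x) *
          ((deriv χ x : ℝ) : ℂ)) x
      + resTerm m V N lam (fun x => remainder m V N lam x * χ x) x) := by
  filter_upwards [ae_differentiableAt_of_lipAt hR.lipAt] with x hdiff
  by_cases hx : x ∈ core m V f ν ε₁ η lam
  · have hJ := hR.sub hx
    have hP := (hdiff hJ).hasDerivAt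
    have hz := (hR.near x hJ).right_ne
    have hdu : HasDerivAt (duFun m V N lam χ)
        (((iteratedDeriv 2 χ x : ℝ) - 2 * (deriv χ x : ℝ) * dPhase m V N lam x
          - χ x * deriv (dPhase m V N lam) x + χ x * dPhase m V N lam x ^ 2) *
            exp (-phase m V N lam x)) x := by
      refine (((hχ.hasDerivAt_deriv x).sub ((hχ.hasDerivAt x).mul hP)).mul
        (hasDerivAt_exp_phase hR hJ)).congr_deriv ?_
      simp only [Pi.sub_apply, Pi.mul_apply]
      ring
    have hl := ((((hasDerivAt_k₁ (hA.off_continuous hN 1 0 (by simp)) x).mul hdu).mul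
      ((hA.differentiable_zTwo hN lam x).hasDerivAt.inv hz)).const_mul (-I)).deriv
    change deriv (compTwo m V N lam χ) x = _ at hl
    rw [hl]
    simp only [resTerm, remainder, compOne, compTwo, logK, Vlam_eq, Pi.mul_apply, Pi.inv_apply]
    -- This turns V₁₁ + m - λ into -(λ - m - V₁₁), which after division by λ + m - V₂₂ is the term
    -- V_λ of the remainder.
    have h00 : V x 0 0 = lam - m - zOne m V lam x := by rw [zOne]; ring
    rw [h00]
    simp only [duFun]
    field_simp
    ring_nf
    simp only [I_sq, I_pow_three]
    ring
  · obtain ⟨h0, h1, h2⟩ := hχ.eq_zero_of_notMem hx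
    have h3 : compTwo m V N lam χ =ᶠ[𝓝 x] fun _ => 0 := by
      filter_upwards [hχ.duFun_eventuallyEq (N := N) hx] with y hy
      simp [compTwo, hy]
    simp [h3.deriv_eq, h3.self_of_nhds, compOne, resTerm, h0, h1, h2]

end

end DiracWKB

end

noncomputable section

namespace DiracWKB

/-! ### Square integrability -/

lemma toReal_eLpNorm_sq {E : Type*} [NormedAddCommGroup E] {h : ℝ → E}
    (hh : MemLp h 2 volume) : (eLpNorm h 2 volume).toReal ^ 2 = ∫ x, ‖h x‖ ^ 2 := by
  have h0 : 0 ≤ ∫ x, ‖h x‖ ^ 2 := integral_nonneg fun x => by positivity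
  rw [hh.eLpNorm_eq_integral_rpow_norm two_ne_zero (by simp)]
  simp only [ENNReal.toReal_ofNat, Real.rpow_ofNat]
  rw [ENNReal.toReal_ofReal (by positivity), ← Real.rpow_natCast, ← Real.rpow_mul h0]
  norm_num

lemma normL2_nonneg (h : ℝ → ℂ) : 0 ≤ normL2 h := ENNReal.toReal_nonneg

lemma normL2_add_le {g h : ℝ → ℂ} (hg : MemLp g 2 volume) (hh : MemLp h 2 volume) :
    normL2 (fun x => g x + h x) ≤ normL2 g + normL2 h := by
  unfold normL2
  rw [← ENNReal.toReal_add hg.2.ne hh.2.ne]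
  exact ENNReal.toReal_mono (ENNReal.add_ne_top.2 ⟨hg.2.ne, hh.2.ne⟩)
    (eLpNorm_add_le hg.1 hh.1 (by norm_num))

lemma normL2_sub_le {g h : ℝ → ℂ} (hg : MemLp g 2 volume) (hh : MemLp h 2 volume) :
    normL2 (fun x => g x - h x) ≤ normL2 g + normL2 h := by
  unfold normL2
  rw [← ENNReal.toReal_add hg.2.ne hh.2.ne]
  exact ENNReal.toReal_mono (ENNReal.add_ne_top.2 ⟨hg.2.ne, hh.2.ne⟩)
    (eLpNorm_sub_le hg.1 hh.1 (by norm_num))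

lemma normL2_le_mul {g h : ℝ → ℂ} {c : ℝ} (hc : 0 ≤ c) (hh : MemLp h 2 volume)
    (hgh : ∀ᵐ x, ‖g x‖ ≤ c * ‖h x‖) : normL2 g ≤ c * normL2 h := by
  unfold normL2
  rw [← ENNReal.toReal_ofReal hc, ← ENNReal.toReal_mul]
  refine ENNReal.toReal_mono (ENNReal.mul_ne_top ENNReal.ofReal_ne_top hh.2.ne) ?_
  exact eLpNorm_le_mul_eLpNorm_of_ae_le_mul hgh 2

/-- A function that is bounded by `B` and vanishes outside a set of measure at most `D ^ 2`. -/
lemma normL2_le_of_support {g : ℝ → ℂ} {S : Set ℝ} (hS : MeasurableSet S) {B D : ℝ} (hB : 0 ≤ B)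
    (hD : 0 ≤ D) (hvol : volume S ≤ ENNReal.ofReal (D ^ 2)) (hg : ∀ᵐ x, ‖g x‖ ≤ B)
    (hg0 : ∀ x, x ∉ S → g x = 0) : normL2 g ≤ B * D := by
  unfold normL2
  rw [← ENNReal.toReal_ofReal (mul_nonneg hB hD)]
  refine ENNReal.toReal_mono ENNReal.ofReal_ne_top ?_
  calc eLpNorm g 2 volume ≤ eLpNorm (S.indicator fun _ => B) 2 volume := by
        refine eLpNorm_mono_ae ?_
        filter_upwards [hg] with x hx
        by_cases hxS : x ∈ S
        · rw [Set.indicator_of_mem hxS, Real.norm_of_nonneg hB]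
          exact hx
        · simp [hg0 x hxS]
    _ = ENNReal.ofReal B * volume S ^ (1 / 2 : ℝ) := by
        rw [eLpNorm_indicator_const hS two_ne_zero (by simp), Real.enorm_of_nonneg hB]
        simp
    _ ≤ ENNReal.ofReal B * ENNReal.ofReal (D ^ 2) ^ (1 / 2 : ℝ) := by gcongr
    _ = ENNReal.ofReal (B * D) := by
        rw [ENNReal.ofReal_rpow_of_nonneg (by positivity) (by norm_num),
          ENNReal.ofReal_mul hB, ← Real.sqrt_eq_rpow, Real.sqrt_sq hD]

lemma integrable_exp_neg_mul_abs {a : ℝ} (ha : 0 < a) :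
    Integrable fun x : ℝ => Real.exp (-a * |x|) := by
  rw [← integrableOn_univ, ← Set.Iic_union_Ioi (a := (0 : ℝ))]
  refine IntegrableOn.union ?_ ?_
  · refine (integrableOn_exp_mul_Iic ha 0).congr_fun (fun x hx => ?_) measurableSet_Iic
    simp only [abs_of_nonpos (Set.mem_Iic.1 hx)]
    ring_nf
  · refine (integrableOn_exp_mul_Ioi (neg_neg_of_pos ha) 0).congr_fun (fun x hx => ?_)
      measurableSet_Ioi
    simp only [abs_of_pos (Set.mem_Ioi.1 hx)]

lemma memLp_spinor {a b : ℝ → ℂ} (ha : MemLp a 2 volume) (hb : MemLp b 2 volume) :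
    MemLp (fun x => (!₂[a x, b x] : Spinor)) 2 volume := by
  refine MemLp.of_eval_piLp fun i => ?_
  fin_cases i
  · exact ha
  · exact hb

lemma toReal_eLpNorm_spinor {a b : ℝ → ℂ} (ha : MemLp a 2 volume) (hb : MemLp b 2 volume) :
    (eLpNorm (fun x => (!₂[a x, b x] : Spinor)) 2 volume).toReal =
      √(normL2 a ^ 2 + normL2 b ^ 2) := by
  refine (Real.sqrt_eq_iff_mul_self_eq (by positivity) ENNReal.toReal_nonneg).2 ?_ |>.symm
  rw [← pow_two, toReal_eLpNorm_sq (memLp_spinor ha hb), normL2, normL2, toReal_eLpNorm_sq ha,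
    toReal_eLpNorm_sq hb, ← integral_add ((memLp_two_iff_integrable_sq_norm ha.1).1 ha)
      ((memLp_two_iff_integrable_sq_norm hb.1).1 hb)]
  refine integral_congr_ae (ae_of_all _ fun x => ?_)
  simp only [EuclideanSpace.norm_sq_eq, Fin.sum_univ_two]
  simp

section

variable {m : ℝ} {V : ℝ → Matrix (Fin 2) (Fin 2) ℂ} {N : ℕ} {f : ℝ → ℝ} {μ ε ν : Side → ℝ}
  {ε₁ η e C c d lam C₀ : ℝ} {χ : ℝ → ℝ}

lemma AssumptionA.memLp_exp_bigF (hA : AssumptionA V N f μ ε ν) (hd : 0 < d) :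
    MemLp (fun x => Real.exp (-d * bigF V x)) 2 volume := by
  have hF : Continuous (bigF V) :=
    continuous_iff_continuousAt.2 fun x => (hA.hasDerivAt_bigF x).continuousAt
  have hc : Continuous fun x => Real.exp (-d * bigF V x) :=
    Real.continuous_exp.comp (continuous_const.mul hF)
  obtain ⟨c₀, hc₀, C₁, -, h⟩ := hA.exists_bigF_lower
  rw [memLp_two_iff_integrable_sq hc.aestronglyMeasurable]
  refine ((integrable_exp_neg_mul_abs (a := 2 * d * c₀) (by positivity)).const_mul
    (Real.exp (2 * d * C₁))).mono' (hc.pow 2).aestronglyMeasurable (ae_of_all _ fun x => ?_)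
  rw [Real.norm_of_nonneg (by positivity), ← Real.exp_nat_mul, ← Real.exp_add, Real.exp_le_exp]
  push_cast
  nlinarith [mul_le_mul_of_nonneg_left (h x) hd.le]

end

end DiracWKB

end

noncomputable section

namespace DiracWKB

/-! ### The pseudomode belongs to the domain -/

/-- For locally Lipschitz components classical and weak derivatives coincide, so it is enough to
have the two rows almost everywhere. -/
lemma isDiracImage_of_lipAt {m : ℝ} {V : ℝ → Matrix (Fin 2) (Fin 2) ℂ} {a b g₀ g₁ : ℝ → ℂ}
    (hV : ∀ i j, Continuous fun x => V x i j) (ha : ∀ x, LipAt a x) (hb : ∀ x, LipAt b x)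
    (h₀ : ∀ᵐ x, -I * deriv b x + (V x 0 1 * b x + (V x 0 0 + m) * a x) = g₀ x)
    (h₁ : ∀ᵐ x, -I * deriv a x + (V x 1 0 * a x + (V x 1 1 - m) * b x) = g₁ x) :
    IsDiracImage m V (fun x => !₂[a x, b x]) fun x => !₂[g₀ x, g₁ x] := by
  have ca := continuous_of_lipAt ha
  have cb := continuous_of_lipAt hb
  have key {u w g : ℝ → ℂ} (hu : ∀ x, LipAt u x) (hw : Continuous w)
      (h : ∀ᵐ x, -I * deriv u x + w x = g x) (φ : ℝ → ℂ) (h1 : ContDiff ℝ ∞ φ)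
      (h2 : HasCompactSupport φ) :
      ∫ x, (I * u x * deriv φ x + w x * φ x) = ∫ x, g x * φ x := by
    have cu := continuous_of_lipAt hu
    have i1 := (integrable_mul_test cu.locallyIntegrable (h1.continuous_deriv (by simp))
      h2.deriv).const_mul I
    have i2 := integrable_mul_test hw.locallyIntegrable h1.continuous h2
    have i3 := (integrable_deriv_mul_test hu h1.continuous h2).const_mul (-I)
    have e1 : ∫ x, (I * u x * deriv φ x + w x * φ x) =
        ∫ x, (I * (u x * deriv φ x) + w x * φ x) :=
      integral_congr_ae (ae_of_all _ fun x => by ring)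
    have e2 : ∫ x, g x * φ x = ∫ x, (-I * (deriv u x * φ x) + w x * φ x) := by
      refine integral_congr_ae ?_
      filter_upwards [h] with x hx
      rw [← hx]
      ring
    rw [e1, e2, integral_add i1 i2, integral_add i3 i2, integral_const_mul, integral_const_mul,
      isWeakDeriv_of_lipAt hu φ h1 h2]
    ring
  refine ⟨fun i j => ?_, fun φ h1 h2 => ⟨?_, ?_⟩⟩
  · refine Continuous.locallyIntegrable ((hV i j).mul ?_)
    fin_cases j
    · exact ca
    · exact cb
  · exact key hb (((hV 0 1).mul cb).add (((hV 0 0).add continuous_const).mul ca)) h₀ φ h1 h2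
  · exact key ha (((hV 1 0).mul ca).add (((hV 1 1).sub continuous_const).mul cb)) h₁ φ h1 h2

section

variable {m : ℝ} {V : ℝ → Matrix (Fin 2) (Fin 2) ℂ} {N : ℕ} {f : ℝ → ℝ} {μ ε ν : Side → ℝ}
  {ε₁ η e C c d lam C₀ : ℝ} {χ : ℝ → ℝ}

lemma AssumptionA.continuous_entry (hA : AssumptionA V N f μ ε ν) (hN : 1 ≤ N) (i j : Fin 2) :
    Continuous fun x => V x i j := by
  by_cases hij : i = j
  · subst hij
    exact hA.diag_continuous i
  · exact hA.off_continuous hN i j hij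

/-- A qualitative bound, with a constant depending on λ; it serves only to obtain square
integrability. -/
lemma IsCutoff.exists_deriv_bound (h : IsCutoff m V f ν ε₁ η C₀ lam χ)
    (hr : RadiusGE m V f ν ε₁ η 2 lam) : ∃ K, 0 ≤ K ∧ ∀ x,
      |χ x| ≤ 1 ∧ |deriv χ x| ≤ K ∧ |iteratedDeriv 2 χ x| ≤ K := by
  set r := |radius m V f ν ε₁ η .minus lam| + |radius m V f ν ε₁ η .plus lam|
  have key {j : ℕ} (hj : j = 1 ∨ j = 2) (x : ℝ) :
      |iteratedDeriv j χ x| ≤ |C₀| * r + |C₀| * r ^ 2 := by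
    by_cases hx : iteratedDeriv j χ x = 0
    · rw [hx, abs_zero]
      positivity
    · obtain ⟨s, -, -, -, hs⟩ := h.exists_side_of_deriv_ne hr hj hx
      have hrs : |radius m V f ν ε₁ η s lam| ≤ r := by
        cases s
        · exact le_add_of_nonneg_right (abs_nonneg _)
        · exact le_add_of_nonneg_left (abs_nonneg _)
      have h1 : |iteratedDeriv j χ x| ≤ |C₀| * r ^ j := by
        refine hs.trans ((le_abs_self _).trans ?_)
        rw [abs_mul, abs_pow]
        gcongr
      rcases hj with rfl | rfl
      · rw [pow_one] at h1
        exact h1.trans (le_add_of_nonneg_right (by positivity))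
      · exact h1.trans (le_add_of_nonneg_left (by positivity))
  refine ⟨|C₀| * r + |C₀| * r ^ 2, by positivity, fun x => ⟨?_, ?_, key (Or.inr rfl) x⟩⟩
  · rw [abs_of_nonneg (h.mem_Icc x).1]
    exact (h.mem_Icc x).2
  · rw [← iteratedDeriv_one]
    exact key (Or.inl rfl) x

variable (hR : Regime m V N f ν ε₁ η e C c d lam) (hA : AssumptionA V N f μ ε ν) (hN : 1 ≤ N)
  (hχ : IsCutoff m V f ν ε₁ η C₀ lam χ)

include hR in
lemma Regime.one_le_rho {x : ℝ} (hx : x ∈ core m V f ν ε₁ η lam) : 1 ≤ 2 * rho m V lam x := by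
  have h1 := (hR.near x (hR.sub hx)).norm_right'
  have h2 := hR.one_le
  unfold rho
  linarith

include hR in
lemma Regime.const_nonneg : 0 ≤ C := by
  have h1 := hR.upper 0 zero_mem_core
  by_contra hcon
  have := mul_neg_of_neg_of_pos (not_le.1 hcon) (Real.exp_pos (-d * bigF V 0))
  linarith [norm_nonneg (k₁ V 0 * exp (-phase m V N lam 0))]

include hR in
-- The denominator λ + m - V₂₂ has modulus ρ and cancels the factor ρ that all estimates of the
-- regime carry.
lemma Regime.norm_resTerm_le {g : ℝ → ℂ} {K x : ℝ} (hx : x ∈ core m V f ν ε₁ η lam)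
    (hg : ‖g x‖ ≤ K * rho m V lam x) :
    ‖resTerm m V N lam g x‖ ≤ K * ‖k₁ V x * exp (-phase m V N lam x)‖ := by
  have hr := rho_pos (hR.near x (hR.sub hx))
  rw [resTerm, norm_mul, norm_mul, norm_inv]
  change _ * (rho m V lam x)⁻¹ * _ ≤ _
  calc _ ≤ ‖k₁ V x * exp (-phase m V N lam x)‖ * (rho m V lam x)⁻¹ * (K * rho m V lam x) := by
        gcongr
    _ = _ := by field_simp

include hR hA hN in
lemma Regime.memLp_resTerm {g : ℝ → ℂ} {K : ℝ} (hd : 0 < d) (hg : AEStronglyMeasurable g volume)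
    (hK : 0 ≤ K) (hgK : ∀ᵐ x, x ∈ core m V f ν ε₁ η lam → ‖g x‖ ≤ K * rho m V lam x)
    (hg0 : ∀ x, x ∉ core m V f ν ε₁ η lam → g x = 0) :
    MemLp (resTerm m V N lam g) 2 volume := by
  have hcont : ContinuousOn (fun x => k₁ V x * exp (-phase m V N lam x) * (zTwo m V lam x)⁻¹)
      (core m V f ν ε₁ η lam) := by
    intro x hx
    have hJ := hR.sub hx
    exact ((((hasDerivAt_k₁ (hA.continuous_entry hN 1 0) x).continuousAt.mul
      (hasDerivAt_exp_phase hR hJ).continuousAt).mul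
        ((hA.lipAt_zTwo lam x).continuousAt.inv₀ (hR.near x hJ).right_ne))).continuousWithinAt
  -- The coefficient is known to be continuous only on the core; extension by zero changes nothing
  -- because g vanishes outside.
  have hmeas : AEStronglyMeasurable (resTerm m V N lam g) volume := by
    have h1 := (hcont.aestronglyMeasurable isClosed_core.measurableSet (μ := volume))
    have h2 := ((aestronglyMeasurable_indicator_iff isClosed_core.measurableSet).2 h1).mul hg
    refine h2.congr (ae_of_all _ fun x => ?_)
    by_cases hx : x ∈ core m V f ν ε₁ η lam
    · simp [resTerm, hx]
    · simp [resTerm, hg0 x hx]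
  refine (hA.memLp_exp_bigF hd).of_le_mul (c := K * C) hmeas ?_
  filter_upwards [hgK] with x hx
  rw [Real.norm_of_nonneg (Real.exp_pos _).le]
  by_cases hxc : x ∈ core m V f ν ε₁ η lam
  · refine (hR.norm_resTerm_le hxc (hx hxc)).trans ?_
    rw [mul_assoc]
    exact mul_le_mul_of_nonneg_left (hR.upper x hxc) hK
  · have := hR.const_nonneg
    rw [resTerm, hg0 x hxc, mul_zero, norm_zero]
    positivity

include hR hA hN hχ in
lemma Regime.memLp_compOne (hd : 0 < d) : MemLp (compOne m V N lam χ) 2 volume := by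
  refine (hA.memLp_exp_bigF hd).of_le_mul (c := C)
    (continuous_of_lipAt (hR.lipAt_compOne hA hN hχ)).aestronglyMeasurable (ae_of_all _ fun x => ?_)
  rw [Real.norm_of_nonneg (Real.exp_pos _).le]
  have hC := hR.const_nonneg
  by_cases hxc : x ∈ core m V f ν ε₁ η lam
  · rw [compOne, norm_mul]
    refine (mul_le_of_le_one_right (norm_nonneg _) ?_).trans (hR.upper x hxc)
    rw [norm_real, Real.norm_of_nonneg (hχ.mem_Icc x).1]
    exact (hχ.mem_Icc x).2
  · rw [compOne, (hχ.eq_zero_of_notMem hxc).1, ofReal_zero, mul_zero, norm_zero]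
    positivity

include hR in
-- The derivative of any function on the line is measurable, whereas `dPhase` is controlled only on
-- `dom`. The two may be interchanged against a factor supported in the core.
lemma Regime.deriv_phase_mul (h : ℂ → ℂ) (x : ℝ) {g : ℂ}
    (hg : x ∉ core m V f ν ε₁ η lam → g = 0) :
    h (deriv (phase m V N lam) x) * g = h (dPhase m V N lam x) * g := by
  by_cases hx : x ∈ core m V f ν ε₁ η lam
  · rw [(hR.hasDerivAt x (hR.sub hx)).deriv]
  · rw [hg hx, mul_zero, mul_zero]

include hR hA hN hχ in
lemma Regime.memLp_compTwo (hd : 0 < d) : MemLp (compTwo m V N lam χ) 2 volume := by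
  obtain ⟨K, hK, hb⟩ := hχ.exists_deriv_bound hR.radius_ge
  have heq : compTwo m V N lam χ = fun x => -I * resTerm m V N lam
      (fun x => ((deriv χ x : ℝ) : ℂ) - deriv (phase m V N lam) x * χ x) x := by
    funext x
    have := hR.deriv_phase_mul id x (g := (χ x : ℂ))
      (fun hx => by rw [(hχ.eq_zero_of_notMem hx).1, ofReal_zero])
    simp only [id] at this
    simp only [compTwo, duFun, resTerm, this]
    ring
  rw [heq]
  refine (hR.memLp_resTerm hA hN hd (K := 2 * K + C) ?_ ?_ ?_ ?_).const_mul (-I)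
  · exact hχ.continuous_deriv.aestronglyMeasurable.sub
      ((measurable_deriv _).aestronglyMeasurable.mul
        (continuous_ofReal.comp hχ.smooth.continuous).aestronglyMeasurable)
  · have := hR.const_nonneg
    positivity
  · filter_upwards [hR.dPhase_le] with x hx hxc
    rw [(hR.hasDerivAt x (hR.sub hxc)).deriv]
    refine (norm_sub_le _ _).trans ?_
    rw [norm_mul, norm_real, norm_real, add_mul]
    have h1 := hb x
    refine add_le_add ?_ ?_
    · have := mul_le_mul_of_nonneg_left (hR.one_le_rho hxc) hK
      rw [Real.norm_eq_abs]
      linarith [h1.2.1]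
    · exact (mul_le_of_le_one_right (norm_nonneg _) h1.1).trans (hx hxc)
  · intro x hx
    obtain ⟨h0, h1, -⟩ := hχ.eq_zero_of_notMem hx
    simp [h0, h1]

lemma AssumptionA.measurable_logDeriv_Klam (hA : AssumptionA V N f μ ε ν) (hN : 1 ≤ N) :
    Measurable fun x => deriv (Klam m V lam) x / Klam m V lam x := by
  refine (measurable_deriv _).div ?_
  have h1 : Measurable (k₁ V) := (continuous_iff_continuousAt.2 fun x =>
    (hasDerivAt_k₁ (hA.continuous_entry hN 1 0) x).continuousAt).measurable
  have h2 : Measurable (k₂ V) := (continuous_iff_continuousAt.2 fun x =>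
    (hasDerivAt_k₂ (hA.continuous_entry hN 0 1) x).continuousAt).measurable
  have h3 := (hA.continuous_entry hN 1 1).measurable
  exact (h1.div h2).mul (measurable_const.div (measurable_const.sub h3))

/-- The second coefficient in the numerator of `kappa`. -/
def kappaTwo (m : ℝ) (V : ℝ → Matrix (Fin 2) (Fin 2) ℂ) (N : ℕ) (lam : ℝ) (χ : ℝ → ℝ) (x : ℝ) :
    ℂ :=
  (2 * deriv (phase m V N lam) x - deriv (Klam m V lam) x / Klam m V lam x) *
    ((deriv χ x : ℝ) : ℂ)

include hR hA hN in
lemma Regime.kappaTwo_eq {x : ℝ} (hx : x ∈ core m V f ν ε₁ η lam) :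
    kappaTwo m V N lam χ x =
      (2 * dPhase m V N lam x - logK m V lam x) * ((deriv χ x : ℝ) : ℂ) := by
  have hJ := hR.sub hx
  rw [kappaTwo, (hR.hasDerivAt x hJ).deriv, hA.deriv_Klam_div hN (hR.near x hJ).right_ne]

include hR hA hN in
lemma Regime.kappaTwo_le : ∀ᵐ x, x ∈ core m V f ν ε₁ η lam →
    ‖kappaTwo m V N lam χ x‖ ≤ 3 * C * rho m V lam x * |deriv χ x| := by
  filter_upwards [hR.dPhase_le, hR.logK_le] with x h1 h2 hx
  rw [hR.kappaTwo_eq hA hN hx, norm_mul, norm_real, Real.norm_eq_abs]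
  refine mul_le_mul_of_nonneg_right ?_ (abs_nonneg _)
  refine (norm_sub_le _ _).trans ?_
  rw [norm_mul, Complex.norm_ofNat]
  linarith [h1 hx, h2 hx]

include hχ in
lemma IsCutoff.kappaTwo_eq_zero {x : ℝ} (hx : x ∉ core m V f ν ε₁ η lam) :
    kappaTwo m V N lam χ x = 0 := by
  rw [kappaTwo, (hχ.eq_zero_of_notMem hx).2.1, ofReal_zero, mul_zero]

include hR hA hN hχ in
lemma Regime.memLp_kappaOne (hd : 0 < d) :
    MemLp (resTerm m V N lam fun x => ((iteratedDeriv 2 χ x : ℝ) : ℂ)) 2 volume := by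
  obtain ⟨K, hK, hb⟩ := hχ.exists_deriv_bound hR.radius_ge
  refine hR.memLp_resTerm hA hN hd (K := 2 * K)
    hχ.continuous_iteratedDeriv_two.aestronglyMeasurable (by positivity)
    (ae_of_all _ fun x hx => ?_) fun x hx => by simp [(hχ.eq_zero_of_notMem hx).2.2]
  have := mul_le_mul_of_nonneg_left (hR.one_le_rho hx) hK
  rw [norm_real, Real.norm_eq_abs]
  linarith [(hb x).2.2]

include hR hA hN hχ in
lemma Regime.memLp_kappaTwo (hd : 0 < d) :
    MemLp (resTerm m V N lam (kappaTwo m V N lam χ)) 2 volume := by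
  obtain ⟨K, hK, hb⟩ := hχ.exists_deriv_bound hR.radius_ge
  have hC := hR.const_nonneg
  refine hR.memLp_resTerm hA hN hd (K := 3 * C * K) ?_ (by positivity) ?_ fun x hx =>
    hχ.kappaTwo_eq_zero hx
  · exact (((measurable_deriv _).const_mul 2).sub
      (hA.measurable_logDeriv_Klam hN)).aestronglyMeasurable.mul
        hχ.continuous_deriv.aestronglyMeasurable
  · filter_upwards [hR.kappaTwo_le (χ := χ) hA hN] with x hx hxc
    refine (hx hxc).trans ?_
    rw [mul_right_comm]
    have hr : 0 ≤ rho m V lam x := norm_nonneg _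
    exact mul_le_mul_of_nonneg_right (mul_le_mul_of_nonneg_left (hb x).2.1 (by positivity)) hr

include hR hA hN hχ in
/-- The WKB remainder. -/
lemma Regime.memLp_remainder (hd : 0 < d) :
    MemLp (resTerm m V N lam fun x => remainder m V N lam x * χ x) 2 volume ∧
    normL2 (resTerm m V N lam fun x => remainder m V N lam x * χ x) ≤
      C * (rate ν ε₁ N .minus lam + rate ν ε₁ N .plus lam) * normL2 (compOne m V N lam χ) := by
  have hC := hR.const_nonneg
  set r := rate ν ε₁ N .minus lam + rate ν ε₁ N .plus lam
  have hr : 0 ≤ r := add_nonneg (rate_nonneg _ _ _ _ _) (rate_nonneg _ _ _ _ _)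
  have hb : ∀ᵐ x, ‖resTerm m V N lam (fun x => remainder m V N lam x * χ x) x‖ ≤
      C * r * ‖compOne m V N lam χ x‖ := by
    filter_upwards [hR.remainder_le] with x hx
    by_cases hxc : x ∈ core m V f ν ε₁ η lam
    · have := hR.norm_resTerm_le (g := fun x => remainder m V N lam x * χ x) (K := C * r * ‖(χ x : ℂ)‖)
        hxc (by
          rw [norm_mul, mul_right_comm]
          exact mul_le_mul_of_nonneg_right (hx hxc) (norm_nonneg _))
      refine this.trans (le_of_eq ?_)
      rw [compOne, norm_mul _ (χ x : ℂ)]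
      ring
    · simp only [resTerm, (hχ.eq_zero_of_notMem hxc).1, ofReal_zero, mul_zero, norm_zero]
      positivity
  have hmem := hR.memLp_compOne hA hN hχ hd
  refine ⟨?_, normL2_le_mul (by positivity) hmem hb⟩
  refine hmem.of_le_mul ?_ hb
  have hc1 := (hR.memLp_kappaOne hA hN hχ hd).1
  have hc2 := (hR.memLp_kappaTwo hA hN hχ hd).1
  have c1 := continuous_of_lipAt (hR.lipAt_compOne hA hN hχ)
  have c2 := continuous_of_lipAt (hR.lipAt_compTwo hA hN hχ)
  -- Measurability of the remainder term is read off the residual equation, in which every other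
  -- term is measurable.
  have h1 : AEStronglyMeasurable (fun x => -I * deriv (compTwo m V N lam χ) x +
      (V x 0 1 * compTwo m V N lam χ x + (V x 0 0 + m) * compOne m V N lam χ x)
        - lam * compOne m V N lam χ x) volume :=
    (((measurable_deriv _).const_mul (-I)).aestronglyMeasurable.add
      (((hA.continuous_entry hN 0 1).mul c2).add
        (((hA.continuous_entry hN 0 0).add continuous_const).mul c1)).aestronglyMeasurable).sub
      (continuous_const.mul c1).aestronglyMeasurable
  refine ((h1.neg.sub hc1).add hc2).congr ?_
  filter_upwards [hR.deriv_compTwo hA hN hχ] with x hx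
  have h2 : resTerm m V N lam (kappaTwo m V N lam χ) x = resTerm m V N lam
      (fun x => (2 * dPhase m V N lam x - logK m V lam x) * ((deriv χ x : ℝ) : ℂ)) x := by
    by_cases hxc : x ∈ core m V f ν ε₁ η lam
    · rw [resTerm, hR.kappaTwo_eq hA hN hxc, resTerm]
    · simp [resTerm, hχ.kappaTwo_eq_zero hxc, (hχ.eq_zero_of_notMem hxc).2.1]
  simp only [Pi.add_apply, Pi.sub_apply, Pi.neg_apply, hx, h2]
  ring

end

end DiracWKB

end

/-! ### Membership in the operator domain and the residual estimate -/

noncomputable section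

namespace DiracWKB

lemma exists_domain_of_isDiracImage {m : ℝ} {V : ℝ → Matrix (Fin 2) (Fin 2) ℂ} {p q : Hilb}
    (h : IsDiracImage m V p q) :
    ∃ Ψ : (diracOp m V).domain, (Ψ : Hilb) = p ∧ diracOp m V Ψ = q := by
  have hmem : (p, q) ∈ (diracOp m V).graph := by
    rw [diracOp, Submodule.toLinearPMap_graph_eq _ (diracGraph_single_valued m V)]
    exact h
  exact ((diracOp m V).mem_graph_iff).1 hmem

section

variable {m : ℝ} {V : ℝ → Matrix (Fin 2) (Fin 2) ℂ} {N : ℕ} {f : ℝ → ℝ} {μ ε ν : Side → ℝ}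
  {ε₁ η e C c d lam C₀ : ℝ} {χ : ℝ → ℝ}

variable (hR : Regime m V N f ν ε₁ η e C c d lam) (hA : AssumptionA V N f μ ε ν) (hN : 1 ≤ N)
  (hχ : IsCutoff m V f ν ε₁ η C₀ lam χ)

include hR hA hN hχ in
-- Since every cut-off radius is at least 2, the cut-off equals 1 on [0, 1], and the exponential is
-- at least c on this interval of length 1.
lemma Regime.le_normL2_compOne (hc : 0 < c) (hd : 0 < d) : c ≤ normL2 (compOne m V N lam χ) := by
  have hmem := hR.memLp_compOne hA hN hχ hd
  have h1 : eLpNorm ((Set.Icc (0 : ℝ) 1).indicator fun _ => c) 2 volume ≤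
      eLpNorm (compOne m V N lam χ) 2 volume := by
    refine eLpNorm_mono fun x => ?_
    by_cases hx : x ∈ Set.Icc (0 : ℝ) 1
    · have hone : χ x = 1 := hχ.eq_one_of_lt hR.radius_ge fun s hs => by
        have hi := hR.radius_ge.inv_mem hs
        have h2 := (hR.radius_ge s hs).1
        have h3 : s.sgn * x ≤ 1 := by
          cases s <;> simp only [Side.sgn] <;> linarith [hx.1, hx.2]
        linarith
      have hxc : x ∈ core m V f ν ε₁ η lam := by
        by_contra hcon
        rw [(hχ.eq_zero_of_notMem hcon).1] at hone
        exact zero_ne_one hone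
      rw [Set.indicator_of_mem hx, Real.norm_of_nonneg hc.le, compOne, hone, ofReal_one, mul_one]
      exact hR.lower x hxc hx
    · simp [Set.indicator_of_notMem hx]
  have h2 := ENNReal.toReal_mono hmem.2.ne h1
  rw [eLpNorm_indicator_const measurableSet_Icc two_ne_zero (by simp)] at h2
  rw [normL2]
  simpa [Real.enorm_of_nonneg hc.le, hc.le] using h2

include hR hχ in
lemma Regime.kappa_eq : kappa m V N lam χ =
    (normL2 (resTerm m V N lam fun x => ((iteratedDeriv 2 χ x : ℝ) : ℂ)) +
      normL2 (resTerm m V N lam (kappaTwo m V N lam χ))) /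
      √(normL2 (compOne m V N lam χ) ^ 2 + normL2 (compTwo m V N lam χ) ^ 2) := by
  have hu : (fun y => exp (-phase m V N lam y) * (χ y : ℂ)) = uFun m V N lam χ := by
    funext y
    rw [uFun, mul_comm]
  rw [kappa, hu]
  congr 2
  · congr 1
    funext x
    rw [resTerm, kappaTwo, zTwo]
    ring
  · congr 3
    funext x
    rw [(hR.hasDerivAt_uFun hχ x).deriv, compTwo, zTwo]
    ring

include hR hA hN hχ in
/-- The pseudomode belongs to the domain, with a control of the residual. -/
theorem Regime.exists_domain (hc : 0 < c) (hd : 0 < d) : ∃ Ψ : (diracOp m V).domain,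
    ((Ψ : Hilb) : ℝ → Spinor) =ᵐ[volume] pseudomode m V N lam χ ∧ (Ψ : Hilb) ≠ 0 ∧
    ‖diracOp m V Ψ - (lam : ℂ) • (Ψ : Hilb)‖ / ‖(Ψ : Hilb)‖ ≤
      kappa m V N lam χ + C * (rate ν ε₁ N .minus lam + rate ν ε₁ N .plus lam) := by
  have m1 := hR.memLp_compOne hA hN hχ hd
  have m2 := hR.memLp_compTwo hA hN hχ hd
  have k1 := hR.memLp_kappaOne hA hN hχ hd
  have k2 := hR.memLp_kappaTwo hA hN hχ hd
  obtain ⟨k3, hk3⟩ := hR.memLp_remainder hA hN hχ hd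
  set T₁ := resTerm m V N lam fun x => ((iteratedDeriv 2 χ x : ℝ) : ℂ) with hT₁
  set T₂ := resTerm m V N lam (kappaTwo m V N lam χ) with hT₂
  set T₃ := resTerm m V N lam fun x => remainder m V N lam x * χ x with hT₃
  set R : ℝ → ℂ := fun x => (T₁ x - T₂ x) + T₃ x with hRdef
  have mR : MemLp R 2 volume := (k1.sub k2).add k3
  have hrow : ∀ᵐ x, -I * deriv (compTwo m V N lam χ) x +
      (V x 0 1 * compTwo m V N lam χ x + (V x 0 0 + m) * compOne m V N lam χ x) =
        lam * compOne m V N lam χ x - R x := by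
    filter_upwards [hR.deriv_compTwo hA hN hχ] with x hx
    have h2 : T₂ x = resTerm m V N lam
        (fun x => (2 * dPhase m V N lam x - logK m V lam x) * ((deriv χ x : ℝ) : ℂ)) x := by
      by_cases hxc : x ∈ core m V f ν ε₁ η lam
      · rw [hT₂, resTerm, hR.kappaTwo_eq hA hN hxc, resTerm]
      · simp [hT₂, resTerm, hχ.kappaTwo_eq_zero hxc, (hχ.eq_zero_of_notMem hxc).2.1]
    simp only [hRdef, h2]
    linear_combination hx
  have himg := isDiracImage_of_lipAt (hA.continuous_entry hN) (hR.lipAt_compOne hA hN hχ)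
    (hR.lipAt_compTwo hA hN hχ) hrow (ae_of_all _ (hR.deriv_compOne hA hN hχ))
  have mg := memLp_spinor ((m1.const_mul (lam : ℂ)).sub mR) (m2.const_mul (lam : ℂ))
  have mp := memLp_spinor m1 m2
  obtain ⟨Ψ, hΨ, hH⟩ := exists_domain_of_isDiracImage (p := mp.toLp _) (q := mg.toLp _)
    (himg.congr mp.coeFn_toLp.symm mg.coeFn_toLp.symm)
  have hnorm : ‖(Ψ : Hilb)‖ =
      √(normL2 (compOne m V N lam χ) ^ 2 + normL2 (compTwo m V N lam χ) ^ 2) := by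
    rw [hΨ, Lp.norm_toLp, toReal_eLpNorm_spinor m1 m2]
  have hle : normL2 (compOne m V N lam χ) ≤ ‖(Ψ : Hilb)‖ := by
    rw [hnorm]
    exact Real.le_sqrt_of_sq_le (le_add_of_nonneg_right (sq_nonneg _))
  have hpos : 0 < ‖(Ψ : Hilb)‖ := hc.trans_le ((hR.le_normL2_compOne hA hN hχ hc hd).trans hle)
  refine ⟨Ψ, ?_, norm_pos_iff.1 hpos, ?_⟩
  · rw [hΨ, hR.pseudomode_eq hχ]
    exact mp.coeFn_toLp
  · have m0 : MemLp (fun _ : ℝ => (0 : ℂ)) 2 volume := MemLp.zero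
    have hres : diracOp m V Ψ - (lam : ℂ) • (Ψ : Hilb) =
        (memLp_spinor mR.neg m0).toLp _ := by
      rw [hH, hΨ]
      refine Lp.ext ?_
      filter_upwards [Lp.coeFn_sub (mg.toLp _) ((lam : ℂ) • mp.toLp _),
        Lp.coeFn_smul (lam : ℂ) (mp.toLp _), mg.coeFn_toLp, mp.coeFn_toLp,
        (memLp_spinor mR.neg m0).coeFn_toLp] with x h1 h2 h3 h4 h5
      rw [h1, Pi.sub_apply, h2, Pi.smul_apply, h3, h4, h5]
      ext i
      fin_cases i <;> simp
    have hnr : ‖diracOp m V Ψ - (lam : ℂ) • (Ψ : Hilb)‖ = normL2 R := by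
      rw [hres, Lp.norm_toLp, toReal_eLpNorm_spinor mR.neg m0]
      have h0 : normL2 (fun _ : ℝ => (0 : ℂ)) = 0 := by simp [normL2]
      have hn : normL2 (-R) = normL2 R := by rw [normL2, normL2, eLpNorm_neg]
      rw [h0, hn]
      simp [Real.sqrt_sq (normL2_nonneg R)]
    have hC := hR.const_nonneg
    have hr : 0 ≤ rate ν ε₁ N .minus lam + rate ν ε₁ N .plus lam :=
      add_nonneg (rate_nonneg _ _ _ _ _) (rate_nonneg _ _ _ _ _)
    rw [hR.kappa_eq hχ, ← hnorm, hnr, div_add' _ _ _ hpos.ne']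
    refine div_le_div_of_nonneg_right ?_ hpos.le
    calc normL2 R ≤ normL2 (fun x => T₁ x - T₂ x) + normL2 T₃ := normL2_add_le (k1.sub k2) k3
      _ ≤ (normL2 T₁ + normL2 T₂) + _ := add_le_add (normL2_sub_le k1 k2) hk3
      _ ≤ _ := by
        gcongr

end

end DiracWKB

end

noncomputable section

namespace DiracWKB

/-! ### The contribution of the cut-off -/

lemma sq_mul_exp_le {b r : ℝ} (hb : 0 < b) (hr : 0 ≤ r) :
    r ^ 2 * Real.exp (-(b * r)) ≤ 2 / b ^ 2 := by
  have h := Real.quadratic_le_exp_of_nonneg (mul_nonneg hb.le hr)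
  rw [Real.exp_neg, ← div_eq_mul_inv, div_le_div_iff₀ (Real.exp_pos _) (by positivity)]
  have := mul_nonneg hb.le hr
  nlinarith

lemma kappa_nonneg (m : ℝ) (V : ℝ → Matrix (Fin 2) (Fin 2) ℂ) (N : ℕ) (lam : ℝ) (χ : ℝ → ℝ) :
    0 ≤ kappa m V N lam χ :=
  div_nonneg (add_nonneg (normL2_nonneg _) (normL2_nonneg _)) (Real.sqrt_nonneg _)

section

variable {m : ℝ} {V : ℝ → Matrix (Fin 2) (Fin 2) ℂ} {N : ℕ} {f : ℝ → ℝ} {μ ε ν : Side → ℝ}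
  {ε₁ η e C c d lam C₀ : ℝ} {χ : ℝ → ℝ}

lemma kappaBound_eq {d₁ d₂ : ℝ} {s : Side} (hs : ¬ NoCut V ν s) :
    kappaBound m V f ν ε₁ η d₁ d₂ s lam =
      Real.exp (-d₁ * bigF V (s.sgn * (d₂ * radius m V f ν ε₁ η s lam))) := if_neg hs

lemma kappaBound_nonneg (d₁ d₂ : ℝ) (s : Side) : 0 ≤ kappaBound m V f ν ε₁ η d₁ d₂ s lam := by
  unfold kappaBound
  split_ifs <;> positivity

/-- The square of the radius is absorbed by the exponential. -/
lemma AssumptionA.exists_absorb (hA : AssumptionA V N f μ ε ν) (hd : 0 < d) :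
    ∃ M > 0, ∀ (s : Side) (r : ℝ), 0 ≤ r →
      r ^ 2 * Real.exp (-d * bigF V (s.sgn * (1 / 2 * r))) ≤
        M * Real.exp (-(d / 2) * bigF V (s.sgn * (1 / 2 * r))) := by
  obtain ⟨c₀, hc₀, C₁, hC₁, hF⟩ := hA.exists_bigF_lower
  -- Half of the exponent is sacrificed: F(± r/2) ≥ c₀ r/2 - C₁ makes e^{-dF/2} at most e^{-d c₀
  -- r/4} up to a constant, which absorbs r². The other half is the decay that remains.
  refine ⟨2 / (d * c₀ / 4) ^ 2 * Real.exp (d / 2 * C₁), by positivity, fun s r hr => ?_⟩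
  have h1 := hF (s.sgn * (1 / 2 * r))
  rw [abs_mul, s.abs_sgn, one_mul, abs_of_nonneg (by positivity)] at h1
  set F := bigF V (s.sgn * (1 / 2 * r))
  have h2 : Real.exp (-d * F) ≤
      Real.exp (-(d * c₀ / 4 * r)) * Real.exp (d / 2 * C₁) * Real.exp (-(d / 2) * F) := by
    rw [← Real.exp_add, ← Real.exp_add, Real.exp_le_exp]
    nlinarith
  calc r ^ 2 * Real.exp (-d * F)
      ≤ r ^ 2 * (Real.exp (-(d * c₀ / 4 * r)) * Real.exp (d / 2 * C₁) *
          Real.exp (-(d / 2) * F)) := by gcongr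
    _ = (r ^ 2 * Real.exp (-(d * c₀ / 4 * r))) * Real.exp (d / 2 * C₁) *
          Real.exp (-(d / 2) * F) := by ring
    _ ≤ _ := by
      gcongr
      exact sq_mul_exp_le (by positivity) hr

open Classical in
/-- The transition region of a cut-off at the end `s`. -/
def transition (m : ℝ) (V : ℝ → Matrix (Fin 2) (Fin 2) ℂ) (f : ℝ → ℝ) (ν : Side → ℝ) (ε₁ η : ℝ)
    (lam : ℝ) (s : Side) : Set ℝ :=
  if NoCut V ν s then ∅ else (fun x => s.sgn * x) ⁻¹'
    Set.Icc (radius m V f ν ε₁ η s lam - (radius m V f ν ε₁ η s lam)⁻¹) (radius m V f ν ε₁ η s lam)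

lemma measurableSet_transition (s : Side) :
    MeasurableSet (transition m V f ν ε₁ η lam s) := by
  unfold transition
  split_ifs
  · exact MeasurableSet.empty
  · exact measurableSet_Icc.preimage (measurable_const_mul _)

lemma volume_transition_le (hr : RadiusGE m V f ν ε₁ η 2 lam) (s : Side) :
    volume (transition m V f ν ε₁ η lam s) ≤ 1 := by
  unfold transition
  split_ifs with hs
  · simp
  · have hs0 : s.sgn ≠ 0 := by cases s <;> simp [Side.sgn]
    rw [Real.volume_preimage_mul_left hs0, abs_inv, s.abs_sgn, Real.volume_Icc, sub_sub_cancel,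
      inv_one, ENNReal.ofReal_one, one_mul, ENNReal.ofReal_le_one]
    linarith [(hr.inv_mem hs).2]

variable (hR : Regime m V N f ν ε₁ η e C c d lam) (hA : AssumptionA V N f μ ε ν) (hN : 1 ≤ N)
  (hχ : IsCutoff m V f ν ε₁ η C₀ lam χ)

include hR hχ in
/-- The size of the terms that contain derivatives of the cut-off. -/
lemma Regime.exp_mul_deriv_le {a M : ℝ} (hd : 0 < d)
    (hmono : ∀ (s : Side) (x y : ℝ), a ≤ x → x ≤ y → bigF V (s.sgn * x) ≤ bigF V (s.sgn * y))
    (ha : RadiusGE m V f ν ε₁ η (2 * a) lam)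
    (hM : ∀ (s : Side) (r : ℝ), 0 ≤ r → r ^ 2 * Real.exp (-d * bigF V (s.sgn * (1 / 2 * r))) ≤
        M * Real.exp (-(d / 2) * bigF V (s.sgn * (1 / 2 * r)))) {j : ℕ} (hj : j = 1 ∨ j = 2) {x : ℝ}
    (hx : iteratedDeriv j χ x ≠ 0) :
    x ∈ transition m V f ν ε₁ η lam .minus ∪ transition m V f ν ε₁ η lam .plus ∧
    (x ∈ core m V f ν ε₁ η lam →
      ‖k₁ V x * exp (-phase m V N lam x)‖ * |iteratedDeriv j χ x| ≤
        C * |C₀| * M * (kappaBound m V f ν ε₁ η (d / 2) (1 / 2) .minus lam +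
          kappaBound m V f ν ε₁ η (d / 2) (1 / 2) .plus lam)) := by
  obtain ⟨s, hs, h1, h2, h3⟩ := hχ.exists_side_of_deriv_ne hR.radius_ge hj hx
  have hC := hR.const_nonneg
  set r := radius m V f ν ε₁ η s lam with hr
  have hr2 : 2 ≤ r := (hR.radius_ge s hs).1
  have hra : 2 * a ≤ r := (ha s hs).1
  have hri := (hR.radius_ge.inv_mem hs).2
  constructor
  · have hmem : x ∈ transition m V f ν ε₁ η lam s := by
      rw [transition, if_neg hs]
      exact ⟨h1, h2⟩
    cases s
    · exact Or.inl hmem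
    · exact Or.inr hmem
  · intro hxc
    -- In the transition region ± x ≥ r - 1/r ≥ r/2, and F is monotone beyond a, so F(x) ≥ F(± r/2).
    -- Hence the factor 1/2 inside F in the final bound.
    have hF := hmono s (1 / 2 * r) (s.sgn * x) (by linarith) (by linarith)
    rw [s.sgn_mul_sgn_mul] at hF
    have hrj : r ^ j ≤ r ^ 2 := pow_le_pow_right₀ (by linarith) (by omega)
    have hk : Real.exp (-(d / 2) * bigF V (s.sgn * (1 / 2 * r))) ≤
        kappaBound m V f ν ε₁ η (d / 2) (1 / 2) .minus lam +
          kappaBound m V f ν ε₁ η (d / 2) (1 / 2) .plus lam := by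
      have := kappaBound_eq (m := m) (f := f) (ε₁ := ε₁) (η := η) (lam := lam) (d₁ := d / 2)
        (d₂ := 1 / 2) hs
      rw [← this]
      cases s
      · exact le_add_of_nonneg_right (kappaBound_nonneg _ _ _)
      · exact le_add_of_nonneg_left (kappaBound_nonneg _ _ _)
    have hM0 : 0 ≤ M := by
      have h0 := (mul_nonneg (sq_nonneg (1 : ℝ)) (Real.exp_pos _).le).trans (hM s 1 zero_le_one)
      exact nonneg_of_mul_nonneg_left h0 (Real.exp_pos _)
    calc ‖k₁ V x * exp (-phase m V N lam x)‖ * |iteratedDeriv j χ x|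
        ≤ (C * Real.exp (-d * bigF V x)) * (|C₀| * r ^ 2) := by
          refine mul_le_mul (hR.upper x hxc) (h3.trans ?_) (abs_nonneg _) (by positivity)
          exact mul_le_mul (le_abs_self _) hrj (by positivity) (abs_nonneg _)
      _ ≤ (C * Real.exp (-d * bigF V (s.sgn * (1 / 2 * r)))) * (|C₀| * r ^ 2) := by
          have : Real.exp (-d * bigF V x) ≤ Real.exp (-d * bigF V (s.sgn * (1 / 2 * r))) := by
            rw [Real.exp_le_exp]
            nlinarith
          gcongr
      _ = C * |C₀| * (r ^ 2 * Real.exp (-d * bigF V (s.sgn * (1 / 2 * r)))) := by ring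
      _ ≤ C * |C₀| * (M * Real.exp (-(d / 2) * bigF V (s.sgn * (1 / 2 * r)))) :=
          mul_le_mul_of_nonneg_left (hM s r (by linarith)) (by positivity)
      _ ≤ C * |C₀| * (M * (kappaBound m V f ν ε₁ η (d / 2) (1 / 2) .minus lam +
            kappaBound m V f ν ε₁ η (d / 2) (1 / 2) .plus lam)) := by gcongr
      _ = _ := by ring

include hR hA hN hχ in
-- Each numerator is bounded pointwise and supported in the transition regions, whose total length
-- is at most 2 ≤ 2², so its L² norm is at most twice the pointwise bound. The denominator is at
-- least c.
lemma Regime.kappa_le {a M : ℝ} (hc : 0 < c) (hd : 0 < d)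
    (hmono : ∀ (s : Side) (x y : ℝ), a ≤ x → x ≤ y → bigF V (s.sgn * x) ≤ bigF V (s.sgn * y))
    (ha : RadiusGE m V f ν ε₁ η (2 * a) lam) (hM0 : 0 ≤ M)
    (hM : ∀ (s : Side) (r : ℝ), 0 ≤ r → r ^ 2 * Real.exp (-d * bigF V (s.sgn * (1 / 2 * r))) ≤
        M * Real.exp (-(d / 2) * bigF V (s.sgn * (1 / 2 * r)))) :
    kappa m V N lam χ ≤ (2 + 3 * C) * (C * |C₀| * M) * 2 / c *
      (kappaBound m V f ν ε₁ η (d / 2) (1 / 2) .minus lam +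
        kappaBound m V f ν ε₁ η (d / 2) (1 / 2) .plus lam) := by
  have hC := hR.const_nonneg
  set B := kappaBound m V f ν ε₁ η (d / 2) (1 / 2) .minus lam +
        kappaBound m V f ν ε₁ η (d / 2) (1 / 2) .plus lam with hBdef
  have hB : 0 ≤ B := add_nonneg (kappaBound_nonneg _ _ _) (kappaBound_nonneg _ _ _)
  set S := transition m V f ν ε₁ η lam .minus ∪ transition m V f ν ε₁ η lam .plus with hS
  have hSm : MeasurableSet S := (measurableSet_transition _).union (measurableSet_transition _)
  have hSv : volume S ≤ ENNReal.ofReal (2 ^ 2) := by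
    refine (measure_union_le _ _).trans ((add_le_add (volume_transition_le hR.radius_ge _)
      (volume_transition_le hR.radius_ge _)).trans ?_)
    rw [one_add_one_eq_two, ← ENNReal.ofReal_ofNat]
    exact ENNReal.ofReal_le_ofReal (by norm_num)
  have key {j : ℕ} (hj : j = 1 ∨ j = 2) {x : ℝ} (hx : iteratedDeriv j χ x ≠ 0) :=
    hR.exp_mul_deriv_le hχ hd hmono ha hM hj hx
  have key' {j : ℕ} (hj : j = 1 ∨ j = 2) {x : ℝ} (hxc : x ∈ core m V f ν ε₁ η lam) :
      ‖k₁ V x * exp (-phase m V N lam x)‖ * |iteratedDeriv j χ x| ≤ C * |C₀| * M * B := by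
    by_cases hx : iteratedDeriv j χ x = 0
    · rw [hx, abs_zero, mul_zero]
      positivity
    · exact (key hj hx).2 hxc
  have t1 : normL2 (resTerm m V N lam fun x => ((iteratedDeriv 2 χ x : ℝ) : ℂ)) ≤
      2 * (C * |C₀| * M * B) * 2 := by
    refine normL2_le_of_support hSm (by positivity) two_pos.le hSv (ae_of_all _ fun x => ?_)
      fun x hx => ?_
    · by_cases hxc : x ∈ core m V f ν ε₁ η lam
      · have h1 := hR.norm_resTerm_le (g := fun x => ((iteratedDeriv 2 χ x : ℝ) : ℂ))
          (K := 2 * |iteratedDeriv 2 χ x|) hxc (by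
            rw [norm_real, Real.norm_eq_abs]
            have := mul_le_mul_of_nonneg_left (hR.one_le_rho hxc) (abs_nonneg (iteratedDeriv 2 χ x))
            linarith)
        have h2 := key' (Or.inr rfl) hxc
        linarith
      · rw [resTerm, (hχ.eq_zero_of_notMem hxc).2.2, ofReal_zero, mul_zero, norm_zero]
        positivity
    · have h0 : iteratedDeriv 2 χ x = 0 := by
        by_contra hcon
        exact hx (key (Or.inr rfl) hcon).1
      rw [resTerm, h0, ofReal_zero, mul_zero]
  have t2 : normL2 (resTerm m V N lam (kappaTwo m V N lam χ)) ≤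
      3 * C * (C * |C₀| * M * B) * 2 := by
    refine normL2_le_of_support hSm (by positivity) two_pos.le hSv ?_ fun x hx => ?_
    · filter_upwards [hR.kappaTwo_le (χ := χ) hA hN] with x hx
      by_cases hxc : x ∈ core m V f ν ε₁ η lam
      · have h1 := hR.norm_resTerm_le (K := 3 * C * |deriv χ x|) hxc (by
          rw [mul_right_comm]
          exact hx hxc)
        have h2 := mul_le_mul_of_nonneg_left (key' (Or.inl rfl) hxc)
          (mul_nonneg (by norm_num : (0 : ℝ) ≤ 3) hC)
        rw [iteratedDeriv_one] at h2
        linarith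
      · rw [resTerm, hχ.kappaTwo_eq_zero hxc, mul_zero, norm_zero]
        positivity
    · have h0 : deriv χ x = 0 := by
        by_contra hcon
        rw [← iteratedDeriv_one] at hcon
        exact hx (key (Or.inl rfl) hcon).1
      rw [resTerm, kappaTwo, h0, ofReal_zero, mul_zero, mul_zero]
  have hden : c ≤ √(normL2 (compOne m V N lam χ) ^ 2 + normL2 (compTwo m V N lam χ) ^ 2) :=
    (hR.le_normL2_compOne hA hN hχ hc hd).trans
      (Real.le_sqrt_of_sq_le (le_add_of_nonneg_right (sq_nonneg _)))
  rw [hR.kappa_eq hχ]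
  calc _ ≤ (2 * (C * |C₀| * M * B) * 2 + 3 * C * (C * |C₀| * M * B) * 2) / c :=
        div_le_div₀ (by positivity) (add_le_add t1 t2) hc hden
    _ = _ := by ring

lemma AssumptionA.kappa_le (hA : AssumptionA V N f μ ε ν) (hN : 1 ≤ N)
    (hε₁ : ε₁ ∈ Set.Ioo (0 : ℝ) 1) (hη : 0 < η) (hc : 0 < c) (hd : 0 < d)
    (hR : ∀ᶠ lam in atBot ⊔ atTop, Regime m V N f ν ε₁ η e C c d lam) {χ : ℝ → ℝ → ℝ}
    (hχ : ∀ᶠ lam in atBot ⊔ atTop, IsCutoff m V f ν ε₁ η C₀ lam (χ lam)) :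
    ∃ K > 0, ∀ᶠ lam : ℝ in atBot ⊔ atTop, kappa m V N lam (χ lam) ≤
      K * (kappaBound m V f ν ε₁ η (d / 2) (1 / 2) .minus lam +
        kappaBound m V f ν ε₁ η (d / 2) (1 / 2) .plus lam) := by
  obtain ⟨a, -, hmono⟩ := hA.exists_bigF_mono
  obtain ⟨M, hM, hM'⟩ := hA.exists_absorb hd
  refine ⟨|(2 + 3 * C) * (C * |C₀| * M) * 2 / c| + 1, by positivity, ?_⟩
  filter_upwards [hR, hχ, hA.eventually_radiusGE (m := m) hε₁ hη (2 * a)] with lam h1 h2 h3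
  refine (h1.kappa_le hA hN h2 hc hd hmono h3 hM.le hM').trans ?_
  refine mul_le_mul_of_nonneg_right ?_
    (add_nonneg (kappaBound_nonneg _ _ _) (kappaBound_nonneg _ _ _))
  linarith [le_abs_self ((2 + 3 * C) * (C * |C₀| * M) * 2 / c)]

lemma AssumptionA.tendsto_kappaBound (hA : AssumptionA V N f μ ε ν)
    (hε₁ : ε₁ ∈ Set.Ioo (0 : ℝ) 1) (hη : 0 < η) {d₁ d₂ : ℝ} (h₁ : 0 < d₁) (h₂ : 0 < d₂)
    (s : Side) : Tendsto (kappaBound m V f ν ε₁ η d₁ d₂ s) (atBot ⊔ atTop) (𝓝 0) := by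
  by_cases hs : NoCut V ν s
  · have : kappaBound m V f ν ε₁ η d₁ d₂ s = fun _ => 0 := funext fun _ => if_pos hs
    rw [this]
    exact tendsto_const_nhds
  · obtain ⟨c₀, hc₀, C₁, hC₁, hF⟩ := hA.exists_bigF_lower
    have hr : Tendsto (fun lam => radius m V f ν ε₁ η s lam) (atBot ⊔ atTop) atTop :=
      tendsto_atTop.2 fun R => (hA.eventually_radiusGE (m := m) hε₁ hη R).mono fun lam h =>
        (h s hs).1
    have h1 : Tendsto (fun lam => d₁ * (c₀ * d₂ * radius m V f ν ε₁ η s lam - C₁))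
        (atBot ⊔ atTop) atTop :=
      (tendsto_atTop_add_const_right _ (-C₁)
        (hr.const_mul_atTop (mul_pos hc₀ h₂))).const_mul_atTop h₁
    refine squeeze_zero' (Eventually.of_forall fun lam => kappaBound_nonneg _ _ _) ?_
      (Real.tendsto_exp_neg_atTop_nhds_zero.comp h1)
    filter_upwards [hA.eventually_radiusGE (m := m) hε₁ hη 0] with lam hl
    rw [kappaBound_eq hs, Function.comp_apply, Real.exp_le_exp]
    have h2 := hF (s.sgn * (d₂ * radius m V f ν ε₁ η s lam))
    rw [abs_mul, s.abs_sgn, one_mul, abs_of_nonneg (mul_nonneg h₂.le (hl s hs).1)] at h2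
    nlinarith

lemma tendsto_rate (ν : Side → ℝ) (hε₁ : ε₁ ∈ Set.Ioo (0 : ℝ) 1) (hN : 1 ≤ N) (s : Side) :
    Tendsto (rate ν ε₁ N s) (atBot ⊔ atTop) (𝓝 0) := by
  have hN' : (1 : ℝ) ≤ N := by exact_mod_cast hN
  unfold rate
  split_ifs
  · exact (tendsto_rpow_neg_atTop (by linarith : (0 : ℝ) < N)).comp tendsto_abs_atTop'
  -- Since N ≥ 1, (1 + ε₁)(N + 1)/2 is at least 1 + ε₁; here ε₁ > 0 is essential when N = 1.
  · have hp : 0 < (1 + ε₁) / 2 * (N + 1) - 1 := by nlinarith [hε₁.1]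
    have := (tendsto_rpow_neg_atTop hp).comp tendsto_abs_atTop'
    refine this.congr fun lam => ?_
    rw [Function.comp_apply]
    congr 1
    ring

/-- The choice of `η₀`. -/
lemma AssumptionA.exists_eta (hA : AssumptionA V N f μ ε ν) :
    ∃ η₀ : ℝ, 0 < η₀ ∧ η₀ ≤ min (μ .minus) (μ .plus) ∧ ∀ η ∈ Set.Ioo 0 η₀,
      2 * η ≤ 1 / 10 ∧ (∀ s, 2 * η ≤ μ s) ∧ ∀ s, ε s < phaseGap (2 * η) μ s := by
  have hgap (s : Side) : ∃ δ > 0, ∀ e : ℝ, |e| < δ → ε s < phaseGap e μ s := by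
    have hc : ContinuousAt (fun e => phaseGap e μ s) 0 := by
      unfold phaseGap
      refine ContinuousAt.div (by fun_prop) (by fun_prop) (by norm_num)
    -- In the limit of small η the gain is exactly 1/2, and ε_± < μ_±/2 ≤ 1/2; continuity then
    -- yields a whole range of η.
    have h0 : ε s < phaseGap 0 μ s := by
      have h1 := (hA.ε_mem s).2
      have h2 := (hA.μ_mem s).2
      have : phaseGap 0 μ s = 1 / 2 := by simp [phaseGap]
      linarith
    obtain ⟨δ, hδ, h⟩ := Metric.eventually_nhds_iff.1 (hc.eventually_const_lt h0)
    exact ⟨δ, hδ, fun e he => h (by simpa using he)⟩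
  choose δ hδ hgap using hgap
  have hμ := hA.μ_mem
  set η₀ := min (min (μ .minus) (μ .plus) / 2) (min (1 / 20) (min (δ .minus) (δ .plus) / 2))
  have hmin : 0 < min (μ .minus) (μ .plus) := lt_min (hμ _).1 (hμ _).1
  have e1 : η₀ ≤ min (μ .minus) (μ .plus) / 2 := min_le_left _ _
  have e2 : η₀ ≤ 1 / 20 := (min_le_right _ _).trans (min_le_left _ _)
  have e3 : η₀ ≤ min (δ .minus) (δ .plus) / 2 := (min_le_right _ _).trans (min_le_right _ _)
  refine ⟨η₀, ?_, by linarith, fun η hη => ⟨by linarith [hη.2], fun s => ?_, fun s => ?_⟩⟩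
  · exact lt_min (half_pos hmin) (lt_min (by norm_num) (half_pos (lt_min (hδ _) (hδ _))))
  · have : min (μ .minus) (μ .plus) ≤ μ s := by
      cases s
      · exact min_le_left _ _
      · exact min_le_right _ _
    linarith [hη.2]
  · refine hgap s _ ?_
    have : min (δ .minus) (δ .plus) ≤ δ s := by
      cases s
      · exact min_le_left _ _
      · exact min_le_right _ _
    rw [abs_of_pos (by linarith [hη.1])]
    linarith [hη.2]

end

end DiracWKB

end

/-! ### Proof of the claim -/

theorem mainTheorem2 (m : ℝ) (hm : 0 ≤ m) (V : ℝ → Matrix (Fin 2) (Fin 2) ℂ) (N : ℕ) (hN : 1 ≤ N)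
    (f : ℝ → ℝ) (μ ε ν : Side → ℝ) (hA : AssumptionA V N f μ ε ν)
    (ε₁ : ℝ) (hε₁ : ε₁ ∈ Set.Ioo (0 : ℝ) 1) :
    ∃ η₀ : ℝ, 0 < η₀ ∧ η₀ ≤ min (μ .minus) (μ .plus) ∧ ∀ η ∈ Set.Ioo 0 η₀,
      -- admissible families of cut-off functions exist
      (∃ (C₀ : ℝ) (χ : ℝ → ℝ → ℝ),
        ∀ᶠ lam in atBot ⊔ atTop, IsCutoff m V f ν ε₁ η C₀ lam (χ lam)) ∧
      -- and every such family yields pseudomodes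
      ∀ (C₀ : ℝ) (χ : ℝ → ℝ → ℝ),
        (∀ᶠ lam in atBot ⊔ atTop, IsCutoff m V f ν ε₁ η C₀ lam (χ lam)) →
        ∃ Ψ : ℝ → (diracOp m V).domain,
          (∀ᶠ lam in atBot ⊔ atTop,
            ((Ψ lam : Hilb) : ℝ → Spinor) =ᵐ[volume] pseudomode m V N lam (χ lam) ∧
              (Ψ lam : Hilb) ≠ 0) ∧
          Tendsto (fun lam : ℝ =>
            ‖diracOp m V (Ψ lam) - (lam : ℂ) • (Ψ lam : Hilb)‖ / ‖(Ψ lam : Hilb)‖)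
            (atBot ⊔ atTop) (𝓝 0) ∧
          (∃ C : ℝ, ∀ᶠ lam : ℝ in atBot ⊔ atTop,
            ‖diracOp m V (Ψ lam) - (lam : ℂ) • (Ψ lam : Hilb)‖ / ‖(Ψ lam : Hilb)‖ ≤
              kappa m V N lam (χ lam) + C * (rate ν ε₁ N .minus lam + rate ν ε₁ N .plus lam)) ∧
          Tendsto (fun lam : ℝ => kappa m V N lam (χ lam)) (atBot ⊔ atTop) (𝓝 0) ∧
          (∃ C > 0, ∃ d₁ > 0, ∃ d₂ > 0, ∀ᶠ lam : ℝ in atBot ⊔ atTop,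
            kappa m V N lam (χ lam) ≤
              C * (kappaBound m V f ν ε₁ η d₁ d₂ .minus lam
                + kappaBound m V f ν ε₁ η d₁ d₂ .plus lam)) := by
  obtain ⟨η₀, hη₀, hle, hη₀'⟩ := hA.exists_eta
  refine ⟨η₀, hη₀, hle, fun η hη => ?_⟩
  obtain ⟨h10, hμ, hgap⟩ := hη₀' η hη
  refine ⟨hA.exists_isCutoff hε₁ hη.1, fun C₀ χ hχ => ?_⟩
  obtain ⟨C, c, d, -, hc, hd, hR⟩ := hA.eventually_regime (m := m) hN hε₁ hη.1 h10 hμ hgap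
  obtain ⟨K, hK, hκ⟩ := hA.kappa_le hN hε₁ hη.1 hc hd hR hχ
  have hκ0 : Tendsto (fun lam : ℝ => kappa m V N lam (χ lam)) (atBot ⊔ atTop) (𝓝 0) := by
    have h0 := ((hA.tendsto_kappaBound (m := m) hε₁ hη.1 (half_pos hd) one_half_pos .minus).add
      (hA.tendsto_kappaBound (m := m) hε₁ hη.1 (half_pos hd) one_half_pos .plus)).const_mul K
    rw [add_zero, mul_zero] at h0
    exact squeeze_zero' (Eventually.of_forall fun lam => kappa_nonneg _ _ _ _ _) hκ h0
  have hrate : Tendsto (fun lam : ℝ => C * (rate ν ε₁ N .minus lam + rate ν ε₁ N .plus lam))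
      (atBot ⊔ atTop) (𝓝 0) := by
    simpa using ((tendsto_rate ν hε₁ hN .minus).add (tendsto_rate ν hε₁ hN .plus)).const_mul C
  have hex : ∀ lam : ℝ, ∃ Ψ : (diracOp m V).domain,
      Regime m V N f ν ε₁ η (2 * η) C c d lam → IsCutoff m V f ν ε₁ η C₀ lam (χ lam) →
        ((Ψ : Hilb) : ℝ → Spinor) =ᵐ[volume] pseudomode m V N lam (χ lam) ∧ (Ψ : Hilb) ≠ 0 ∧
        ‖diracOp m V Ψ - (lam : ℂ) • (Ψ : Hilb)‖ / ‖(Ψ : Hilb)‖ ≤ kappa m V N lam (χ lam) +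
          C * (rate ν ε₁ N .minus lam + rate ν ε₁ N .plus lam) := by
    intro lam
    by_cases h : Regime m V N f ν ε₁ η (2 * η) C c d lam ∧ IsCutoff m V f ν ε₁ η C₀ lam (χ lam)
    · obtain ⟨Ψ, hΨ⟩ := h.1.exists_domain hA hN h.2 hc hd
      exact ⟨Ψ, fun _ _ => hΨ⟩
    -- Where the regime or the cut-off condition fails nothing is asserted, and the zero vector
    -- serves as a default value.
    · exact ⟨0, fun h1 h2 => absurd ⟨h1, h2⟩ h⟩
  choose Ψ hΨ using hex
  have hres : ∀ᶠ lam : ℝ in atBot ⊔ atTop,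
      ‖diracOp m V (Ψ lam) - (lam : ℂ) • (Ψ lam : Hilb)‖ / ‖(Ψ lam : Hilb)‖ ≤
        kappa m V N lam (χ lam) + C * (rate ν ε₁ N .minus lam + rate ν ε₁ N .plus lam) := by
    filter_upwards [hR, hχ] with lam h1 h2 using (hΨ lam h1 h2).2.2
  refine ⟨Ψ, ?_, ?_, ⟨C, hres⟩, hκ0, ⟨K, hK, d / 2, half_pos hd, 1 / 2, one_half_pos, hκ⟩⟩
  · filter_upwards [hR, hχ] with lam h1 h2 using ⟨(hΨ lam h1 h2).1, (hΨ lam h1 h2).2.1⟩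
  · refine squeeze_zero' (Eventually.of_forall fun lam => by positivity) hres ?_
    simpa using hκ0.add hrate
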